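/- Let $d\in\{1,2,3\}$, $\mathbb T^d=(\mathbb R/2\pi\mathbb Z)^d$, $T>0$ and $a\in C^\infty(\mathbb T^d;\mathbb R)$. For $s\ge 0$ let $\|f\|_{H^s}^2=\sum_{k\in\mathbb Z^d}\langle|k|\rangle^{2s}|\hat f(k)|^2$ with $\langle x\rangle=\sqrt{1+x^2}$. For $b\ge 0$ let $X^{s,b}$ be the Bourgain space of functions on $\mathbb R\times\mathbb T^d$ with finite norm $$\|u\|_{X^{s,b}}^2=\sum_{k\in\mathbb Z^d}\int_{\mathbb R}\langle|k|\rangle^{2s}\langle\tau+|k|^2\rangle^{2b}\,|\hat{\hat u}(\tau,k)|^2\,d\tau ,$$ where $\hat{\hat u}$ is the Fourier transform in time and space, and let $X_T^{s,b}$ be the space of restrictions to $(0,T)\times\mathbb T^d$ of elements of $X^{s,b}$, with the norm $\|u\|_{X_T^{s,b}}=\inf\{\|\tilde u\|_{X^{s,b}} : \tilde u=u \text{ in } (0,T)\times\mathbb T^d\}$. There exists a constant $C>0$, depending only on $T$, $d$ and $a$, such that the following holds for all $s\ge1$, $b\in(1/2,1)$, $u_0\in H^s(\mathbb T^d)$ and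 $g\in L^2(0,T;H^s(\mathbb T^d))$. If $u\in X_T^{s,b}$ (identified with its continuous representative on $[0,T]$) satisfies $$i\,\partial_t u=-\Delta u+|u|^2u-i\,a(x)\,u+g\quad\text{in }(0,T)\times\mathbb T^d,\qquad u(0,\cdot)=u_0,$$ the equation being understood in the sense of distributions, then the energy $$E(t)=\frac12\int_{\mathbb T^d}|u(t,x)|^2dx+\frac12\int_{\mathbb T^d}|\nabla u(t,x)|^2dx+\frac14\int_{\mathbb T^d}|u(t,x)|^4dx$$ is finite and satisfies $$E(t)\le C\Big(E(0)+\|g\|_{L^2(0,T;H^1(\mathbb T^d))}^2+\|g\|_{L^2(0,T;H^1(\mathbb T^d))}^4\Big)\qquad\text{for all }t\in[0,T].$$ -/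

import Mathlib

open MeasureTheory Set
open scoped ENNReal ContDiff

noncomputable section

namespace DampedNLS

instance factTwoPiPos : Fact (0 < 2 * Real.pi) := ⟨Real.two_pi_pos⟩

/-- The torus `(ℝ / 2πℤ)^d`; its `volume` is the product Lebesgue measure, of total mass `(2π)^d`. -/
abbrev Torus (d : ℕ) : Type := Fin d → AddCircle (2 * Real.pi)

/-- The Hilbert space `L²(𝕋^d; ℂ)`. -/
abbrev L2 (d : ℕ) : Type := Lp ℂ 2 (volume : Measure (Torus d))

/-! ### Smooth functions on the torus and their partial derivatives -/

/-- The projection `ℝ^d → 𝕋^d`. -/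
def proj {d : ℕ} (y : Fin d → ℝ) : Torus d := fun j => (y j : AddCircle (2 * Real.pi))

/-- `ψ ∈ C^∞(𝕋^d)`: its periodic lift to `ℝ^d` is smooth. -/
def IsSmooth {d : ℕ} {E : Type*} [NormedAddCommGroup E] [NormedSpace ℝ E] (ψ : Torus d → E) :
    Prop :=
  ContDiff ℝ ∞ (fun y : Fin d → ℝ => ψ (proj y))

/-- The classical partial derivative `∂_j ψ`. -/
def partialDeriv {d : ℕ} (j : Fin d) (ψ : Torus d → ℂ) (x : Torus d) : ℂ :=
  deriv (fun h : ℝ => ψ (x + Pi.single j (h : AddCircle (2 * Real.pi)))) 0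

/-- The classical Laplacian `Δψ = ∑ⱼ ∂_j ∂_j ψ`. -/
def laplacian {d : ℕ} (ψ : Torus d → ℂ) (x : Torus d) : ℂ :=
  ∑ j : Fin d, partialDeriv j (partialDeriv j ψ) x

/-- `φ ∈ C_c^∞((0,T) × 𝕋^d; ℂ)`. (The torus is compact, so compact support means that the time
support, a closed set, lies in the bounded open interval `(0,T)`.) -/
def IsTestFunction {d : ℕ} (T : ℝ) (φ : ℝ → Torus d → ℂ) : Prop :=
  ContDiff ℝ ∞ (fun p : ℝ × (Fin d → ℝ) => φ p.1 (proj p.2)) ∧ tsupport φ ⊆ Ioo 0 T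

/-! ### Fourier coefficients and Sobolev spaces -/

/-- The character `x ↦ e^{i k·x}` of the torus. -/
def character {d : ℕ} (k : Fin d → ℤ) (x : Torus d) : ℂ := ∏ j, fourier (k j) (x j)

/-- The Fourier coefficient `f̂(k) = (2π)^{-d} ∫ f(x) e^{-i k·x} dx`. -/
def coeff {d : ℕ} (f : L2 d) (k : Fin d → ℤ) : ℂ :=
  ((2 * Real.pi : ℝ) ^ d : ℝ)⁻¹ • ∫ x, f x * character (-k) x

/-- The Japanese bracket `⟨x⟩ = √(1 + x²)`. -/
def bracket (x : ℝ) : ℝ := Real.sqrt (1 + x ^ 2)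

/-- The squared Euclidean length `|k|²` of a frequency. -/
def freqSq {d : ℕ} (k : Fin d → ℤ) : ℝ := ∑ j, (k j : ℝ) ^ 2

/-- The squared norm `‖f‖²_{H^s} = ∑_k ⟨|k|⟩^{2s} |f̂(k)|²` of `f ∈ L²(𝕋^d)`, with value `∞` when
`f ∉ H^s`. For `s ≥ 0` the space `H^s(𝕋^d)` is the set of `f ∈ L²(𝕋^d)` where it is finite. -/
def sobolevNormSq {d : ℕ} (s : ℝ) (f : L2 d) : ℝ≥0∞ :=
  ∑' k : Fin d → ℤ, ENNReal.ofReal (bracket (Real.sqrt (freqSq k)) ^ (2 * s)) * ‖coeff f k‖ₑ ^ 2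

/-- `f ∈ H^s(𝕋^d)`, `s ≥ 0`. -/
def MemSobolev {d : ℕ} (s : ℝ) (f : L2 d) : Prop := sobolevNormSq s f < ⊤

/-- The norm of `L²(0,T; H^s(𝕋^d))`, with value `∞` when the square of the `H^s` norm is not
integrable. -/
def l2SobolevNorm {d : ℕ} (T s : ℝ) (g : ℝ → L2 d) : ℝ≥0∞ :=
  (∫⁻ t in Ioo 0 T, sobolevNormSq s (g t)) ^ (1 / 2 : ℝ)

/-- `g ∈ L²(0,T; H^s(𝕋^d))`, `s ≥ 0`. -/
def MemL2Sobolev {d : ℕ} (T s : ℝ) (g : ℝ → L2 d) : Prop :=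
  AEStronglyMeasurable g (volume.restrict (Ioo 0 T)) ∧ l2SobolevNorm T s g < ⊤

/-! ### Bourgain spaces

For `s, b ≥ 0` the space `X^{s,b}` is contained in `L²(ℝ × 𝕋^d) = L²(ℝ; L²(𝕋^d))`. -/

/-- The Fourier transform in time and space: `û̂(τ, k)` is the `k`-th Fourier coefficient of the
(Plancherel) time Fourier transform `∫ e^{-iτt} u(t) dt`. Mathlib's transform is
`𝓕 u (ξ) = ∫ e^{-2πi ξ t} u(t) dt`, so it is evaluated at `ξ = τ / 2π`. -/
def spacetimeFourier {d : ℕ} (u : Lp (L2 d) 2 (volume : Measure ℝ)) (τ : ℝ) (k : Fin d → ℤ) : ℂ :=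
  coeff ((FourierTransform.fourier u : Lp (L2 d) 2 (volume : Measure ℝ)) (τ / (2 * Real.pi))) k

/-- The norm of `X^{s,b}`, given by
`‖u‖² = ∑_k ∫ ⟨|k|⟩^{2s} ⟨τ + |k|²⟩^{2b} |û̂(τ, k)|² dτ`, with value `∞` when `u ∉ X^{s,b}`. -/
def bourgainNorm {d : ℕ} (s b : ℝ) (u : Lp (L2 d) 2 (volume : Measure ℝ)) : ℝ≥0∞ :=
  (∑' k : Fin d → ℤ, ∫⁻ τ : ℝ,
    ENNReal.ofReal (bracket (Real.sqrt (freqSq k)) ^ (2 * s) * bracket (τ + freqSq k) ^ (2 * b)) *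
      ‖spacetimeFourier u τ k‖ₑ ^ 2) ^ (1 / 2 : ℝ)

/-- The norm of the restriction space `X_T^{s,b}`: the infimum of `‖ũ‖_{X^{s,b}}` over all `ũ` with
`ũ = u` (almost everywhere) in `(0,T) × 𝕋^d`. -/
def restrictedBourgainNorm {d : ℕ} (T s b : ℝ) (u : ℝ → L2 d) : ℝ≥0∞ :=
  ⨅ v : {v : Lp (L2 d) 2 (volume : Measure ℝ) // ∀ᵐ t ∂(volume.restrict (Ioo 0 T)), v t = u t},
    bourgainNorm s b v.1

/-- `u ∈ X_T^{s,b}`, `s, b ≥ 0`. -/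
def MemBourgain {d : ℕ} (T s b : ℝ) (u : ℝ → L2 d) : Prop := restrictedBourgainNorm T s b u < ⊤

/-! ### The energy -/

/-- `v = (v₁, …, v_d)` is the weak gradient of `f`. It is unique if it exists. -/
def IsWeakGradient {d : ℕ} (f : L2 d) (v : Fin d → L2 d) : Prop :=
  ∀ (j : Fin d) (ψ : Torus d → ℂ), IsSmooth ψ →
    ∫ x, f x * partialDeriv j ψ x = -∫ x, v j x * ψ x

/-- The Dirichlet integral `∫ |∇f|² dx`, with value `∞` when `f` has no weak gradient in `L²`. -/
def dirichlet {d : ℕ} (f : L2 d) : ℝ≥0∞ :=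
  ⨅ v : {v : Fin d → L2 d // IsWeakGradient f v}, ∫⁻ x, ∑ j, ‖v.1 j x‖ₑ ^ 2

/-- The total energy `½ ∫ |f|² + ½ ∫ |∇f|² + ¼ ∫ |f|⁴`. -/
def energy {d : ℕ} (f : L2 d) : ℝ≥0∞ :=
  1 / 2 * (∫⁻ x, ‖f x‖ₑ ^ 2) + 1 / 2 * dirichlet f + 1 / 4 * (∫⁻ x, ‖f x‖ₑ ^ 4)

/-! ### The equation -/

/-- `u ∈ X_T^{s,b}` solves, on `(0,T) × 𝕋^d`, the Cauchy problem
`i ∂_t u = -Δu + |u|² u - i a(x) u + g`, `u(0) = u₀`. The equation holds in the sense of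
distributions. As usual for `b > 1/2`, `u` stands for its continuous representative on `[0,T]`, so
that `u(t)` is meaningful for each `t ∈ [0,T]`. -/
structure IsBourgainSolution {d : ℕ} (T s b : ℝ) (a : Torus d → ℝ) (g : ℝ → L2 d) (u₀ : L2 d)
    (u : ℝ → L2 d) : Prop where
  memBourgain : MemBourgain T s b u
  continuousOn : ContinuousOn u (Icc 0 T)
  initial : u 0 = u₀
  equation : ∀ φ : ℝ → Torus d → ℂ, IsTestFunction T φ →
    ∫ t in Ioo 0 T, ∫ x, u t x * (-(Complex.I * deriv (fun r => φ r x) t)) =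
      ∫ t in Ioo 0 T, ∫ x, (-(u t x * laplacian (φ t) x) +
        ((‖u t x‖ ^ 2 : ℝ) * u t x - Complex.I * a x * u t x + g t x) * φ t x)

end DampedNLS

end

open Filter
open scoped ComplexConjugate Topology

noncomputable section

namespace DampedNLS

/-! Formally this is the energy method. Pair the equation with the derivative `u - Δu + |u|²u` of
the energy. The Hamiltonian part contributes nothing, and the damping and the forcing contribute at
most `c₁ E + c₂ (E^(1/2) + E^(3/4)) ‖g‖_{H¹}`. A Gronwall argument for such sublinear terms
(`gronwall_sublinear`) then gives the bound. The difficulty is that `u` may be no better than `H¹`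
in space, so the pairing of `Δu` with the equation has no direct meaning.

The computation is therefore made for the Fourier truncation of `u` to a box. Each Fourier
coefficient of `u` is a primitive of an integrable function (`isPrimitive_coeff`), so the truncated
energy satisfies an exact identity (`WaveData.truncEnergy_eq`). The Hamiltonian part of the
truncated equation still drops out (`re_energyPairing_hamiltonian`). The price of the truncation is
one error term: the derivative of the truncated energy, paired with the difference between the
nonlinearity of `u` and that of its truncation. The heart of the proof is that the time integral of
this error is at most a constant times the square root of the squared `X^{1,b}` norm of the
discarded modes (`WaveData.lintegral_energyError_le`).

This estimate rests on a bilinear bound: the `L²((0,T) × 𝕋^d)` norm of a product is controlled by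
the `X^{1,b}` norm of one factor and the `X^{0,b}` norm of the other (`lintegral_wave_mul_wave_le`).
In the `H¹` part of the error, four functions are multiplied and two of them are differentiated; the
factors are paired so that each pair contains one derivative. The part where two cubic terms meet is
handled by a trilinear `L²` bound (`WaveData.lintegral_trilinear`), which follows from the bilinear
one and the embedding `H¹ ⊂ L⁴`.

For `b > 1/2` an element of `X^{1,b}` is a superposition of free solutions modulated by `e^{itσ}`,
so the bilinear bound reduces to free solutions. For these, space-time orthogonality reduces it to
counting the lattice points `k` with `|k|² + |n - k|² = m`, which lie on a sphere. A sphere has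
`O(R^{5/3})` lattice points in a box of side `R` (`card_sphere_le`), and this is beaten by the
weight `⟨k⟩^{-2}`. The count comes from an elementary argument with chords of plane circles
(`card_upper_quarter_le`).

The truncation is removed in `WaveData.Represents.energy_le`. The quantities that depend on `b` and
on `u` serve only to send the error to zero and to know that the energy is bounded; the final
constant is built from `d`, `T` and `a` alone. -/

/-! ### Characters of the torus -/

/-- The volume `(2π)^d` of the torus. -/
def vol (d : ℕ) : ℝ := (2 * Real.pi) ^ d

lemma vol_pos (d : ℕ) : 0 < vol d := pow_pos Real.two_pi_pos d

lemma vol_ne_zero (d : ℕ) : vol d ≠ 0 := (vol_pos d).ne'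

variable {d : ℕ}

@[fun_prop]
lemma continuous_character (k : Fin d → ℤ) : Continuous (character k) := by
  unfold character
  fun_prop

lemma norm_character (k : Fin d → ℤ) (x : Torus d) : ‖character k x‖ = 1 := by
  simp only [character, norm_prod, fourier_apply, Circle.norm_coe, Finset.prod_const_one]

lemma character_add (k l : Fin d → ℤ) (x : Torus d) :
    character (k + l) x = character k x * character l x := by
  simp only [character, Pi.add_apply, fourier_add, Finset.prod_mul_distrib]

lemma character_neg (k : Fin d → ℤ) (x : Torus d) :
    character (-k) x = conj (character k x) := by
  simp only [character, Pi.neg_apply, fourier_neg, map_prod]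

@[simp] lemma character_zero (x : Torus d) : character 0 x = 1 := by
  simp [character]

lemma integral_fourier_circle (n : ℤ) :
    ∫ x : AddCircle (2 * Real.pi), fourier n x = if n = 0 then ((2 * Real.pi : ℝ) : ℂ) else 0 := by
  have h := (orthonormal_iff_ite.mp (orthonormal_fourier (T := 2 * Real.pi))) 0 n
  rw [ContinuousMap.inner_toLp] at h
  simp only [← fourier_neg] at h
  rw [AddCircle.volume_eq_smul_haarAddCircle, integral_smul_measure]
  have h2 : ∫ x : AddCircle (2 * Real.pi), fourier n x ∂AddCircle.haarAddCircle
      = if n = 0 then 1 else 0 := by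
    rw [← ite_congr (propext (eq_comm (a := (0:ℤ)) (b := n))) (fun _ => rfl) (fun _ => rfl), ← h]
    simp
  rw [h2, ENNReal.toReal_ofReal Real.two_pi_pos.le]
  split_ifs <;> simp

lemma integral_character (k : Fin d → ℤ) :
    ∫ x, character k x = if k = 0 then ((vol d : ℝ) : ℂ) else 0 := by
  unfold character
  rw [MeasureTheory.integral_fintype_prod_volume_eq_prod (fun j x => fourier (k j) x)]
  simp only [integral_fourier_circle]
  split_ifs with h
  · subst h
    simp [vol]
  · obtain ⟨i, hi⟩ := Function.ne_iff.mp h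
    exact Finset.prod_eq_zero (Finset.mem_univ i) (by simpa using hi)

lemma integral_character_mul_conj (k l : Fin d → ℤ) :
    ∫ x, character k x * conj (character l x) = if k = l then ((vol d : ℝ) : ℂ) else 0 := by
  simp only [← character_neg, ← character_add, integral_character]
  congr 1
  rw [← sub_eq_add_neg, sub_eq_zero]

lemma integrable_of_continuous {E : Type*} [NormedAddCommGroup E]
    {F : Torus d → E} (hF : Continuous F) : Integrable F :=
  hF.integrable_of_hasCompactSupport (HasCompactSupport.of_compactSpace F)

lemma memLp_of_continuous {E : Type*} [NormedAddCommGroup E] {p : ℝ≥0∞}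
    {F : Torus d → E} (hF : Continuous F) : MemLp F p :=
  hF.memLp_of_hasCompactSupport (HasCompactSupport.of_compactSpace F)

/-! ### Fourier coefficients and trigonometric polynomials -/

/-- The Fourier coefficient of a function on the torus. -/
def fcoeff (F : Torus d → ℂ) (k : Fin d → ℤ) : ℂ :=
  ((2 * Real.pi : ℝ) ^ d : ℝ)⁻¹ • ∫ x, F x * character (-k) x

lemma coeff_eq_fcoeff (f : L2 d) (k : Fin d → ℤ) : coeff f k = fcoeff f k := rfl

lemma fcoeff_def (F : Torus d → ℂ) (k : Fin d → ℤ) :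
    fcoeff F k = ((vol d : ℝ) : ℂ)⁻¹ * ∫ x, F x * character (-k) x := by
  simp [fcoeff, vol]

lemma vol_mul_fcoeff (F : Torus d → ℂ) (k : Fin d → ℤ) :
    ((vol d : ℝ) : ℂ) * fcoeff F k = ∫ x, F x * character (-k) x := by
  rw [fcoeff_def, mul_inv_cancel_left₀]
  exact_mod_cast vol_ne_zero d

lemma integrable_mul_character {F : Torus d → ℂ} (hF : Integrable F) (k : Fin d → ℤ) :
    Integrable (fun x => F x * character k x) :=
  hF.mul_bdd (continuous_character k).aestronglyMeasurable (c := 1)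
    (ae_of_all _ fun x => (norm_character k x).le)

lemma fcoeff_congr {F G : Torus d → ℂ} (h : F =ᵐ[volume] G) (k : Fin d → ℤ) :
    fcoeff F k = fcoeff G k := by
  rw [fcoeff_def, fcoeff_def, integral_congr_ae]
  filter_upwards [h] with x hx
  rw [hx]

lemma fcoeff_add {F G : Torus d → ℂ} (hF : Integrable F) (hG : Integrable G) (k : Fin d → ℤ) :
    fcoeff (fun x => F x + G x) k = fcoeff F k + fcoeff G k := by
  simp only [fcoeff_def, add_mul]
  rw [integral_add (integrable_mul_character hF _) (integrable_mul_character hG _), mul_add]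

lemma fcoeff_sub {F G : Torus d → ℂ} (hF : Integrable F) (hG : Integrable G) (k : Fin d → ℤ) :
    fcoeff (fun x => F x - G x) k = fcoeff F k - fcoeff G k := by
  simp only [fcoeff_def, sub_mul]
  rw [integral_sub (integrable_mul_character hF _) (integrable_mul_character hG _), mul_sub]

lemma fcoeff_const_mul (c : ℂ) (F : Torus d → ℂ) (k : Fin d → ℤ) :
    fcoeff (fun x => c * F x) k = c * fcoeff F k := by
  simp only [fcoeff_def, mul_assoc]
  rw [integral_const_mul]
  ring

lemma norm_fcoeff_le {F : Torus d → ℂ} (k : Fin d → ℤ) :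
    ‖fcoeff F k‖ ≤ (vol d)⁻¹ * ∫ x, ‖F x‖ := by
  rw [fcoeff_def, norm_mul, norm_inv, Complex.norm_real, Real.norm_of_nonneg (vol_pos d).le]
  refine mul_le_mul_of_nonneg_left ?_ (inv_nonneg.mpr (vol_pos d).le)
  refine (norm_integral_le_integral_norm _).trans_eq ?_
  simp [norm_character]

/-- The trigonometric polynomial with frequencies in `S` and coefficients `c`. -/
def trig (S : Finset (Fin d → ℤ)) (c : (Fin d → ℤ) → ℂ) (x : Torus d) : ℂ :=
  ∑ k ∈ S, c k * character k x

@[fun_prop]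
lemma continuous_trig (S : Finset (Fin d → ℤ)) (c : (Fin d → ℤ) → ℂ) : Continuous (trig S c) := by
  unfold trig
  fun_prop

lemma fcoeff_trig (S : Finset (Fin d → ℤ)) (c : (Fin d → ℤ) → ℂ) (l : Fin d → ℤ) :
    fcoeff (trig S c) l = if l ∈ S then c l else 0 := by
  have h0 : ((vol d : ℝ) : ℂ) ≠ 0 := by exact_mod_cast vol_ne_zero d
  rw [fcoeff_def]
  simp only [trig, Finset.sum_mul, character_neg]
  rw [integral_finsetSum _ fun k _ => integrable_of_continuous (by fun_prop)]
  simp only [mul_assoc, integral_const_mul, integral_character_mul_conj]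
  simp only [mul_ite, mul_zero, Finset.sum_ite_eq']
  split_ifs
  · field_simp
  · simp

/-- Pairing a trigonometric polynomial with an integrable function. -/
lemma integral_conj_trig_mul {F : Torus d → ℂ} (hF : Integrable F) (S : Finset (Fin d → ℤ))
    (c : (Fin d → ℤ) → ℂ) :
    ∫ x, conj (trig S c x) * F x = (vol d : ℂ) * ∑ k ∈ S, conj (c k) * fcoeff F k := by
  simp only [trig, map_sum, map_mul, Finset.sum_mul, Finset.mul_sum, ← character_neg]
  rw [integral_finsetSum]
  · refine Finset.sum_congr rfl fun k _ => ?_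
    rw [mul_left_comm, vol_mul_fcoeff, ← integral_const_mul]
    congr 1 with x
    ring
  · intro k _
    have := (integrable_mul_character hF (-k)).const_mul (conj (c k))
    refine this.congr (ae_of_all _ fun x => ?_)
    ring

/-! ### Completeness of the characters -/

/-- The character as a continuous map. -/
def characterMap (k : Fin d → ℤ) : C(Torus d, ℂ) := ⟨character k, continuous_character k⟩

/-- The star subalgebra of `C(𝕋^d, ℂ)` generated by the characters. -/
def characterSubalgebra (d : ℕ) : StarSubalgebra ℂ C(Torus d, ℂ) where
  toSubalgebra := Algebra.adjoin ℂ (range characterMap)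
  star_mem' := by
    change Algebra.adjoin ℂ (range characterMap) ≤ star (Algebra.adjoin ℂ (range characterMap))
    refine Algebra.adjoin_le ?_
    rintro _ ⟨n, rfl⟩
    refine Algebra.subset_adjoin ⟨-n, ?_⟩
    ext1 x
    simp [characterMap, character_neg, ContinuousMap.star_apply]

/-- The characters contain `1` and are closed under products, so adjoining them as an algebra adds
nothing to their linear span. -/
lemma characterSubalgebra_coe :
    (characterSubalgebra d).toSubalgebra.toSubmodule = Submodule.span ℂ (range characterMap) := by
  apply Algebra.adjoin_eq_span_of_subset
  refine .trans (fun x ↦ Submonoid.closure_induction (fun _ ↦ id) ⟨0, ?_⟩ ?_)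
    Submodule.subset_span
  · ext z
    simp [characterMap]
  · rintro _ _ _ _ ⟨m, rfl⟩ ⟨n, rfl⟩
    refine ⟨m + n, ?_⟩
    ext z
    simp [characterMap, character_add]

lemma character_single (i : Fin d) (x : Torus d) : character (Pi.single i 1) x = fourier 1 (x i) := by
  rw [character, Finset.prod_eq_single i]
  · simp
  · intro j _ hj
    simp [Pi.single_eq_of_ne hj]
  · simp

lemma characterSubalgebra_separatesPoints : (characterSubalgebra d).SeparatesPoints := by
  intro x y hxy
  rw [Ne, funext_iff, not_forall] at hxy
  obtain ⟨i, hi⟩ := hxy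
  refine ⟨_, ⟨characterMap (Pi.single i 1), Algebra.subset_adjoin ⟨Pi.single i 1, rfl⟩, rfl⟩, ?_⟩
  change character _ x ≠ character _ y
  rw [character_single, character_single, fourier_one, fourier_one]
  contrapose hi
  exact AddCircle.injective_toCircle Real.two_pi_pos.ne' (Circle.ext hi)

/-- Stone–Weierstrass; points are already separated by the characters of the coordinate frequencies.
-/
lemma span_characterMap_closure_eq_top :
    (Submodule.span ℂ (range (characterMap (d := d)))).topologicalClosure = ⊤ := by
  rw [← characterSubalgebra_coe]
  exact congr_arg (Subalgebra.toSubmodule <| StarSubalgebra.toSubalgebra ·)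
    (ContinuousMap.starSubalgebra_topologicalClosure_eq_top_of_separatesPoints _
      (characterSubalgebra_separatesPoints (d := d)))

/-- The character as an element of `L²`. -/
def characterL2 (k : Fin d → ℤ) : L2 d := ContinuousMap.toLp (E := ℂ) 2 volume ℂ (characterMap k)

lemma coeFn_characterL2 (k : Fin d → ℤ) : characterL2 k =ᵐ[volume] character k :=
  ContinuousMap.coeFn_toLp volume (characterMap k)

lemma span_characterL2_closure_eq_top :
    (Submodule.span ℂ (range (characterL2 (d := d)))).topologicalClosure = ⊤ := by
  have := (ContinuousMap.toLp_denseRange (p := 2) ℂ (volume : Measure (Torus d)) ℂ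
    (by simp)).topologicalClosure_map_submodule span_characterMap_closure_eq_top
  rw [Submodule.map_span, ContinuousLinearMap.coe_coe, ← range_comp] at this
  exact this

lemma inner_characterL2 (k : Fin d → ℤ) (f : L2 d) :
    inner ℂ (characterL2 k) f = (vol d : ℂ) * coeff f k := by
  rw [coeff_eq_fcoeff, vol_mul_fcoeff, L2.inner_def]
  refine integral_congr_ae ?_
  filter_upwards [coeFn_characterL2 k] with x hx
  rw [hx, character_neg]
  simp [mul_comm]

lemma coeff_characterL2 (k l : Fin d → ℤ) :
    coeff (characterL2 k) l = if l = k then 1 else 0 := by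
  have h : fcoeff (characterL2 k) l = fcoeff (trig {k} fun _ => 1) l := by
    refine fcoeff_congr ?_ l
    filter_upwards [coeFn_characterL2 k] with x hx
    simp [hx, trig]
  rw [coeff_eq_fcoeff, h, fcoeff_trig]
  simp

/-- The normalised characters form a Hilbert basis of `L²(𝕋^d)`. -/
def characterBasis (d : ℕ) : HilbertBasis (Fin d → ℤ) ℂ (L2 d) :=
  HilbertBasis.mk (v := fun k => ((Real.sqrt (vol d) : ℂ))⁻¹ • characterL2 k)
    (by
      have h0 : ((vol d : ℝ) : ℂ) ≠ 0 := by exact_mod_cast vol_ne_zero d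
      rw [orthonormal_iff_ite]
      intro k l
      rw [inner_smul_left, inner_smul_right, inner_characterL2, coeff_characterL2]
      by_cases h : k = l
      · subst h
        have hs : (Real.sqrt (vol d) : ℂ) * (Real.sqrt (vol d) : ℂ) = (vol d : ℂ) := by
          exact_mod_cast Real.mul_self_sqrt (vol_pos d).le
        have hs0 : (Real.sqrt (vol d) : ℂ) ≠ 0 := by
          intro h'; rw [h', zero_mul] at hs; exact h0 hs.symm
        simp only [map_inv₀, Complex.conj_ofReal, if_true, mul_one]
        field_simp
        rw [sq, hs]
      · simp [h])
    (by
      have hs0 : (Real.sqrt (vol d) : ℂ) ≠ 0 := by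
        exact_mod_cast (Real.sqrt_pos.mpr (vol_pos d)).ne'
      rw [← span_characterL2_closure_eq_top (d := d)]
      refine Submodule.topologicalClosure_mono (Submodule.span_le.mpr ?_)
      rintro _ ⟨k, rfl⟩
      have : characterL2 k =
          (Real.sqrt (vol d) : ℂ) • ((Real.sqrt (vol d) : ℂ))⁻¹ • characterL2 k := by
        rw [smul_smul, mul_inv_cancel₀ hs0, one_smul]
      rw [this]
      exact Submodule.smul_mem _ _ (Submodule.subset_span ⟨k, rfl⟩))

lemma characterBasis_apply (k : Fin d → ℤ) :
    characterBasis d k = ((Real.sqrt (vol d) : ℂ))⁻¹ • characterL2 k := by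
  simp [characterBasis]

lemma characterBasis_repr (f : L2 d) (k : Fin d → ℤ) :
    (characterBasis d).repr f k = (Real.sqrt (vol d) : ℂ) * coeff f k := by
  have hs : (Real.sqrt (vol d) : ℂ) * (Real.sqrt (vol d) : ℂ) = (vol d : ℂ) := by
    exact_mod_cast Real.mul_self_sqrt (vol_pos d).le
  have hs0 : (Real.sqrt (vol d) : ℂ) ≠ 0 := by
    exact_mod_cast (Real.sqrt_pos.mpr (vol_pos d)).ne'
  rw [HilbertBasis.repr_apply_apply, characterBasis_apply, inner_smul_left, inner_characterL2]
  simp only [map_inv₀, Complex.conj_ofReal]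
  rw [← hs]
  field_simp

lemma hasSum_coeff_smul (f : L2 d) : HasSum (fun k => coeff f k • characterL2 k) f := by
  have h := (characterBasis d).hasSum_repr f
  have hs0 : (Real.sqrt (vol d) : ℂ) ≠ 0 := by
    exact_mod_cast (Real.sqrt_pos.mpr (vol_pos d)).ne'
  convert h using 2 with k
  rw [characterBasis_repr, characterBasis_apply, smul_smul]
  congr 1
  field_simp

/-- Parseval's identity. -/
lemma hasSum_norm_coeff_sq (f : L2 d) : HasSum (fun k => vol d * ‖coeff f k‖ ^ 2) (‖f‖ ^ 2) := by
  have h := lp.hasSum_norm (p := 2) (by simp) ((characterBasis d).repr f)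
  simp only [characterBasis_repr, LinearIsometryEquiv.norm_map, ENNReal.toReal_ofNat,
    Real.rpow_ofNat, norm_mul, mul_pow, Complex.norm_real, Real.norm_eq_abs, sq_abs,
    Real.sq_sqrt (vol_pos d).le] at h
  exact h

/-- Two elements of `L²` with the same Fourier coefficients are equal. -/
lemma ext_coeff {f g : L2 d} (h : ∀ k, coeff f k = coeff g k) : f = g := by
  have h1 := hasSum_coeff_smul f
  simp only [h] at h1
  exact h1.unique (hasSum_coeff_smul g)

/-- Riesz–Fischer. -/
lemma exists_coeff_eq {c : (Fin d → ℤ) → ℂ} (hc : Summable fun k => ‖c k‖ ^ 2) :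
    ∃ f : L2 d, ∀ k, coeff f k = c k := by
  have hs0 : (Real.sqrt (vol d) : ℂ) ≠ 0 := by
    exact_mod_cast (Real.sqrt_pos.mpr (vol_pos d)).ne'
  have hm : Memℓp (fun k => (Real.sqrt (vol d) : ℂ) * c k) 2 := by
    rw [memℓp_gen_iff (by simp)]
    simpa [mul_pow] using hc.mul_left ((Real.sqrt (vol d)) ^ 2)
  refine ⟨(characterBasis d).repr.symm ⟨_, hm⟩, fun k => ?_⟩
  have h := characterBasis_repr ((characterBasis d).repr.symm ⟨_, hm⟩) k
  rw [LinearIsometryEquiv.apply_symm_apply] at h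
  exact (mul_left_cancel₀ hs0 h).symm

/-- The `k`-th Fourier coefficient as a continuous linear functional. -/
def coeffCLM (k : Fin d → ℤ) : L2 d →L[ℂ] ℂ := ((vol d : ℂ))⁻¹ • innerSL ℂ (characterL2 k)

lemma coeffCLM_apply (k : Fin d → ℤ) (f : L2 d) : coeffCLM k f = coeff f k := by
  have h0 : ((vol d : ℝ) : ℂ) ≠ 0 := by exact_mod_cast vol_ne_zero d
  simp [coeffCLM, inner_characterL2, h0]

/-- The boxes `{|k_j| ≤ N}` exhaust the lattice. -/
def box (d N : ℕ) : Finset (Fin d → ℤ) := Finset.Icc (fun _ => -(N : ℤ)) (fun _ => (N : ℤ))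

lemma mem_box {N : ℕ} {k : Fin d → ℤ} : k ∈ box d N ↔ ∀ j, |k j| ≤ N := by
  simp only [box, Finset.mem_Icc, Pi.le_def, abs_le, forall_and]

lemma box_mono : Monotone (box d) := by
  intro M N h k hk
  rw [mem_box] at hk ⊢
  exact fun j => (hk j).trans (by exact_mod_cast h)

lemma tendsto_box : Tendsto (box d) atTop atTop := by
  refine tendsto_atTop_finset_of_monotone box_mono fun k => ⟨∑ j, (k j).natAbs, ?_⟩
  rw [mem_box]
  intro j
  have : (k j).natAbs ≤ ∑ j, (k j).natAbs :=
    Finset.single_le_sum (f := fun j => (k j).natAbs) (fun _ _ => Nat.zero_le _) (Finset.mem_univ j)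
  rw [Int.abs_eq_natAbs]
  exact_mod_cast this

/-- The trigonometric polynomial `trig S c` as an element of `L²`. -/
def trigL2 (S : Finset (Fin d → ℤ)) (c : (Fin d → ℤ) → ℂ) : L2 d := ∑ k ∈ S, c k • characterL2 k

lemma coeFn_trigL2 (S : Finset (Fin d → ℤ)) (c : (Fin d → ℤ) → ℂ) :
    trigL2 S c =ᵐ[volume] trig S c := by
  have h1 : ∀ k, ∀ᵐ x, (c k • characterL2 k : L2 d) x = c k * character k x := fun k => by
    filter_upwards [Lp.coeFn_smul (c k) (characterL2 (d := d) k), coeFn_characterL2 k] with x h h'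
    rw [h, Pi.smul_apply, h', smul_eq_mul]
  have h2 := Lp.coeFn_finsetSum (p := 2) (μ := (volume : Measure (Torus d))) S
    (fun k => c k • characterL2 k)
  filter_upwards [h2, ae_all_iff.mpr h1] with x h h'
  rw [trigL2, h, Finset.sum_apply]
  simp only [h', trig]

lemma tendsto_trigL2_coeff (f : L2 d) :
    Tendsto (fun N => trigL2 (box d N) (coeff f)) atTop (𝓝 f) :=
  (hasSum_coeff_smul f).comp tendsto_box

/-! ### Lattice points on circles and spheres -/

/-- Distinct points of the upper quarter of a circle are joined by chords of slope less than one. -/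
lemma abs_sub_lt_of_upper_quarter {M X Y X' Y' : ℤ} (h : X ^ 2 + Y ^ 2 = M)
    (h' : X' ^ 2 + Y' ^ 2 = M) (hY : |X| ≤ Y) (hY' : |X'| ≤ Y') (hne : ¬(X = X' ∧ Y = Y')) :
    |Y - Y'| < |X - X'| := by
  by_contra! hcon
  have hX : X ≠ X' := by
    rintro rfl
    have h2 : Y ^ 2 = Y' ^ 2 := by linarith
    have h3 := abs_nonneg X
    exact hne ⟨rfl, (sq_eq_sq₀ (h3.trans hY) (h3.trans hY')).mp h2⟩
  have hpos : 0 < |X - X'| := abs_pos.mpr (sub_ne_zero.mpr hX)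
  -- Subtract the two equations of the circle and factor both differences of squares.
  have e1 : |Y - Y'| * (Y + Y') = |X - X'| * |X + X'| := by
    have hs : 0 ≤ Y + Y' := by have := abs_nonneg X; have := abs_nonneg X'; linarith
    rw [← abs_of_nonneg hs, ← abs_mul, ← abs_mul, ← abs_neg]
    congr 1
    linear_combination h' - h
  have h4 : |X + X'| ≤ |X| + |X'| := abs_add_le X X'
  have h5 : |X - X'| * (Y + Y') ≤ |X - X'| * |X + X'| := by
    rw [← e1]
    exact mul_le_mul_of_nonneg_right hcon
      (by have := abs_nonneg X; have := abs_nonneg X'; linarith)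
  have h6 : Y + Y' ≤ |X + X'| := le_of_mul_le_mul_left h5 hpos
  -- Now `|X + X'| ≤ |X| + |X'| ≤ Y + Y' ≤ |X + X'|`, so all are equalities. Both points are then at
  -- the ends of the quarter; being distinct they satisfy `X = -X'`, and the last inequality forces
  -- `Y + Y' ≤ 0`, so everything vanishes.
  have h7 : Y = |X| := by linarith
  have h8 : Y' = |X'| := by linarith
  have h9 : |X| = |X'| := by
    have e2 : X ^ 2 = X' ^ 2 := by
      rw [h7, sq_abs] at h; rw [h8, sq_abs] at h'; linarith
    exact (sq_eq_sq_iff_abs_eq_abs X X').mp e2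
  rcases abs_eq_abs.mp h9 with h10 | h10
  · exact hX h10
  · subst h10
    simp only [neg_add_cancel, abs_zero] at h6
    have := abs_nonneg X'
    have h11 : |X'| = 0 := by rw [h7, h8, abs_neg] at h6; linarith
    rw [abs_eq_zero] at h11
    exact hX (by rw [h11, neg_zero])

/-- Cut the plane into vertical strips of width `ℓ`; at most `3ℓ²` of them meet the points. By
Cauchy–Schwarz, `|S|²` is at most the number of strips times the number of pairs of points in a
common strip. A pair of distinct points of the arc is determined by its difference vector. Within
one strip this vector lies in a square of side `2ℓ + 1`, because chords have slope less than one.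
Hence there are at most `|S| + (2ℓ+1)²` pairs. In terms of the abscissa bound `R = ℓ³` the result is
`O(R^{2/3})`. -/
lemma card_upper_quarter_le {ℓ : ℕ} (hℓ : 1 ≤ ℓ) (A B M : ℤ) (S : Finset (ℤ × ℤ))
    (hS : ∀ p ∈ S, |p.1| ≤ (ℓ : ℤ) ^ 3 ∧ (2 * p.1 - A) ^ 2 + (2 * p.2 - B) ^ 2 = M ∧
      |2 * p.1 - A| ≤ 2 * p.2 - B) :
    S.card ≤ 10 * ℓ ^ 2 := by
  classical
  have hℓ0 : (0 : ℤ) < ℓ := by exact_mod_cast hℓ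
  have key : ∀ p ∈ S, ∀ q ∈ S, p ≠ q → |p.2 - q.2| < |p.1 - q.1| := by
    intro p hp q hq hne
    have := abs_sub_lt_of_upper_quarter (hS p hp).2.1 (hS q hq).2.1 (hS p hp).2.2 (hS q hq).2.2
      (fun h => hne (Prod.ext (by linarith [h.1]) (by linarith [h.2])))
    have e1 : 2 * p.2 - B - (2 * q.2 - B) = 2 * (p.2 - q.2) := by ring
    have e2 : 2 * p.1 - A - (2 * q.1 - A) = 2 * (p.1 - q.1) := by ring
    rw [e1, e2, abs_mul, abs_mul] at this
    exact lt_of_mul_lt_mul_left this (by norm_num)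
  set f : ℤ × ℤ → ℤ := fun p => p.1 / ℓ with hf
  set I : Finset ℤ := Finset.Icc (-(ℓ : ℤ) ^ 2) ((ℓ : ℤ) ^ 2) with hI
  have hmaps : ∀ p ∈ S, f p ∈ I := by
    intro p hp
    have h1 := abs_le.mp (hS p hp).1
    rw [hI, Finset.mem_Icc]
    constructor
    · rw [Int.le_ediv_iff_mul_le hℓ0]; nlinarith [h1.1]
    · apply Int.le_of_lt_add_one
      rw [Int.ediv_lt_iff_lt_mul hℓ0]; nlinarith [h1.2]
  have hIcard : (I.card : ℤ) ≤ 3 * ℓ ^ 2 := by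
    rw [hI, Int.card_Icc]
    have : (1 : ℤ) ≤ (ℓ : ℤ) ^ 2 := one_le_pow₀ (by exact_mod_cast hℓ)
    rw [Int.toNat_of_nonneg (by linarith)]
    linarith
  set P : Finset ((ℤ × ℤ) × (ℤ × ℤ)) := (S ×ˢ S).filter fun z => f z.1 = f z.2 with hP
  have hPcard : P.card = ∑ i ∈ I, (S.filter fun p => f p = i).card ^ 2 := by
    rw [Finset.card_eq_sum_card_fiberwise (f := fun z => f z.1) (t := I)]
    · refine Finset.sum_congr rfl fun i _ => ?_
      rw [sq, ← Finset.card_product]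
      congr 1
      ext ⟨p, q⟩
      simp only [hP, Finset.mem_filter, Finset.mem_product]
      constructor
      · rintro ⟨⟨⟨h1, h2⟩, h3⟩, h4⟩
        exact ⟨⟨h1, h4⟩, h2, h3 ▸ h4⟩
      · rintro ⟨⟨h1, h4⟩, h2, h3⟩
        exact ⟨⟨⟨h1, h2⟩, h4.trans h3.symm⟩, h4⟩
    · intro z hz
      have hz' := Finset.mem_filter.mp (Finset.mem_coe.mp hz)
      exact hmaps _ (Finset.mem_product.mp hz'.1).1
  have hcs : S.card ^ 2 ≤ I.card * P.card := by
    rw [hPcard, Finset.card_eq_sum_card_fiberwise (f := f) (t := I) hmaps]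
    exact sq_sum_le_card_mul_sum_sq
  have hPle : P.card ≤ S.card + (2 * ℓ + 1) ^ 2 := by
    have h1 : (P.filter fun z => z.1 = z.2).card ≤ S.card := by
      refine Finset.card_le_card_of_injOn Prod.fst ?_ ?_
      · intro z hz
        simp only [hP, Finset.coe_filter, Finset.mem_filter, Finset.mem_product, mem_ofPred_eq] at hz
        exact hz.1.1.1
      · intro z hz w hw h
        simp only [Finset.coe_filter, mem_ofPred_eq] at hz hw
        exact Prod.ext h (by rw [← hz.2, ← hw.2, h])
    have h2 : (P.filter fun z => ¬z.1 = z.2).card ≤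
        (Finset.Icc (-(ℓ : ℤ)) ℓ ×ˢ Finset.Icc (-(ℓ : ℤ)) ℓ).card := by
      refine Finset.card_le_card_of_injOn (fun z => (z.2.1 - z.1.1, z.2.2 - z.1.2)) ?_ ?_
      · rintro ⟨p, q⟩ hz
        simp only [hP, Finset.coe_filter, Finset.mem_filter, Finset.mem_product, mem_ofPred_eq] at hz
        obtain ⟨⟨⟨hp, hq⟩, hfpq⟩, hne⟩ := hz
        have h3 := key q hq p hp (Ne.symm hne)
        have h4 : |q.1 - p.1| ≤ ℓ := by
          have e1 := Int.emod_add_mul_ediv p.1 ℓ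
          have e2 := Int.emod_add_mul_ediv q.1 ℓ
          have e3 := Int.emod_nonneg p.1 hℓ0.ne'
          have e4 := Int.emod_nonneg q.1 hℓ0.ne'
          have e5 := Int.emod_lt_of_pos p.1 hℓ0
          have e6 := Int.emod_lt_of_pos q.1 hℓ0
          have e7 : p.1 / (ℓ : ℤ) = q.1 / ℓ := hfpq
          rw [e7] at e1
          rw [abs_le]
          constructor <;> linarith
        have h5 := abs_le.mp h4
        have h6 := abs_le.mp (h3.le.trans h4)
        simp only [Finset.coe_product, Finset.coe_Icc, mem_prod, mem_Icc]
        exact ⟨h5, h6⟩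
      · rintro ⟨p, q⟩ hz ⟨p', q'⟩ hw h
        simp only [hP, Finset.coe_filter, Finset.mem_filter, Finset.mem_product, mem_ofPred_eq,
          Prod.mk.injEq] at hz hw h
        obtain ⟨⟨⟨hp, hq⟩, -⟩, hne⟩ := hz
        obtain ⟨⟨⟨hp', hq'⟩, -⟩, hne'⟩ := hw
        -- Two pairs with the same difference span a parallelogram with vertices on the circle.
        -- Comparing the four equations shows that `p - p'` is orthogonal to the chord `q - p`. Two
        -- chords of slope less than one in absolute value cannot be orthogonal.
        have hpp : p = p' := by
          by_contra hpp
          have k1 := key p hp p' hp' hpp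
          have k2 := key q hq p hp (Ne.symm hne)
          have o1 := (hS p hp).2.1
          have o2 := (hS q hq).2.1
          have o3 := (hS p' hp').2.1
          have o4 := (hS q' hq').2.1
          have hq1 : q'.1 = p'.1 + (q.1 - p.1) := by linarith [h.1]
          have hq2 : q'.2 = p'.2 + (q.2 - p.2) := by linarith [h.2]
          rw [hq1, hq2] at o4
          have o5 : (p.1 - p'.1) * (q.1 - p.1) = -((p.2 - p'.2) * (q.2 - p.2)) := by
            have : 8 * ((p.1 - p'.1) * (q.1 - p.1)) + 8 * ((p.2 - p'.2) * (q.2 - p.2)) = 0 := by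
              linear_combination o2 - o1 - o4 + o3
            linarith
          have o6 : |p.1 - p'.1| * |q.1 - p.1| = |p.2 - p'.2| * |q.2 - p.2| := by
            rw [← abs_mul, o5, abs_neg, abs_mul]
          have := abs_nonneg (p.2 - p'.2)
          have := abs_nonneg (q.2 - p.2)
          nlinarith
        refine Prod.ext hpp (Prod.ext ?_ ?_)
        · have := h.1; rw [← hpp] at this; simpa using this
        · have := h.2; rw [← hpp] at this; simpa using this
    have h3 : (Finset.Icc (-(ℓ : ℤ)) ℓ ×ˢ Finset.Icc (-(ℓ : ℤ)) ℓ).card = (2 * ℓ + 1) ^ 2 := by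
      rw [Finset.card_product, Int.card_Icc, sq]
      congr 1 <;> omega
    have h4 := Finset.card_filter_add_card_filter_not (s := P) (fun z => z.1 = z.2)
    omega
  have hℓ1 : (1 : ℤ) ≤ ℓ := by exact_mod_cast hℓ
  have g1 : (S.card : ℤ) ^ 2 ≤ 3 * ℓ ^ 2 * (S.card + (2 * ℓ + 1) ^ 2) := by
    have a1 : (S.card : ℤ) ^ 2 ≤ I.card * P.card := by exact_mod_cast hcs
    have a2 : (P.card : ℤ) ≤ S.card + (2 * ℓ + 1) ^ 2 := by exact_mod_cast hPle
    exact a1.trans (mul_le_mul hIcard a2 (by positivity) (by positivity))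
  have g2 : ((2 : ℤ) * ℓ + 1) ^ 2 ≤ 9 * ℓ ^ 2 := by nlinarith
  -- With `Q = ℓ²` and `x = |S|` the inequality is `x² ≤ 3Qx + 27Q²`, which fails for `x > 10Q`.
  have g3 : (S.card : ℤ) ≤ 10 * ℓ ^ 2 := by
    by_contra! hc
    have hQ : (1 : ℤ) ≤ (ℓ : ℤ) ^ 2 := one_le_pow₀ hℓ1
    have g4 : (S.card : ℤ) ^ 2 ≤ 3 * ℓ ^ 2 * (S.card + 9 * ℓ ^ 2) :=
      g1.trans (mul_le_mul_of_nonneg_left (by linarith) (by positivity))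
    nlinarith
  exact_mod_cast g3

lemma card_vertical_quarters_le {ℓ : ℕ} (hℓ : 1 ≤ ℓ) (A B M : ℤ) (S : Finset (ℤ × ℤ))
    (hS : ∀ p ∈ S, |p.1| ≤ (ℓ : ℤ) ^ 3 ∧ (2 * p.1 - A) ^ 2 + (2 * p.2 - B) ^ 2 = M ∧
      |2 * p.1 - A| ≤ |2 * p.2 - B|) :
    S.card ≤ 20 * ℓ ^ 2 := by
  have h1 : (S.filter fun p => 0 ≤ 2 * p.2 - B).card ≤ 10 * ℓ ^ 2 := by
    refine card_upper_quarter_le hℓ A B M _ fun p hp => ?_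
    rw [Finset.mem_filter] at hp
    obtain ⟨a, b, c⟩ := hS p hp.1
    exact ⟨a, b, by rwa [abs_of_nonneg hp.2] at c⟩
  have h2 : (S.filter fun p => ¬0 ≤ 2 * p.2 - B).card ≤ 10 * ℓ ^ 2 := by
    -- Reflecting in the horizontal axis turns the lower quarter into an upper one; the ordinate `B`
    -- of the centre changes sign.
    rw [← Finset.card_image_of_injective (f := fun p : ℤ × ℤ => (p.1, -p.2)) _
      (fun p q h => by simpa [Prod.ext_iff] using h)]
    refine card_upper_quarter_le hℓ A (-B) M _ fun p hp => ?_
    rw [Finset.mem_image] at hp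
    obtain ⟨q, hq, rfl⟩ := hp
    rw [Finset.mem_filter, not_le] at hq
    obtain ⟨a, b, c⟩ := hS q hq.1
    refine ⟨a, ?_, ?_⟩
    · rw [← b]; ring
    · rw [abs_of_neg hq.2] at c
      linarith
  have := Finset.card_filter_add_card_filter_not (s := S) (fun p => 0 ≤ 2 * p.2 - B)
  omega

/-- A circle with half-integral centre has few lattice points in a box. -/
lemma card_circle_le {ℓ : ℕ} (hℓ : 1 ≤ ℓ) (A B M : ℤ) (S : Finset (ℤ × ℤ))
    (hS : ∀ p ∈ S, |p.1| ≤ (ℓ : ℤ) ^ 3 ∧ |p.2| ≤ (ℓ : ℤ) ^ 3 ∧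
      (2 * p.1 - A) ^ 2 + (2 * p.2 - B) ^ 2 = M) :
    S.card ≤ 40 * ℓ ^ 2 := by
  have h1 : (S.filter fun p => |2 * p.1 - A| ≤ |2 * p.2 - B|).card ≤ 20 * ℓ ^ 2 := by
    refine card_vertical_quarters_le hℓ A B M _ fun p hp => ?_
    rw [Finset.mem_filter] at hp
    obtain ⟨a, b, c⟩ := hS p hp.1
    exact ⟨a, c, hp.2⟩
  have h2 : (S.filter fun p => ¬|2 * p.1 - A| ≤ |2 * p.2 - B|).card ≤ 20 * ℓ ^ 2 := by
    rw [← Finset.card_image_of_injective _ Prod.swap_injective]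
    refine card_vertical_quarters_le hℓ B A M _ fun p hp => ?_
    rw [Finset.mem_image] at hp
    obtain ⟨q, hq, rfl⟩ := hp
    rw [Finset.mem_filter, not_le] at hq
    obtain ⟨a, b, c⟩ := hS q hq.1
    exact ⟨b, by rw [← c, add_comm]; rfl, hq.2.le⟩
  have := Finset.card_filter_add_card_filter_not (s := S)
    (fun p => |2 * p.1 - A| ≤ |2 * p.2 - B|)
  omega

/-- A sphere with half-integral centre has few lattice points in a box. -/
lemma card_sphere_le {ℓ : ℕ} (hℓ : 1 ≤ ℓ) (n : Fin 3 → ℤ) (M : ℤ) (S : Finset (Fin 3 → ℤ))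
    (hS : ∀ k ∈ S, (∀ j, |k j| ≤ (ℓ : ℤ) ^ 3) ∧ ∑ j, (2 * k j - n j) ^ 2 = M) :
    S.card ≤ 120 * ℓ ^ 5 := by
  classical
  -- Slice the sphere by its first coordinate: every slice is a circle, and there are at most `2ℓ³ +
  -- 1 ≤ 3ℓ³` slices. No finer count is needed, since any exponent below `2` in the side of the box
  -- would do.
  have h1 : S.card ≤ (40 * ℓ ^ 2) * (S.image fun k => k 0).card := by
    refine Finset.card_le_mul_card_image S _ fun z _ => ?_
    rw [← Finset.card_image_of_injOn (f := fun k : Fin 3 → ℤ => (k 1, k 2))]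
    · refine card_circle_le hℓ (n 1) (n 2) (M - (2 * z - n 0) ^ 2) _ fun p hp => ?_
      rw [Finset.mem_image] at hp
      obtain ⟨k, hk, rfl⟩ := hp
      rw [Finset.mem_filter] at hk
      obtain ⟨a, b⟩ := hS k hk.1
      refine ⟨a 1, a 2, ?_⟩
      rw [← b, ← hk.2, Fin.sum_univ_three]
      ring
    · intro k hk l hl h
      simp only [Finset.coe_filter, mem_ofPred_eq] at hk hl
      simp only [Prod.mk.injEq] at h
      funext j
      fin_cases j
      · exact hk.2.trans hl.2.symm
      · exact h.1
      · exact h.2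
  have h2 : (S.image fun k => k 0).card ≤ 3 * ℓ ^ 3 := by
    have : (S.image fun k => k 0) ⊆ Finset.Icc (-(ℓ : ℤ) ^ 3) ((ℓ : ℤ) ^ 3) := by
      intro z hz
      rw [Finset.mem_image] at hz
      obtain ⟨k, hk, rfl⟩ := hz
      have := abs_le.mp ((hS k hk).1 0)
      exact Finset.mem_Icc.mpr ⟨by linarith [this.1], this.2⟩
    refine (Finset.card_le_card this).trans ?_
    rw [Int.card_Icc]
    have : 1 ≤ ℓ ^ 3 := Nat.one_le_pow _ _ hℓ
    have e : (ℓ : ℤ) ^ 3 = ((ℓ ^ 3 : ℕ) : ℤ) := by push_cast; rfl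
    rw [e]
    omega
  calc S.card ≤ (40 * ℓ ^ 2) * (3 * ℓ ^ 3) := h1.trans (Nat.mul_le_mul_left _ h2)
    _ = 120 * ℓ ^ 5 := by ring

variable {d : ℕ}

/-- Lower dimensions embed in dimension three by padding the points and the centre with zeros, which
leaves the equation of the sphere unchanged. -/
lemma card_sphere_le_of_dim_le (hd : d = 1 ∨ d = 2 ∨ d = 3) {ℓ : ℕ} (hℓ : 1 ≤ ℓ) (n : Fin d → ℤ)
    (M : ℤ) (S : Finset (Fin d → ℤ))
    (hS : ∀ k ∈ S, (∀ j, |k j| ≤ (ℓ : ℤ) ^ 3) ∧ ∑ j, (2 * k j - n j) ^ 2 = M) :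
    S.card ≤ 120 * ℓ ^ 5 := by
  classical
  have h0 : |(0 : ℤ)| ≤ (ℓ : ℤ) ^ 3 := by simp
  rcases hd with rfl | rfl | rfl
  · rw [← Finset.card_image_of_injective (f := fun k : Fin 1 → ℤ => ![k 0, 0, 0]) S]
    · refine card_sphere_le hℓ ![n 0, 0, 0] M _ fun k hk => ?_
      obtain ⟨l, hl, rfl⟩ := Finset.mem_image.mp hk
      obtain ⟨a, b⟩ := hS l hl
      refine ⟨fun j => ?_, ?_⟩
      · fin_cases j
        · exact a 0
        · exact h0
        · exact h0
      · rw [← b, Fin.sum_univ_three]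
        simp
    · intro k l h
      funext j
      fin_cases j
      exact congrFun h 0
  · rw [← Finset.card_image_of_injective (f := fun k : Fin 2 → ℤ => ![k 0, k 1, 0]) S]
    · refine card_sphere_le hℓ ![n 0, n 1, 0] M _ fun k hk => ?_
      obtain ⟨l, hl, rfl⟩ := Finset.mem_image.mp hk
      obtain ⟨a, b⟩ := hS l hl
      refine ⟨fun j => ?_, ?_⟩
      · fin_cases j
        · exact a 0
        · exact a 1
        · exact h0
      · rw [← b, Fin.sum_univ_three, Fin.sum_univ_two]
        simp
    · intro k l h
      funext j
      fin_cases j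
      · exact congrFun h 0
      · exact congrFun h 1
  · exact card_sphere_le hℓ n M S hS

/-! ### Weighted lattice sums -/

/-- The weight `⟨k⟩² = 1 + |k|²`. -/
def wt (k : Fin d → ℤ) : ℝ := 1 + freqSq k

lemma freqSq_nonneg (k : Fin d → ℤ) : 0 ≤ freqSq k := Finset.sum_nonneg fun _ _ => sq_nonneg _

lemma one_le_wt (k : Fin d → ℤ) : 1 ≤ wt k := by
  have := freqSq_nonneg k
  unfold wt; linarith

lemma wt_pos (k : Fin d → ℤ) : 0 < wt k := lt_of_lt_of_le one_pos (one_le_wt k)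

/-- The index of the shell `8^(L-1) < |k|_∞ ≤ 8^L` containing `k`. -/
def shell (k : Fin d → ℤ) : ℕ := Nat.clog 8 (Finset.univ.sup fun j => (k j).natAbs)

lemma mem_box_shell (k : Fin d → ℤ) : k ∈ box d (8 ^ shell k) := by
  rw [mem_box]
  intro j
  have h1 : (k j).natAbs ≤ Finset.univ.sup fun j => (k j).natAbs :=
    Finset.le_sup (f := fun j => (k j).natAbs) (Finset.mem_univ j)
  have h2 := h1.trans (Nat.le_pow_clog (b := 8) (by norm_num) _)
  rw [Int.abs_eq_natAbs]
  exact_mod_cast h2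

/-- Outside shell zero some coordinate exceeds `8^(L-1)`, and its square `64^(L-1)` is a lower bound
for the weight. The factor `64` pays for the missing power. -/
lemma pow_shell_le_wt (k : Fin d → ℤ) : (64 : ℝ) ^ shell k ≤ 64 * wt k := by
  rcases Nat.eq_zero_or_pos (shell k) with h | h
  · rw [h, pow_zero]; linarith [one_le_wt k]
  · have h1 : 8 ^ (shell k - 1) < Finset.univ.sup fun j => (k j).natAbs :=
      (Nat.lt_clog_iff_pow_lt (by norm_num)).mp (by unfold shell at h ⊢; omega)
    obtain ⟨j, -, hj⟩ := Finset.lt_sup_iff.mp h1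
    have h2 : ((8 : ℝ) ^ (shell k - 1)) ≤ |(k j : ℝ)| := by
      have : (8 ^ (shell k - 1) : ℕ) ≤ (k j).natAbs := hj.le
      have h3 : ((8 ^ (shell k - 1) : ℕ) : ℝ) ≤ ((k j).natAbs : ℝ) := by exact_mod_cast this
      rw [Nat.cast_natAbs] at h3
      exact_mod_cast h3
    have h3 : ((k j : ℝ)) ^ 2 ≤ freqSq k :=
      Finset.single_le_sum (f := fun j => (k j : ℝ) ^ 2) (fun _ _ => sq_nonneg _)
        (Finset.mem_univ j)
    have h4 : ((8 : ℝ) ^ (shell k - 1)) ^ 2 ≤ (k j : ℝ) ^ 2 := by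
      rw [← sq_abs (k j : ℝ)]
      exact pow_le_pow_left₀ (by positivity) h2 2
    have h5 : (64 : ℝ) ^ shell k = 64 * ((8 : ℝ) ^ (shell k - 1)) ^ 2 := by
      obtain ⟨m, hm⟩ : ∃ m, shell k = m + 1 := ⟨shell k - 1, by omega⟩
      rw [hm, Nat.add_sub_cancel, ← pow_mul, mul_comm m 2, pow_mul, pow_succ]
      norm_num
      ring
    rw [h5]
    unfold wt
    linarith

/-- The weight decays per shell by twice the factor by which the count grows. Shell `L` thus
contributes at most `C D 2^{-L}`, and the geometric series sums to two. -/
lemma sum_le_of_card_shell_le {S : Finset (Fin d → ℤ)} {w : (Fin d → ℤ) → ℝ} {C D ρ : ℝ}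
    (hρ : 0 < ρ) (hC : 0 ≤ C) (hD : 0 ≤ D)
    (hcard : ∀ L, ((S.filter fun k => k ∈ box d (8 ^ L)).card : ℝ) ≤ C * ρ ^ L)
    (hw : ∀ k, w k ≤ D / (2 * ρ) ^ shell k) :
    ∑ k ∈ S, w k ≤ 2 * (C * D) := by
  classical
  rw [← Finset.sum_fiberwise_of_maps_to (t := S.image shell) (g := shell)
    (fun k hk => Finset.mem_image_of_mem _ hk)]
  have h1 : ∀ L ∈ S.image shell, ∑ k ∈ S with shell k = L, w k ≤ C * D * (1 / 2 : ℝ) ^ L := by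
    intro L _
    calc ∑ k ∈ S with shell k = L, w k
        ≤ ∑ k ∈ S with shell k = L, D / (2 * ρ) ^ L := by
          refine Finset.sum_le_sum fun k hk => ?_
          rw [Finset.mem_filter] at hk
          have := hw k
          rwa [hk.2] at this
      _ = ((S.filter fun k => shell k = L).card : ℝ) * (D / (2 * ρ) ^ L) := by
          rw [Finset.sum_const, nsmul_eq_mul]
      _ ≤ (C * ρ ^ L) * (D / (2 * ρ) ^ L) := by
          refine mul_le_mul_of_nonneg_right (le_trans ?_ (hcard L)) (by positivity)
          have : (S.filter fun k => shell k = L) ⊆ S.filter fun k => k ∈ box d (8 ^ L) := by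
            intro k hk
            rw [Finset.mem_filter] at hk ⊢
            exact ⟨hk.1, hk.2 ▸ mem_box_shell k⟩
          exact_mod_cast Finset.card_le_card this
      _ = C * D * (1 / 2 : ℝ) ^ L := by
          rw [mul_pow, one_div, inv_pow]
          field_simp
  calc _ ≤ ∑ L ∈ S.image shell, C * D * (1 / 2 : ℝ) ^ L := Finset.sum_le_sum h1
    _ = C * D * ∑ L ∈ S.image shell, (1 / 2 : ℝ) ^ L := by rw [Finset.mul_sum]
    _ ≤ C * D * 2 := by
        refine mul_le_mul_of_nonneg_left ?_ (by positivity)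
        exact (summable_geometric_two.sum_le_tsum _ fun _ _ => by positivity).trans_eq
          tsum_geometric_two
    _ = _ := by ring

/-- The number of points of resonance, with the weight `⟨k⟩^{-2}`. -/
lemma sum_inv_wt_resonant_le (hd : d = 1 ∨ d = 2 ∨ d = 3) (n : Fin d → ℤ) (m : ℤ)
    (S : Finset (Fin d → ℤ)) (hS : ∀ k ∈ S, ∑ j, ((k j) ^ 2 + (n j - k j) ^ 2) = m) :
    ∑ k ∈ S, (wt k)⁻¹ ≤ 15360 := by
  -- The condition says that `2k - n` lies on the sphere of squared radius `2m - |n|²`. The box of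
  -- size `8^L = (2^L)³` therefore contains at most `120 · 32^L` such points, while the weight
  -- decays like `64^{-L}`: this is the gain of the exponent `5/3` over `2`. The total is `2 · 120 ·
  -- 64 = 15360`.
  have h := sum_le_of_card_shell_le (S := S) (w := fun k => (wt k)⁻¹) (C := 120) (D := 64)
    (ρ := 32) (by norm_num) (by norm_num) (by norm_num) ?_ ?_
  · norm_num at h ⊢
    exact h
  · intro L
    have := card_sphere_le_of_dim_le hd (ℓ := 2 ^ L) Nat.one_le_two_pow n (2 * m - ∑ j, (n j) ^ 2)
      (S.filter fun k => k ∈ box d (8 ^ L)) fun k hk => ?_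
    · rw [← pow_mul, mul_comm L 5, pow_mul] at this
      norm_num at this
      exact_mod_cast this
    · rw [Finset.mem_filter, mem_box] at hk
      refine ⟨fun j => (hk.2 j).trans_eq ?_, ?_⟩
      · push_cast
        rw [← pow_mul, mul_comm L 3, pow_mul]
        norm_num
      · rw [← hS k hk.1, Finset.mul_sum, ← Finset.sum_sub_distrib]
        refine Finset.sum_congr rfl fun j _ => ?_
        ring
  · intro k
    have := pow_shell_le_wt k
    norm_num
    rw [inv_le_comm₀ (wt_pos k) (by positivity), inv_div, div_le_iff₀ (by norm_num)]
    linarith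

/-- The sum of `⟨k⟩^{-4}` converges because `d < 4`. Shells have at most `27 · 512^L` points, the
weight decays at least like `1024^{-L}`, and `2 · 27 · 4096 = 221184`. -/
lemma sum_inv_wt_sq_le (hd : d = 1 ∨ d = 2 ∨ d = 3) (S : Finset (Fin d → ℤ)) :
    ∑ k ∈ S, ((wt k) ^ 2)⁻¹ ≤ 221184 := by
  have h := sum_le_of_card_shell_le (S := S) (w := fun k => ((wt k) ^ 2)⁻¹) (C := 27) (D := 4096)
    (ρ := 512) (by norm_num) (by norm_num) (by norm_num) ?_ ?_
  · norm_num at h ⊢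
    exact h
  · intro L
    have h1 : (S.filter fun k => k ∈ box d (8 ^ L)).card ≤ (box d (8 ^ L)).card :=
      Finset.card_le_card fun k hk => (Finset.mem_filter.mp hk).2
    have h2 : (box d (8 ^ L)).card = (2 * 8 ^ L + 1) ^ d := by
      rw [box, Pi.card_Icc]
      simp only [Int.card_Icc, Finset.prod_const, Finset.card_univ, Fintype.card_fin]
      congr 1
      push_cast
      have : ((8 : ℤ) ^ L) = ((8 ^ L : ℕ) : ℤ) := by push_cast; rfl
      rw [this]
      omega
    have h3 : (2 * 8 ^ L + 1) ^ d ≤ (3 * 8 ^ L) ^ 3 := by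
      have : 1 ≤ 8 ^ L := Nat.one_le_pow _ _ (by norm_num)
      calc (2 * 8 ^ L + 1) ^ d ≤ (2 * 8 ^ L + 1) ^ 3 :=
            Nat.pow_le_pow_right (by omega) (by omega)
        _ ≤ _ := Nat.pow_le_pow_left (by omega) 3
    have h4 : (3 * 8 ^ L) ^ 3 = 27 * 512 ^ L := by
      rw [mul_pow, ← pow_mul, mul_comm L 3, pow_mul]
      norm_num
    rw [h2] at h1
    exact_mod_cast (h1.trans h3).trans_eq h4
  · intro k
    have h1 := pow_shell_le_wt k
    have h2 : ((64 : ℝ) ^ shell k) ^ 2 ≤ (64 * wt k) ^ 2 := pow_le_pow_left₀ (by positivity) h1 2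
    have h3 : ((2 * 512 : ℝ)) ^ shell k ≤ ((64 : ℝ) ^ shell k) ^ 2 := by
      rw [← pow_mul, mul_comm _ 2, pow_mul]
      exact pow_le_pow_left₀ (by norm_num) (by norm_num) _
    rw [inv_le_comm₀ (pow_pos (wt_pos k) 2) (by positivity), inv_div, div_le_iff₀ (by norm_num)]
    nlinarith

/-! ### Weighted orthogonality -/

lemma ofReal_norm_pow {E : Type*} [SeminormedAddGroup E] (z : E) (n : ℕ) :
    ENNReal.ofReal (‖z‖ ^ n) = ‖z‖ₑ ^ n := by
  rw [ENNReal.ofReal_pow (norm_nonneg _), ofReal_norm]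

lemma lintegral_enorm_pow_eq {X : Type*} [MeasurableSpace X] {μ : Measure X} {E : Type*}
    [NormedAddCommGroup E] {F : X → E} {n : ℕ} (hF : Integrable (fun x => ‖F x‖ ^ n) μ) :
    ∫⁻ x, ‖F x‖ₑ ^ n ∂μ = ENNReal.ofReal (∫ x, ‖F x‖ ^ n ∂μ) := by
  rw [ofReal_integral_eq_lintegral_ofReal hF (ae_of_all _ fun _ => by positivity)]
  simp only [ofReal_norm_pow]

section Orthogonality

variable {X : Type*} [MeasurableSpace X] {μ : Measure X} {N ι : Type*} [DecidableEq N]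
  {φ : N → X → ℂ} {V : ℝ}

lemma integral_norm_sq_sum_orthogonal
    (hint : ∀ n m, Integrable (fun x => φ n x * conj (φ m x)) μ)
    (horth : ∀ n m, ∫ x, φ n x * conj (φ m x) ∂μ = if n = m then (V : ℂ) else 0)
    (s : Finset N) (b : N → ℂ) :
    Integrable (fun x => ‖∑ n ∈ s, b n * φ n x‖ ^ 2) μ ∧
      ∫ x, ‖∑ n ∈ s, b n * φ n x‖ ^ 2 ∂μ = V * ∑ n ∈ s, ‖b n‖ ^ 2 := by
  have hexp : ∀ x, ((‖∑ n ∈ s, b n * φ n x‖ ^ 2 : ℝ) : ℂ) =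
      ∑ n ∈ s, ∑ m ∈ s, (b n * conj (b m)) * (φ n x * conj (φ m x)) := fun x => by
    push_cast
    rw [← Complex.mul_conj', map_sum, Finset.sum_mul_sum]
    refine Finset.sum_congr rfl fun n _ => Finset.sum_congr rfl fun m _ => ?_
    rw [map_mul]; ring
  have hI : Integrable (fun x => ∑ n ∈ s, ∑ m ∈ s, (b n * conj (b m)) * (φ n x * conj (φ m x))) μ :=
    integrable_finsetSum _ fun n _ => integrable_finsetSum _ fun m _ => (hint n m).const_mul _
  refine ⟨?_, ?_⟩
  · have := hI.re
    refine this.congr (ae_of_all _ fun x => ?_)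
    simp only [← hexp]
    simp only [RCLike.re_to_complex, Complex.ofReal_re]
  · have h : ((∫ x, ‖∑ n ∈ s, b n * φ n x‖ ^ 2 ∂μ : ℝ) : ℂ) =
        ((V * ∑ n ∈ s, ‖b n‖ ^ 2 : ℝ) : ℂ) := by
      rw [← integral_complex_ofReal]
      simp only [hexp]
      rw [integral_finsetSum _ fun n _ =>
        integrable_finsetSum _ fun m _ => (hint n m).const_mul _]
      push_cast
      rw [Finset.mul_sum]
      refine Finset.sum_congr rfl fun n hn => ?_
      rw [integral_finsetSum _ fun m _ => (hint n m).const_mul _]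
      simp only [integral_const_mul, horth, mul_ite, mul_zero, Finset.sum_ite_eq, if_pos hn]
      rw [Complex.mul_conj', mul_comm]
    exact_mod_cast h

/-- If each frequency is attained by indices of small total inverse weight, then the `L²` norm of
an exponential sum is controlled by the weighted `ℓ²` norm of its coefficients. -/
lemma lintegral_sum_orthogonal_le
    (hint : ∀ n m, Integrable (fun x => φ n x * conj (φ m x)) μ)
    (horth : ∀ n m, ∫ x, φ n x * conj (φ m x) ∂μ = if n = m then (V : ℂ) else 0)
    (hV : 0 ≤ V) (s : Finset ι) (freq : ι → N) (a : ι → ℂ) {w : ι → ℝ} (hw : ∀ i, 0 < w i) {K : ℝ}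
    (hK : ∀ n, ∑ i ∈ s with freq i = n, (w i)⁻¹ ≤ K) :
    ∫⁻ x, ‖∑ i ∈ s, a i * φ (freq i) x‖ₑ ^ 2 ∂μ ≤
      ENNReal.ofReal (V * (K * ∑ i ∈ s, w i * ‖a i‖ ^ 2)) := by
  -- Indices with the same frequency are collected first, so that orthogonality applies to distinct
  -- frequencies; inside each group Cauchy–Schwarz with the weight `w` takes over.
  have hgroup : ∀ x, ∑ i ∈ s, a i * φ (freq i) x =
      ∑ n ∈ s.image freq, (∑ i ∈ s with freq i = n, a i) * φ n x := fun x => by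
    rw [← Finset.sum_fiberwise_of_maps_to (t := s.image freq) (g := freq)
      (fun i hi => Finset.mem_image_of_mem _ hi)]
    refine Finset.sum_congr rfl fun n _ => ?_
    rw [Finset.sum_mul]
    refine Finset.sum_congr rfl fun i hi => ?_
    rw [(Finset.mem_filter.mp hi).2]
  simp only [hgroup]
  obtain ⟨h1, h2⟩ := integral_norm_sq_sum_orthogonal hint horth (s.image freq)
    (fun n => ∑ i ∈ s with freq i = n, a i)
  rw [lintegral_enorm_pow_eq h1, h2]
  refine ENNReal.ofReal_le_ofReal (mul_le_mul_of_nonneg_left ?_ hV)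
  rw [← Finset.sum_fiberwise_of_maps_to (t := s.image freq) (g := freq)
      (fun i hi => Finset.mem_image_of_mem _ hi), Finset.mul_sum]
  refine Finset.sum_le_sum fun n _ => ?_
  calc ‖∑ i ∈ s with freq i = n, a i‖ ^ 2 ≤ (∑ i ∈ s with freq i = n, ‖a i‖) ^ 2 :=
        pow_le_pow_left₀ (norm_nonneg _) (norm_sum_le _ _) 2
    _ ≤ (∑ i ∈ s with freq i = n, (w i)⁻¹) * ∑ i ∈ s with freq i = n, w i * ‖a i‖ ^ 2 := by
        refine Finset.sum_sq_le_sum_mul_sum_of_sq_le_mul _ (fun i _ => (inv_pos.mpr (hw i)).le)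
          (fun i _ => mul_nonneg (hw i).le (sq_nonneg _)) fun i _ => ?_
        rw [inv_mul_cancel_left₀ (hw i).ne']
    _ ≤ K * ∑ i ∈ s with freq i = n, w i * ‖a i‖ ^ 2 :=
        mul_le_mul_of_nonneg_right (hK n)
          (Finset.sum_nonneg fun i _ => mul_nonneg (hw i).le (sq_nonneg _))

end Orthogonality

variable {d : ℕ}

/-! ### The embedding `H¹ ⊂ L⁴` for trigonometric polynomials -/

/-- The fourth power is the square of `|trig²|`, and `trig²` is an exponential sum over pairs with
frequency `k + l`. With the weight `⟨k⟩²⟨l⟩²`, the fibre `k + l = n` has bounded inverse weight: by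
the arithmetic-geometric mean inequality it reduces to the sum of `⟨k⟩^{-4}`, as either member
determines the pair. -/
lemma lintegral_trig_pow_four_le (hd : d = 1 ∨ d = 2 ∨ d = 3) (S : Finset (Fin d → ℤ))
    (c : (Fin d → ℤ) → ℂ) :
    ∫⁻ x, ‖trig S c x‖ₑ ^ 4 ≤
      ENNReal.ofReal (vol d * (221184 * (∑ k ∈ S, wt k * ‖c k‖ ^ 2) ^ 2)) := by
  classical
  have h := lintegral_sum_orthogonal_le (μ := (volume : Measure (Torus d)))
    (φ := fun n : Fin d → ℤ => character n) (V := vol d)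
    (fun n m => integrable_of_continuous (by fun_prop)) integral_character_mul_conj (vol_pos d).le
    (S ×ˢ S) (fun z => z.1 + z.2) (fun z => c z.1 * c z.2) (w := fun z => wt z.1 * wt z.2)
    (fun z => mul_pos (wt_pos _) (wt_pos _)) (K := 221184) ?_
  · convert h using 3 with x
    · rw [show (4 : ℕ) = 2 * 2 from rfl, pow_mul, ← enorm_pow, sq (trig S c x)]
      congr 2
      rw [trig, Finset.sum_mul_sum, Finset.sum_product]
      refine Finset.sum_congr rfl fun k _ => Finset.sum_congr rfl fun l _ => ?_
      rw [character_add]; ring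
    · rw [sq, Finset.sum_mul_sum, Finset.sum_product]
      congr 1
      refine Finset.sum_congr rfl fun k _ => Finset.sum_congr rfl fun l _ => ?_
      rw [norm_mul]; ring
  · intro n
    have hinj : ∀ (f : (Fin d → ℤ) × (Fin d → ℤ) → (Fin d → ℤ)),
        (Set.InjOn f {z | z.1 + z.2 = n}) →
        ∑ z ∈ S ×ˢ S with z.1 + z.2 = n, ((wt (f z)) ^ 2)⁻¹ ≤ 221184 := by
      intro f hf
      rw [← Finset.sum_image (f := fun k => ((wt k) ^ 2)⁻¹) (g := f)]
      · exact sum_inv_wt_sq_le hd _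
      · intro z hz z' hz' h
        exact hf (Finset.mem_filter.mp hz).2 (Finset.mem_filter.mp hz').2 h
    have h1 := hinj Prod.fst (by
      rintro ⟨k, l⟩ hz ⟨k', l'⟩ hz' h
      simp only [mem_ofPred_eq] at hz hz' h
      subst h
      rw [Prod.mk.injEq]
      exact ⟨rfl, add_left_cancel (hz.trans hz'.symm)⟩)
    have h2 := hinj Prod.snd (by
      rintro ⟨k, l⟩ hz ⟨k', l'⟩ hz' h
      simp only [mem_ofPred_eq] at hz hz' h
      subst h
      rw [Prod.mk.injEq]
      exact ⟨add_right_cancel (hz.trans hz'.symm), rfl⟩)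
    calc ∑ z ∈ S ×ˢ S with z.1 + z.2 = n, (wt z.1 * wt z.2)⁻¹
        ≤ ∑ z ∈ S ×ˢ S with z.1 + z.2 = n,
            (1 / 2 * ((wt z.1) ^ 2)⁻¹ + 1 / 2 * ((wt z.2) ^ 2)⁻¹) := by
          refine Finset.sum_le_sum fun z _ => ?_
          rw [mul_inv, ← inv_pow, ← inv_pow]
          nlinarith [sq_nonneg ((wt z.1)⁻¹ - (wt z.2)⁻¹)]
      _ ≤ 221184 := by
          rw [Finset.sum_add_distrib, ← Finset.mul_sum, ← Finset.mul_sum]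
          linarith

/-! ### The bilinear estimate for free solutions -/

/-- The space-time measure on `(0,T) × 𝕋^d`. -/
def spaceTime (d : ℕ) (T : ℝ) : Measure (ℝ × Torus d) :=
  ((volume : Measure ℝ).restrict (Ioo 0 T)).prod (volume : Measure (Torus d))

instance (d : ℕ) (T : ℝ) : IsFiniteMeasure (spaceTime d T) := by
  unfold spaceTime; infer_instance

/-- The frequencies `|k|²` of free solutions are integers, so their time exponentials are orthogonal
on any interval whose length is a multiple of `2π`. -/
lemma integral_exp_period {m : ℕ} (hm : 0 < m) (n : ℤ) :
    ∫ t in Ioo 0 (2 * Real.pi * m), Complex.exp (-(Complex.I * n * t)) =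
      if n = 0 then ((2 * Real.pi * m : ℝ) : ℂ) else 0 := by
  have hpos : 0 ≤ 2 * Real.pi * m := by positivity
  rw [← integral_Ioc_eq_integral_Ioo, ← intervalIntegral.integral_of_le hpos]
  split_ifs with h
  · subst h
    simp
  · have hc : -(Complex.I * n) ≠ 0 := by
      simp [h]
    have := integral_exp_mul_complex (a := 0) (b := 2 * Real.pi * m) hc
    simp only [← neg_mul] at this ⊢
    rw [this]
    have h1 : Complex.exp (-Complex.I * n * ((2 * Real.pi * m : ℝ) : ℂ)) = 1 := by
      rw [Complex.exp_eq_one_iff]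
      refine ⟨-(n * m), ?_⟩
      push_cast
      ring
    rw [h1]
    simp

/-- The space-time character `e^{i(n·x - mt)}`. -/
def stCharacter (n : (Fin d → ℤ) × ℤ) (y : ℝ × Torus d) : ℂ :=
  Complex.exp (-(Complex.I * n.2 * y.1)) * character n.1 y.2

@[fun_prop]
lemma continuous_stCharacter (n : (Fin d → ℤ) × ℤ) : Continuous (stCharacter n) := by
  unfold stCharacter
  fun_prop

lemma norm_exp_I_real (r : ℝ) : ‖Complex.exp (Complex.I * r)‖ = 1 := by
  rw [mul_comm]; exact Complex.norm_exp_ofReal_mul_I r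

lemma norm_stCharacter (n : (Fin d → ℤ) × ℤ) (y : ℝ × Torus d) : ‖stCharacter n y‖ = 1 := by
  have : -(Complex.I * n.2 * y.1) = Complex.I * ((-(n.2 * y.1) : ℝ) : ℂ) := by push_cast; ring
  rw [stCharacter, norm_mul, norm_character, this, norm_exp_I_real, mul_one]

lemma integral_stCharacter {m : ℕ} (hm : 0 < m) (n n' : (Fin d → ℤ) × ℤ) :
    ∫ y, stCharacter n y * conj (stCharacter n' y) ∂(spaceTime d (2 * Real.pi * m)) =
      if n = n' then ((2 * Real.pi * m * vol d : ℝ) : ℂ) else 0 := by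
  have h : ∀ y : ℝ × Torus d, stCharacter n y * conj (stCharacter n' y) =
      Complex.exp (-(Complex.I * ((n.2 - n'.2 : ℤ) : ℂ) * y.1)) *
        (character n.1 y.2 * conj (character n'.1 y.2)) := fun y => by
    simp only [stCharacter, map_mul, ← Complex.exp_conj]
    rw [mul_mul_mul_comm, ← Complex.exp_add]
    congr 2
    simp
    ring
  simp only [h]
  rw [spaceTime, integral_prod_mul (fun t : ℝ => Complex.exp (-(Complex.I * ((n.2 - n'.2 : ℤ) : ℂ) * t)))
    (fun x => character n.1 x * conj (character n'.1 x)), integral_exp_period hm,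
    integral_character_mul_conj]
  by_cases h1 : n.1 = n'.1 <;> by_cases h2 : n.2 = n'.2 <;>
    simp [h1, h2, sub_eq_zero, Prod.ext_iff]

/-- The integer `|k|²`. -/
def freqInt (k : Fin d → ℤ) : ℤ := ∑ j, (k j) ^ 2

lemma freqInt_cast (k : Fin d → ℤ) : ((freqInt k : ℤ) : ℝ) = freqSq k := by
  simp [freqInt, freqSq]

/-- The product is an exponential sum over pairs with space-time frequency `(k + l, |k|² + |l|²)`.
For a given value `(n, r)` the pair is determined by `k`, which satisfies `|k|² + |n - k|² = r`. By
the count on spheres the weight `⟨k⟩²` on the first factor alone makes the fibres summable, so the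
second factor needs no derivative. -/
lemma lintegral_free_mul_free_le (hd : d = 1 ∨ d = 2 ∨ d = 3) {m : ℕ} (hm : 0 < m)
    (S S' : Finset (Fin d → ℤ)) (p q : (Fin d → ℤ) → ℂ) :
    ∫⁻ y, ‖(∑ k ∈ S, p k * stCharacter (k, freqInt k) y) *
        ∑ l ∈ S', q l * stCharacter (l, freqInt l) y‖ₑ ^ 2 ∂(spaceTime d (2 * Real.pi * m)) ≤
      ENNReal.ofReal (2 * Real.pi * m * vol d *
        (15360 * ((∑ k ∈ S, wt k * ‖p k‖ ^ 2) * ∑ l ∈ S', ‖q l‖ ^ 2))) := by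
  classical
  have h := lintegral_sum_orthogonal_le (μ := spaceTime d (2 * Real.pi * m))
    (φ := stCharacter) (V := 2 * Real.pi * m * vol d)
    (fun n n' => Integrable.of_bound (C := 1) (by fun_prop)
      (ae_of_all _ fun y => by simp [norm_stCharacter]))
    (integral_stCharacter hm) (by have := vol_pos d; positivity)
    (S ×ˢ S') (fun z => (z.1 + z.2, freqInt z.1 + freqInt z.2)) (fun z => p z.1 * q z.2)
    (w := fun z => wt z.1) (fun z => wt_pos _) (K := 15360) ?_
  · convert h using 3 with y
    · congr 2
      rw [Finset.sum_mul_sum, Finset.sum_product]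
      refine Finset.sum_congr rfl fun k _ => Finset.sum_congr rfl fun l _ => ?_
      simp only [stCharacter]
      rw [character_add, mul_mul_mul_comm, mul_mul_mul_comm (Complex.exp _), ← Complex.exp_add]
      congr 3
      push_cast
      ring
    · rw [Finset.sum_mul_sum, Finset.sum_product]
      congr 1
      refine Finset.sum_congr rfl fun k _ => Finset.sum_congr rfl fun l _ => ?_
      rw [norm_mul]; ring
  · rintro ⟨n, r⟩
    set F : Finset ((Fin d → ℤ) × (Fin d → ℤ)) := (S ×ˢ S').filter fun z =>
      (z.1 + z.2, freqInt z.1 + freqInt z.2) = (n, r) with hF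
    have hinj : ∀ z ∈ F, ∀ z' ∈ F, z.1 = z'.1 → z = z' := by
      rintro ⟨k, l⟩ hz ⟨k', l'⟩ hz' h
      simp only [hF, Finset.mem_filter, Prod.mk.injEq] at hz hz' h
      subst h
      rw [Prod.mk.injEq]
      exact ⟨rfl, add_left_cancel (hz.2.1.trans hz'.2.1.symm)⟩
    change ∑ z ∈ F, (wt z.1)⁻¹ ≤ _
    rw [← Finset.sum_image (f := fun k => (wt k)⁻¹) (g := Prod.fst)
      (fun z hz z' hz' h => hinj z hz z' hz' h)]
    refine sum_inv_wt_resonant_le hd n r _ fun k hk => ?_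
    obtain ⟨⟨k', l⟩, hz, rfl⟩ := Finset.mem_image.mp hk
    simp only [hF, Finset.mem_filter, Prod.mk.injEq] at hz
    rw [← hz.2.1, ← hz.2.2, freqInt, freqInt, Finset.sum_add_distrib]
    simp

/-! ### Superpositions of modulated free solutions -/

/-- A weighted Cauchy–Schwarz inequality. -/
lemma sq_lintegral_le_weighted {X : Type*} [MeasurableSpace X] {μ : Measure X} {f w : X → ℝ≥0∞}
    (hf : AEMeasurable f μ) (hw : AEMeasurable w μ) (h0 : ∀ x, w x ≠ 0) (htop : ∀ x, w x ≠ ⊤) :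
    (∫⁻ x, f x ∂μ) ^ 2 ≤ (∫⁻ x, (w x)⁻¹ ∂μ) * ∫⁻ x, w x * f x ^ 2 ∂μ := by
  have hpq : Real.HolderConjugate 2 2 := Real.HolderConjugate.two_two
  have h := ENNReal.lintegral_mul_le_Lp_mul_Lq μ hpq
    (f := fun x => (w x)⁻¹ ^ (1 / 2 : ℝ)) (g := fun x => w x ^ (1 / 2 : ℝ) * f x)
    (hw.inv.pow_const _) ((hw.pow_const _).mul hf)
  have e1 : ∀ x, ((fun x => (w x)⁻¹ ^ (1 / 2 : ℝ)) * fun x => w x ^ (1 / 2 : ℝ) * f x) x = f x :=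
    fun x => by
      rw [Pi.mul_apply, ← mul_assoc, ← ENNReal.mul_rpow_of_nonneg _ _ (by norm_num),
        ENNReal.inv_mul_cancel (h0 x) (htop x), ENNReal.one_rpow, one_mul]
  have e2 : ∀ x, ((w x)⁻¹ ^ (1 / 2 : ℝ)) ^ (2 : ℝ) = (w x)⁻¹ := fun x => by
    rw [← ENNReal.rpow_mul]; norm_num
  have e3 : ∀ x, (w x ^ (1 / 2 : ℝ) * f x) ^ (2 : ℝ) = w x * f x ^ 2 := fun x => by
    rw [ENNReal.mul_rpow_of_nonneg _ _ (by norm_num), ← ENNReal.rpow_mul]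
    norm_num
  simp only [e1, e2, e3] at h
  calc (∫⁻ x, f x ∂μ) ^ 2 ≤ ((∫⁻ x, (w x)⁻¹ ∂μ) ^ (1 / 2 : ℝ) *
        (∫⁻ x, w x * f x ^ 2 ∂μ) ^ (1 / 2 : ℝ)) ^ 2 := pow_le_pow_left₀ zero_le h 2
    _ = _ := by
      rw [mul_pow, ← ENNReal.rpow_natCast, ← ENNReal.rpow_natCast, ← ENNReal.rpow_mul,
        ← ENNReal.rpow_mul]
      norm_num

lemma one_le_bracket (x : ℝ) : 1 ≤ bracket x := by
  unfold bracket
  rw [Real.one_le_sqrt]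
  nlinarith [sq_nonneg x]

/-- The weight `⟨σ⟩^{2b}`. -/
def modWeight (b σ : ℝ) : ℝ≥0∞ := ENNReal.ofReal (bracket σ ^ (2 * b))

@[fun_prop]
lemma measurable_modWeight (b : ℝ) : Measurable (modWeight b) := by
  unfold modWeight bracket
  fun_prop

lemma modWeight_ne_zero (b σ : ℝ) : modWeight b σ ≠ 0 := by
  have : 0 < bracket σ := one_pos.trans_le (one_le_bracket σ)
  simp only [modWeight, ne_eq, ENNReal.ofReal_eq_zero, not_le]
  positivity

lemma modWeight_ne_top (b σ : ℝ) : modWeight b σ ≠ ⊤ := ENNReal.ofReal_ne_top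

/-- The integral of `⟨σ⟩^{-2b}`. -/
def invMass (b : ℝ) : ℝ≥0∞ := ∫⁻ σ, (modWeight b σ)⁻¹

lemma invMass_lt_top {b : ℝ} (hb : 1 / 2 < b) : invMass b < ⊤ := by
  have h := (integrable_rpow_neg_one_add_norm_sq (E := ℝ) (μ := volume) (r := 2 * b)
    (by simp; linarith)).lintegral_lt_top
  refine lt_of_le_of_lt (lintegral_mono fun σ => ?_) h
  have hpos : 0 < bracket σ ^ (2 * b) := Real.rpow_pos_of_pos (one_pos.trans_le (one_le_bracket σ)) _
  rw [modWeight, ← ENNReal.ofReal_inv_of_pos hpos]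
  refine ENNReal.ofReal_le_ofReal (le_of_eq ?_)
  have : (0 : ℝ) ≤ 1 + σ ^ 2 := by positivity
  rw [bracket, Real.sqrt_eq_rpow, ← Real.rpow_mul this, ← Real.rpow_neg this, Real.norm_eq_abs,
    sq_abs]
  congr 1
  ring

/-- Amplitudes `A_k(σ)` of a function `∑_k ∫ A_k(σ) e^{it(σ - |k|²)} e^{ik·x} dσ`, whose modes are
square integrable against `⟨σ⟩^{2b}`. -/
structure WaveData (d : ℕ) (b : ℝ) where
  /-- the amplitudes -/
  amp : (Fin d → ℤ) → ℝ → ℂ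
  measurable_amp : ∀ k, Measurable (amp k)
  lintegral_lt_top : ∀ k, ∫⁻ σ, modWeight b σ * ‖amp k σ‖ₑ ^ 2 < ⊤

namespace WaveData

variable {d : ℕ} {b : ℝ} (W W' : WaveData d b)

/-- The weighted square norm of a mode. -/
def modeSq (k : Fin d → ℤ) : ℝ≥0∞ := ∫⁻ σ, modWeight b σ * ‖W.amp k σ‖ₑ ^ 2

/-- The time evolution of a mode. -/
def mode (k : Fin d → ℤ) (t : ℝ) : ℂ :=
  ∫ σ, W.amp k σ * Complex.exp (Complex.I * ((t * (σ - freqSq k) : ℝ) : ℂ))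

/-- Multiplication of the modes by constants. -/
def mult (m : (Fin d → ℤ) → ℂ) : WaveData d b where
  amp k σ := m k * W.amp k σ
  measurable_amp k := (W.measurable_amp k).const_mul _
  lintegral_lt_top k := by
    have : ∀ σ, modWeight b σ * ‖m k * W.amp k σ‖ₑ ^ 2 =
        ‖m k‖ₑ ^ 2 * (modWeight b σ * ‖W.amp k σ‖ₑ ^ 2) := fun σ => by
      rw [enorm_mul, mul_pow]; ring
    simp only [this]
    rw [lintegral_const_mul' _ _ (by simp)]
    exact ENNReal.mul_lt_top (by simp) (W.lintegral_lt_top k)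

lemma mode_mult (m : (Fin d → ℤ) → ℂ) (k : Fin d → ℤ) (t : ℝ) :
    (W.mult m).mode k t = m k * W.mode k t := by
  simp only [mode, mult, mul_assoc, integral_const_mul]

lemma modeSq_mult (m : (Fin d → ℤ) → ℂ) (k : Fin d → ℤ) :
    (W.mult m).modeSq k = ‖m k‖ₑ ^ 2 * W.modeSq k := by
  have : ∀ σ, modWeight b σ * ‖m k * W.amp k σ‖ₑ ^ 2 =
      ‖m k‖ₑ ^ 2 * (modWeight b σ * ‖W.amp k σ‖ₑ ^ 2) := fun σ => by
    rw [enorm_mul, mul_pow]; ring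
  simp only [modeSq, mult, this]
  rw [lintegral_const_mul' _ _ (by simp)]

lemma sq_lintegral_amp_le (k : Fin d → ℤ) :
    (∫⁻ σ, ‖W.amp k σ‖ₑ) ^ 2 ≤ invMass b * W.modeSq k :=
  sq_lintegral_le_weighted (W.measurable_amp k).enorm.aemeasurable
    (measurable_modWeight b).aemeasurable (modWeight_ne_zero b) (modWeight_ne_top b)

lemma integrable_amp (hb : 1 / 2 < b) (k : Fin d → ℤ) : Integrable (W.amp k) := by
  refine ⟨(W.measurable_amp k).aestronglyMeasurable, ?_⟩
  have h := (W.sq_lintegral_amp_le k).trans_lt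
    (ENNReal.mul_lt_top (invMass_lt_top hb) (W.lintegral_lt_top k))
  by_contra hcon
  rw [HasFiniteIntegral, not_lt, top_le_iff] at hcon
  rw [hcon] at h
  simp at h

/-- A mode is bounded by the `L¹` norm of its amplitude. For `b > 1/2`, where `invMass b` is finite,
this is the embedding of `X^{s,b}` in `L^∞(ℝ; H^s)`, mode by mode. -/
lemma enorm_mode_sq_le (k : Fin d → ℤ) (t : ℝ) : ‖W.mode k t‖ₑ ^ 2 ≤ invMass b * W.modeSq k := by
  refine le_trans (pow_le_pow_left₀ zero_le ?_ 2) (W.sq_lintegral_amp_le k)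
  refine (enorm_integral_le_lintegral_enorm _).trans_eq ?_
  simp only [enorm_mul]
  refine lintegral_congr fun σ => ?_
  rw [← ofReal_norm (Complex.exp _), norm_exp_I_real, ENNReal.ofReal_one, mul_one]

lemma continuous_mode (hb : 1 / 2 < b) (k : Fin d → ℤ) : Continuous (W.mode k) := by
  refine continuous_of_dominated (bound := fun σ => ‖W.amp k σ‖) ?_ ?_ (W.integrable_amp hb k).norm ?_
  · intro t
    exact ((W.measurable_amp k).mul (by fun_prop)).aestronglyMeasurable
  · intro t
    refine ae_of_all _ fun σ => ?_
    rw [norm_mul, norm_exp_I_real, mul_one]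
  · exact ae_of_all _ fun σ => by fun_prop

/-- The space-time function with modes in `S`. -/
def wave (S : Finset (Fin d → ℤ)) (y : ℝ × Torus d) : ℂ := trig S (fun k => W.mode k y.1) y.2

lemma continuous_wave (hb : 1 / 2 < b) (S : Finset (Fin d → ℤ)) : Continuous (W.wave S) := by
  unfold wave trig
  have := fun k => W.continuous_mode hb k
  fun_prop

/-- The superposed free solution with modulation `σ`. -/
def slice (S : Finset (Fin d → ℤ)) (σ : ℝ) (y : ℝ × Torus d) : ℂ :=
  ∑ k ∈ S, W.amp k σ * stCharacter (k, freqInt k) y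

/-- The transference principle: `e^{it(σ - |k|²)} = e^{itσ} e^{-it|k|²}`, and the unimodular factor
`e^{itσ}` does not depend on `k`, so a wave is an average of modulated free solutions. -/
lemma enorm_wave_le (hb : 1 / 2 < b) (S : Finset (Fin d → ℤ)) (y : ℝ × Torus d) :
    ‖W.wave S y‖ₑ ≤ ∫⁻ σ, ‖W.slice S σ y‖ₑ := by
  have h1 : W.wave S y =
      ∫ σ, Complex.exp (Complex.I * ((y.1 * σ : ℝ) : ℂ)) * W.slice S σ y := by
    simp only [wave, trig, slice, mode, Finset.mul_sum]
    rw [integral_finsetSum]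
    · refine Finset.sum_congr rfl fun k _ => ?_
      rw [← integral_mul_const]
      refine integral_congr_ae (ae_of_all _ fun σ => ?_)
      simp only [stCharacter]
      have : Complex.exp (Complex.I * ((y.1 * (σ - freqSq k) : ℝ) : ℂ)) =
          Complex.exp (Complex.I * ((y.1 * σ : ℝ) : ℂ)) *
            Complex.exp (-(Complex.I * (freqInt k) * y.1)) := by
        rw [← Complex.exp_add, ← freqInt_cast]
        congr 1
        push_cast
        ring
      rw [this]
      ring
    · intro k _
      refine ((W.integrable_amp hb k).mul_const (stCharacter (k, freqInt k) y)).bdd_mul (c := 1)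
        (by fun_prop) (ae_of_all _ fun σ => (norm_exp_I_real _).le)
  rw [h1]
  refine (enorm_integral_le_lintegral_enorm _).trans_eq (lintegral_congr fun σ => ?_)
  rw [enorm_mul, ← ofReal_norm (Complex.exp _), norm_exp_I_real, ENNReal.ofReal_one, one_mul]

lemma measurable_slice (S : Finset (Fin d → ℤ)) :
    Measurable fun z : ℝ × (ℝ × Torus d) => W.slice S z.1 z.2 := by
  unfold slice
  refine Finset.measurable_sum _ fun k _ => ?_
  exact ((W.measurable_amp k).comp measurable_fst).mul
    ((continuous_stCharacter _).measurable.comp measurable_snd)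

end WaveData

variable {d : ℕ} {b : ℝ}

/-- The number of time periods covering `(0,T)`. -/
def periods (T : ℝ) : ℕ := ⌈T / (2 * Real.pi)⌉₊ + 1

lemma le_periods (T : ℝ) : T ≤ 2 * Real.pi * periods T := by
  have h := Nat.le_ceil (T / (2 * Real.pi))
  rw [div_le_iff₀ Real.two_pi_pos] at h
  unfold periods
  push_cast
  nlinarith [Real.two_pi_pos]

lemma spaceTime_mono {T T' : ℝ} (h : T ≤ T') : spaceTime d T ≤ spaceTime d T' :=
  Measure.prod_mono (Measure.restrict_mono (Ioo_subset_Ioo le_rfl h) le_rfl) le_rfl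

/-- The constant in the bilinear estimate. -/
def bilinearConst (d : ℕ) (T b : ℝ) : ℝ≥0∞ :=
  ENNReal.ofReal (2 * Real.pi * periods T * vol d * 15360) * invMass b ^ 2

lemma bilinearConst_lt_top (hb : 1 / 2 < b) (T : ℝ) : bilinearConst d T b < ⊤ :=
  ENNReal.mul_lt_top ENNReal.ofReal_lt_top (ENNReal.pow_lt_top (invMass_lt_top hb))

/-- Bourgain's bilinear estimate: the derivatives may all be put on the first factor. -/
lemma lintegral_wave_mul_wave_le (hd : d = 1 ∨ d = 2 ∨ d = 3) (hb : 1 / 2 < b) (T : ℝ)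
    (W W' : WaveData d b) (S S' : Finset (Fin d → ℤ)) :
    ∫⁻ y, ‖W.wave S y * W'.wave S' y‖ₑ ^ 2 ∂(spaceTime d T) ≤
      bilinearConst d T b * ((∑ k ∈ S, ENNReal.ofReal (wt k) * W.modeSq k) *
        ∑ l ∈ S', W'.modeSq l) := by
  set m := periods T with hm
  have hm0 : 0 < m := by rw [hm, periods]; omega
  set c : ℝ := 2 * Real.pi * m * vol d * 15360 with hc
  have hc0 : 0 ≤ c := by have := vol_pos d; positivity
  set ν := spaceTime d (2 * Real.pi * m) with hν
  -- Enlarge the time interval to a whole number of periods, where orthogonality in time holds.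
  refine (lintegral_mono' (spaceTime_mono (le_periods T)) le_rfl).trans ?_
  change ∫⁻ y, _ ∂ν ≤ _
  have hmeas1 : Measurable fun z : (ℝ × Torus d) × (ℝ × ℝ) => W.slice S z.2.1 z.1 :=
    (W.measurable_slice S).comp (by fun_prop : Measurable fun z : (ℝ × Torus d) × (ℝ × ℝ) =>
      (z.2.1, z.1))
  have hmeas2 : Measurable fun z : (ℝ × Torus d) × (ℝ × ℝ) => W'.slice S' z.2.2 z.1 :=
    (W'.measurable_slice S').comp (by fun_prop : Measurable fun z : (ℝ × Torus d) × (ℝ × ℝ) =>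
      (z.2.2, z.1))
  have hw : Measurable fun z : ℝ × ℝ => modWeight b z.1 * modWeight b z.2 := by fun_prop
  -- Both waves are averages over modulations. Cauchy–Schwarz in the two modulations against the
  -- product weight costs the double integral of the inverse weights.
  have hpt : ∀ y, ‖W.wave S y * W'.wave S' y‖ₑ ^ 2 ≤ invMass b ^ 2 *
      ∫⁻ z : ℝ × ℝ, modWeight b z.1 * modWeight b z.2 *
        ‖W.slice S z.1 y * W'.slice S' z.2 y‖ₑ ^ 2 := by
    intro y
    have e1 : ∫⁻ z : ℝ × ℝ, ‖W.slice S z.1 y * W'.slice S' z.2 y‖ₑ =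
        (∫⁻ σ, ‖W.slice S σ y‖ₑ) * ∫⁻ σ, ‖W'.slice S' σ y‖ₑ := by
      simp only [enorm_mul]
      rw [Measure.volume_eq_prod]
      exact lintegral_prod_mul
        (((W.measurable_slice S).comp (measurable_prodMk_right (y := y))).enorm.aemeasurable)
        (((W'.measurable_slice S').comp (measurable_prodMk_right (y := y))).enorm.aemeasurable)
    have e2 : ∫⁻ z : ℝ × ℝ, (modWeight b z.1 * modWeight b z.2)⁻¹ = invMass b ^ 2 := by
      have : ∀ z : ℝ × ℝ, (modWeight b z.1 * modWeight b z.2)⁻¹ =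
          (modWeight b z.1)⁻¹ * (modWeight b z.2)⁻¹ := fun z =>
        ENNReal.mul_inv (Or.inl (modWeight_ne_zero _ _)) (Or.inl (modWeight_ne_top _ _))
      simp only [this]
      rw [Measure.volume_eq_prod, sq]
      exact lintegral_prod_mul (measurable_modWeight b).inv.aemeasurable
        (measurable_modWeight b).inv.aemeasurable
    have e3 := sq_lintegral_le_weighted (μ := (volume : Measure (ℝ × ℝ)))
      (f := fun z => ‖W.slice S z.1 y * W'.slice S' z.2 y‖ₑ)
      (w := fun z => modWeight b z.1 * modWeight b z.2)
      (((hmeas1.mul hmeas2).comp (measurable_prodMk_left (x := y))).enorm.aemeasurable)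
      hw.aemeasurable
      (fun z => mul_ne_zero (modWeight_ne_zero _ _) (modWeight_ne_zero _ _))
      (fun z => ENNReal.mul_ne_top (modWeight_ne_top _ _) (modWeight_ne_top _ _))
    rw [e2, e1] at e3
    refine le_trans (pow_le_pow_left₀ zero_le ?_ 2) e3
    rw [enorm_mul]
    exact mul_le_mul' (W.enorm_wave_le hb S y) (W'.enorm_wave_le hb S' y)
  -- With both modulations frozen, the slices are free solutions. After interchanging the integrals
  -- the weighted `L²` norms of the amplitudes reassemble into `modeSq`.
  have hfree : ∀ z : ℝ × ℝ, ∫⁻ y, ‖W.slice S z.1 y * W'.slice S' z.2 y‖ₑ ^ 2 ∂ν ≤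
      ENNReal.ofReal c * ((∑ k ∈ S, ENNReal.ofReal (wt k) * ‖W.amp k z.1‖ₑ ^ 2) *
        ∑ l ∈ S', ‖W'.amp l z.2‖ₑ ^ 2) := by
    intro z
    have h := lintegral_free_mul_free_le hd hm0 S S' (fun k => W.amp k z.1) (fun l => W'.amp l z.2)
    refine h.trans_eq ?_
    rw [← mul_assoc, ← hc, ENNReal.ofReal_mul hc0, ENNReal.ofReal_mul
      (Finset.sum_nonneg fun k _ => mul_nonneg (wt_pos k).le (sq_nonneg _)),
      ENNReal.ofReal_sum_of_nonneg (fun k _ => mul_nonneg (wt_pos k).le (sq_nonneg _)),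
      ENNReal.ofReal_sum_of_nonneg (fun k _ => sq_nonneg _)]
    simp only [ENNReal.ofReal_mul (wt_pos _).le, ofReal_norm_pow]
  calc ∫⁻ y, ‖W.wave S y * W'.wave S' y‖ₑ ^ 2 ∂ν
      ≤ ∫⁻ y, invMass b ^ 2 * (∫⁻ z : ℝ × ℝ, modWeight b z.1 * modWeight b z.2 *
          ‖W.slice S z.1 y * W'.slice S' z.2 y‖ₑ ^ 2) ∂ν := lintegral_mono hpt
    _ = invMass b ^ 2 * ∫⁻ y, (∫⁻ z : ℝ × ℝ, modWeight b z.1 * modWeight b z.2 *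
          ‖W.slice S z.1 y * W'.slice S' z.2 y‖ₑ ^ 2) ∂ν :=
        lintegral_const_mul' _ _ (ENNReal.pow_ne_top (invMass_lt_top hb).ne)
    _ = invMass b ^ 2 * ∫⁻ z : ℝ × ℝ, (∫⁻ y, modWeight b z.1 * modWeight b z.2 *
          ‖W.slice S z.1 y * W'.slice S' z.2 y‖ₑ ^ 2 ∂ν) := by
        rw [lintegral_lintegral_swap]
        exact ((hw.comp measurable_snd).mul ((hmeas1.mul hmeas2).enorm.pow_const 2)).aemeasurable
    _ ≤ invMass b ^ 2 * ∫⁻ z : ℝ × ℝ, ENNReal.ofReal c *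
          ((∑ k ∈ S, ENNReal.ofReal (wt k) * (modWeight b z.1 * ‖W.amp k z.1‖ₑ ^ 2)) *
            ∑ l ∈ S', modWeight b z.2 * ‖W'.amp l z.2‖ₑ ^ 2) := by
        refine mul_le_mul_right (lintegral_mono fun z => ?_) _
        rw [lintegral_const_mul' _ _
          (ENNReal.mul_ne_top (modWeight_ne_top _ _) (modWeight_ne_top _ _))]
        refine (mul_le_mul_right (hfree z) _).trans_eq ?_
        rw [← Finset.mul_sum]
        simp only [mul_left_comm _ (modWeight b z.1)]
        rw [← Finset.mul_sum]
        ring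
    _ = invMass b ^ 2 * (ENNReal.ofReal c *
          ((∑ k ∈ S, ENNReal.ofReal (wt k) * W.modeSq k) * ∑ l ∈ S', W'.modeSq l)) := by
        have ha : ∀ (V : WaveData d b) k, Measurable fun σ => modWeight b σ * ‖V.amp k σ‖ₑ ^ 2 :=
          fun V k => (measurable_modWeight b).mul ((V.measurable_amp k).enorm.pow_const 2)
        rw [lintegral_const_mul' _ _ ENNReal.ofReal_ne_top, Measure.volume_eq_prod,
          lintegral_prod_mul (f := fun σ => ∑ k ∈ S, ENNReal.ofReal (wt k) *
            (modWeight b σ * ‖W.amp k σ‖ₑ ^ 2))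
            (g := fun σ => ∑ l ∈ S', modWeight b σ * ‖W'.amp l σ‖ₑ ^ 2)
            (Finset.measurable_sum _ fun k _ => (ha W k).const_mul _).aemeasurable
            (Finset.measurable_sum _ fun l _ => ha W' l).aemeasurable,
          lintegral_finsetSum _ fun k _ => (ha W k).const_mul _,
          lintegral_finsetSum _ fun l _ => ha W' l]
        simp only [lintegral_const_mul' _ _ ENNReal.ofReal_ne_top]
        rfl
    _ = _ := by rw [bilinearConst, ← hm, ← hc]; ring

/-! ### Calculus for smooth functions on the torus -/

section Smooth

variable {d : ℕ} {E : Type*} [NormedAddCommGroup E] [NormedSpace ℝ E]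

lemma proj_surjective : Function.Surjective (proj (d := d)) := fun x => by
  choose y hy using fun j => QuotientAddGroup.mk_surjective (x j)
  exact ⟨y, funext hy⟩

lemma isOpenQuotientMap_proj : IsOpenQuotientMap (proj (d := d)) :=
  IsOpenQuotientMap.piMap (fun _ => QuotientAddGroup.isOpenQuotientMap_mk)

lemma IsSmooth.continuous {ψ : Torus d → E} (h : IsSmooth ψ) : Continuous ψ :=
  isOpenQuotientMap_proj.isQuotientMap.continuous_iff.mpr (ContDiff.continuous h)

lemma proj_add_single (y : Fin d → ℝ) (j : Fin d) (h : ℝ) :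
    proj y + Pi.single j (h : AddCircle (2 * Real.pi)) = proj (y + h • Pi.single j 1) := by
  funext i
  by_cases hi : i = j
  · subst hi
    simp [proj]
  · simp [proj, hi]

lemma IsSmooth.hasDerivAt {ψ : Torus d → ℂ} (hψ : IsSmooth ψ) (j : Fin d) (y : Fin d → ℝ) (r : ℝ) :
    HasDerivAt (fun h : ℝ => ψ (proj y + Pi.single j (h : AddCircle (2 * Real.pi))))
      (fderiv ℝ (fun y => ψ (proj y)) (y + r • Pi.single j 1) (Pi.single j 1)) r := by
  simp only [proj_add_single]
  have h1 : HasFDerivAt (fun y => ψ (proj y)) (fderiv ℝ (fun y => ψ (proj y))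
      (y + r • Pi.single j 1)) (y + r • Pi.single j 1) :=
    ((ContDiff.differentiable hψ (by simp)) _).hasFDerivAt
  have h2 : HasDerivAt (fun h : ℝ => y + h • (Pi.single j 1 : Fin d → ℝ)) (Pi.single j 1) r := by
    simpa using ((hasDerivAt_id r).smul_const (Pi.single j 1 : Fin d → ℝ)).const_add y
  exact h1.comp_hasDerivAt r h2

lemma IsSmooth.partialDeriv_proj {ψ : Torus d → ℂ} (hψ : IsSmooth ψ) (j : Fin d)
    (y : Fin d → ℝ) :
    partialDeriv j ψ (proj y) = fderiv ℝ (fun y => ψ (proj y)) y (Pi.single j 1) := by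
  have := (hψ.hasDerivAt j y 0).deriv
  simpa [partialDeriv] using this

lemma IsSmooth.partialDeriv {ψ : Torus d → ℂ} (hψ : IsSmooth ψ) (j : Fin d) :
    IsSmooth (partialDeriv j ψ) := by
  unfold IsSmooth
  simp only [hψ.partialDeriv_proj j]
  exact (ContDiff.fderiv_right hψ (m := ∞) (by simp)).clm_apply contDiff_const

lemma IsSmooth.hasDerivAt' {ψ : Torus d → ℂ} (hψ : IsSmooth ψ) (j : Fin d) (x : Torus d) (r : ℝ) :
    HasDerivAt (fun h : ℝ => ψ (x + Pi.single j (h : AddCircle (2 * Real.pi))))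
      (DampedNLS.partialDeriv j ψ (x + Pi.single j (r : AddCircle (2 * Real.pi)))) r := by
  obtain ⟨y, rfl⟩ := proj_surjective x
  rw [proj_add_single, hψ.partialDeriv_proj]
  exact hψ.hasDerivAt j y r

lemma IsSmooth.mul {φ ψ : Torus d → ℂ} (hφ : IsSmooth φ) (hψ : IsSmooth ψ) :
    IsSmooth fun x => φ x * ψ x :=
  ContDiff.mul hφ hψ

lemma hasDerivAt_zero_of_isSmooth {ψ : Torus d → ℂ} (hψ : IsSmooth ψ) (j : Fin d) (x : Torus d) :
    HasDerivAt (fun h : ℝ => ψ (x + Pi.single j (h : AddCircle (2 * Real.pi))))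
      (partialDeriv j ψ x) 0 := by
  simpa using hψ.hasDerivAt' j x 0

lemma partialDeriv_mul {φ ψ : Torus d → ℂ} (hφ : IsSmooth φ) (hψ : IsSmooth ψ) (j : Fin d)
    (x : Torus d) : partialDeriv j (fun x => φ x * ψ x) x =
      partialDeriv j φ x * ψ x + φ x * partialDeriv j ψ x := by
  have := ((hasDerivAt_zero_of_isSmooth hφ j x).fun_mul (hasDerivAt_zero_of_isSmooth hψ j x)).deriv
  simpa [partialDeriv] using this

/-- The integral of a partial derivative vanishes. -/
lemma integral_partialDeriv {ψ : Torus d → ℂ} (hψ : IsSmooth ψ) (j : Fin d) :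
    ∫ x, partialDeriv j ψ x = 0 := by
  have hc : Continuous (partialDeriv j ψ) := (hψ.partialDeriv j).continuous
  obtain ⟨C, hC⟩ := isCompact_univ.exists_bound_of_continuousOn hc.continuousOn
  have hadd : ∀ h : ℝ, Continuous fun x : Torus d => x + Pi.single j (h : AddCircle (2 * Real.pi)) :=
    fun h => continuous_add_const _
  -- The integral of a translate is independent of the translation, so its derivative, computed
  -- under the integral sign, must vanish.
  have h3 : HasDerivAt (fun h : ℝ => ∫ x : Torus d, ψ (x + Pi.single j (h : AddCircle (2 * Real.pi))))
      (∫ x : Torus d, partialDeriv j ψ (x + Pi.single j ((0 : ℝ) : AddCircle (2 * Real.pi)))) 0 := by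
    refine (hasDerivAt_integral_of_dominated_loc_of_deriv_le
      (μ := (volume : Measure (Torus d)))
      (F := fun (h : ℝ) x => ψ (x + Pi.single j (h : AddCircle (2 * Real.pi))))
      (F' := fun (h : ℝ) x => partialDeriv j ψ (x + Pi.single j (h : AddCircle (2 * Real.pi))))
      (s := univ) (bound := fun _ => C)
      univ_mem ?_ ?_ ?_ ?_ (integrable_const C) ?_).2
    · exact Eventually.of_forall fun h => (hψ.continuous.comp (hadd h)).aestronglyMeasurable
    · exact integrable_of_continuous (hψ.continuous.comp (hadd 0))
    · exact (hc.comp (hadd 0)).aestronglyMeasurable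
    · exact ae_of_all _ fun x h _ => hC _ (mem_univ _)
    · exact ae_of_all _ fun x h _ => hψ.hasDerivAt' j x h
  have h2 : ∀ h : ℝ, ∫ x : Torus d, ψ (x + Pi.single j (h : AddCircle (2 * Real.pi))) = ∫ x, ψ x := fun h =>
    integral_add_right_eq_self ψ _
  simp only [h2] at h3
  have h4 := h3.unique (hasDerivAt_const (0 : ℝ) (∫ x, ψ x))
  rwa [integral_add_right_eq_self (partialDeriv j ψ)] at h4

/-- Integration by parts. -/
lemma integral_mul_partialDeriv {φ ψ : Torus d → ℂ} (hφ : IsSmooth φ) (hψ : IsSmooth ψ)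
    (j : Fin d) : ∫ x, φ x * partialDeriv j ψ x = -∫ x, partialDeriv j φ x * ψ x := by
  have h := integral_partialDeriv (hφ.mul hψ) j
  simp only [partialDeriv_mul hφ hψ] at h
  rw [integral_add (f := fun x => partialDeriv j φ x * ψ x) (g := fun x => φ x * partialDeriv j ψ x)
    (integrable_of_continuous ((hφ.partialDeriv j).continuous.mul hψ.continuous))
    (integrable_of_continuous (hφ.continuous.mul (hψ.partialDeriv j).continuous))] at h
  linear_combination h

lemma character_proj (k : Fin d → ℤ) (y : Fin d → ℝ) :
    character k (proj y) = Complex.exp (Complex.I * ∑ j, (k j : ℂ) * (y j : ℂ)) := by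
  rw [character, Finset.mul_sum, Complex.exp_sum]
  refine Finset.prod_congr rfl fun j _ => ?_
  rw [proj, fourier_coe_apply]
  congr 1
  have : (Real.pi : ℂ) ≠ 0 := by exact_mod_cast Real.pi_ne_zero
  push_cast
  field_simp

lemma isSmooth_character (k : Fin d → ℤ) : IsSmooth (character k) := by
  unfold IsSmooth
  simp only [character_proj]
  refine ContDiff.cexp (contDiff_const.mul (ContDiff.sum fun j _ => contDiff_const.mul ?_))
  exact Complex.ofRealCLM.contDiff.comp (contDiff_apply ℝ ℝ j)

lemma character_add_single (k : Fin d → ℤ) (x : Torus d) (j : Fin d) (h : ℝ) :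
    character k (x + Pi.single j (h : AddCircle (2 * Real.pi))) =
      Complex.exp (Complex.I * k j * h) * character k x := by
  obtain ⟨y, rfl⟩ := proj_surjective x
  rw [proj_add_single, character_proj, character_proj, ← Complex.exp_add]
  congr 1
  simp only [Pi.add_apply, Pi.smul_apply, smul_eq_mul, Complex.ofReal_add, mul_add,
    Finset.sum_add_distrib]
  rw [add_comm]
  congr 1
  rw [Finset.sum_eq_single j]
  · simp [mul_assoc]
  · intro i _ hi
    simp [hi]
  · simp

lemma hasDerivAt_character (k : Fin d → ℤ) (x : Torus d) (j : Fin d) :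
    HasDerivAt (fun h : ℝ => character k (x + Pi.single j (h : AddCircle (2 * Real.pi))))
      (Complex.I * k j * character k x) 0 := by
  simp only [character_add_single]
  have h1 : HasDerivAt (fun h : ℝ => Complex.I * k j * (h : ℂ)) (Complex.I * k j) 0 := by
    simpa using (Complex.ofRealCLM.hasDerivAt (x := (0 : ℝ))).const_mul (Complex.I * k j)
  simpa using h1.cexp.mul_const (character k x)

lemma partialDeriv_character (k : Fin d → ℤ) (j : Fin d) (x : Torus d) :
    partialDeriv j (character k) x = Complex.I * k j * character k x :=
  (hasDerivAt_character k x j).deriv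

lemma isSmooth_trig (S : Finset (Fin d → ℤ)) (c : (Fin d → ℤ) → ℂ) : IsSmooth (trig S c) :=
  ContDiff.sum fun k _ => contDiff_const.mul (isSmooth_character k)

lemma partialDeriv_trig (S : Finset (Fin d → ℤ)) (c : (Fin d → ℤ) → ℂ) (j : Fin d) (x : Torus d) :
    partialDeriv j (trig S c) x = trig S (fun k => Complex.I * k j * c k) x := by
  have h : HasDerivAt (fun h : ℝ => trig S c (x + Pi.single j (h : AddCircle (2 * Real.pi))))
      (∑ k ∈ S, c k * (Complex.I * k j * character k x)) 0 :=
    HasDerivAt.fun_sum fun k _ => (hasDerivAt_character k x j).const_mul (c k)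
  rw [partialDeriv, h.deriv, trig]
  exact Finset.sum_congr rfl fun k _ => by ring

lemma partialDeriv_const_mul_character (c : ℂ) (k : Fin d → ℤ) (j : Fin d) (x : Torus d) :
    partialDeriv j (fun x => c * character k x) x = Complex.I * k j * c * character k x := by
  rw [partialDeriv, ((hasDerivAt_character k x j).const_mul c).deriv]
  ring

lemma laplacian_const_mul_character (c : ℂ) (k : Fin d → ℤ) (x : Torus d) :
    laplacian (fun x => c * character k x) x = -(freqSq k : ℂ) * (c * character k x) := by
  have h1 : ∀ j : Fin d, partialDeriv j (fun x => c * character k x) =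
      fun x => Complex.I * k j * c * character k x :=
    fun j => funext fun x => partialDeriv_const_mul_character c k j x
  simp only [laplacian, h1, partialDeriv_const_mul_character, freqSq]
  push_cast
  rw [neg_mul, Finset.sum_mul, ← Finset.sum_neg_distrib]
  refine Finset.sum_congr rfl fun j _ => ?_
  linear_combination ((k j : ℂ)) ^ 2 * c * character k x * Complex.I_sq

end Smooth

variable {d : ℕ}

/-! ### Weak gradients and the space `H¹` -/

/-- A continuous function as an element of `L²`. -/
def contL2 (F : Torus d → ℂ) (hF : Continuous F) : L2 d := (memLp_of_continuous hF).toLp F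

lemma coeFn_contL2 {F : Torus d → ℂ} (hF : Continuous F) : contL2 F hF =ᵐ[volume] F :=
  MemLp.coeFn_toLp _

/-- Integration against a continuous function, as a continuous linear functional on `L²`. -/
def pairCLM (φ : Torus d → ℂ) (hφ : Continuous φ) : L2 d →L[ℂ] ℂ :=
  innerSL ℂ (contL2 (fun x => conj (φ x)) (by fun_prop))

lemma pairCLM_apply {φ : Torus d → ℂ} (hφ : Continuous φ) (f : L2 d) :
    pairCLM φ hφ f = ∫ x, f x * φ x := by
  rw [pairCLM, innerSL_apply_apply, L2.inner_def]
  refine integral_congr_ae ?_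
  have hc : Continuous fun x => conj (φ x) := by fun_prop
  filter_upwards [coeFn_contL2 hc] with x hx
  rw [hx]
  simp

lemma pairCLM_characterL2 {φ : Torus d → ℂ} (hφ : Continuous φ) (k : Fin d → ℤ) :
    pairCLM φ hφ (characterL2 k) = ∫ x, character k x * φ x := by
  rw [pairCLM_apply]
  refine integral_congr_ae ?_
  filter_upwards [coeFn_characterL2 k] with x hx
  rw [hx]

lemma integrable_L2_mul (f : L2 d) {φ : Torus d → ℂ} (hφ : Continuous φ) :
    Integrable fun x => f x * φ x :=
  (Lp.memLp f).integrable_mul (memLp_of_continuous (p := 2) hφ)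

lemma integrable_L2 (f : L2 d) : Integrable f := (Lp.memLp f).integrable (by norm_num)

lemma coeff_weakGradient {f : L2 d} {v : Fin d → L2 d} (h : IsWeakGradient f v) (j : Fin d)
    (k : Fin d → ℤ) : coeff (v j) k = Complex.I * k j * coeff f k := by
  have h1 := h j (character (-k)) (isSmooth_character _)
  simp only [partialDeriv_character] at h1
  have h2 : ∫ x, f x * (Complex.I * ((-k) j : ℤ) * character (-k) x) =
      -(Complex.I * k j) * ∫ x, f x * character (-k) x := by
    rw [← integral_const_mul]
    refine integral_congr_ae (ae_of_all _ fun x => ?_)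
    simp only [Pi.neg_apply, Int.cast_neg]
    ring
  rw [h2] at h1
  rw [coeff_eq_fcoeff, coeff_eq_fcoeff, fcoeff_def, fcoeff_def]
  linear_combination ((vol d : ℂ))⁻¹ * h1

/-- Both sides of the defining identity are continuous linear functionals on `L²`, so it suffices to
expand in Fourier series and integrate by parts against each character. -/
lemma isWeakGradient_of_coeff {f : L2 d} {v : Fin d → L2 d}
    (h : ∀ j k, coeff (v j) k = Complex.I * k j * coeff f k) : IsWeakGradient f v := by
  intro j ψ hψ
  have hc : Continuous (partialDeriv j ψ) := (hψ.partialDeriv j).continuous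
  have h1 := (hasSum_coeff_smul f).mapL (pairCLM _ hc)
  have h2 := ((hasSum_coeff_smul (v j)).mapL (pairCLM _ hψ.continuous)).neg
  simp only [map_smul, pairCLM_characterL2] at h1 h2
  rw [pairCLM_apply] at h1 h2
  have e : (fun k => coeff f k • ∫ x, character k x * partialDeriv j ψ x) =
      fun k => -(coeff (v j) k • ∫ x, character k x * ψ x) := by
    funext k
    rw [integral_mul_partialDeriv (isSmooth_character k) hψ]
    simp only [partialDeriv_character, mul_assoc, integral_const_mul, h, smul_eq_mul]
    ring
  rw [e] at h1
  exact h1.unique h2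

/-- The square of the `H¹` norm. -/
def h1Sq (f : L2 d) : ℝ≥0∞ := ∑' k, ENNReal.ofReal (wt k) * ‖coeff f k‖ₑ ^ 2

lemma lintegral_enorm_sq_eq (f : L2 d) :
    ∫⁻ x, ‖f x‖ₑ ^ 2 = ENNReal.ofReal (vol d) * ∑' k, ‖coeff f k‖ₑ ^ 2 := by
  have h1 : ∫⁻ x, ‖f x‖ₑ ^ 2 = ENNReal.ofReal (‖f‖ ^ 2) := by
    have : Integrable (fun x => ‖f x‖ ^ 2) := (Lp.memLp f).integrable_norm_pow (p := 2) (by simp)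
    rw [lintegral_enorm_pow_eq this]
    congr 1
    have h2 : ∀ x, inner ℂ (f x) (f x) = ((‖f x‖ ^ 2 : ℝ) : ℂ) := fun x => by
      rw [inner_self_eq_norm_sq_to_K]; norm_cast
    rw [@norm_sq_eq_re_inner ℂ, L2.inner_def]
    simp only [h2, integral_complex_ofReal]
    simp
  rw [h1, ← (hasSum_norm_coeff_sq f).tsum_eq, ENNReal.ofReal_tsum_of_nonneg
    (fun k => mul_nonneg (vol_pos d).le (sq_nonneg _)) (hasSum_norm_coeff_sq f).summable]
  simp only [ENNReal.ofReal_mul (vol_pos d).le, ofReal_norm_pow]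
  rw [ENNReal.tsum_mul_left]

lemma vol_mul_h1Sq {f : L2 d} {v : Fin d → L2 d} (h : IsWeakGradient f v) :
    ENNReal.ofReal (vol d) * h1Sq f = (∫⁻ x, ‖f x‖ₑ ^ 2) + ∑ j, ∫⁻ x, ‖v j x‖ₑ ^ 2 := by
  simp only [lintegral_enorm_sq_eq, coeff_weakGradient h]
  rw [← Finset.mul_sum, ← mul_add, ← Summable.tsum_finsetSum (fun _ _ => ENNReal.summable),
    ← ENNReal.tsum_add, h1Sq]
  congr 1
  refine tsum_congr fun k => ?_
  have : ∀ j, ‖Complex.I * (k j : ℂ) * coeff f k‖ₑ ^ 2 =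
      ENNReal.ofReal ((k j : ℝ) ^ 2) * ‖coeff f k‖ₑ ^ 2 := fun j => by
    have hI : ‖Complex.I‖ₑ = 1 := by rw [← ofReal_norm, Complex.norm_I, ENNReal.ofReal_one]
    rw [enorm_mul, enorm_mul, mul_pow, mul_pow, hI, ← ofReal_norm_pow (k j : ℂ)]
    simp
  simp only [this]
  rw [← Finset.sum_mul, ← ENNReal.ofReal_sum_of_nonneg (fun _ _ => sq_nonneg _), wt,
    ENNReal.ofReal_add zero_le_one (freqSq_nonneg k), freqSq]
  simp [add_mul]

lemma exists_isWeakGradient {f : L2 d} (h : h1Sq f < ⊤) : ∃ v, IsWeakGradient f v := by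
  have hs : Summable fun k => wt k * ‖coeff f k‖ ^ 2 := by
    have := ENNReal.summable_toReal h.ne
    refine this.congr fun k => ?_
    rw [ENNReal.toReal_mul, ENNReal.toReal_ofReal (wt_pos k).le, ENNReal.toReal_pow, toReal_enorm]
  have hj : ∀ j : Fin d, ∃ v : L2 d, ∀ k, coeff v k = Complex.I * k j * coeff f k := fun j => by
    refine exists_coeff_eq (Summable.of_nonneg_of_le (fun _ => sq_nonneg _) (fun k => ?_) hs)
    rw [norm_mul, norm_mul, Complex.norm_I, one_mul, mul_pow]
    refine mul_le_mul_of_nonneg_right ?_ (sq_nonneg _)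
    have h3 : ((k j : ℝ)) ^ 2 ≤ freqSq k :=
      Finset.single_le_sum (f := fun j => (k j : ℝ) ^ 2) (fun _ _ => sq_nonneg _)
        (Finset.mem_univ j)
    rw [Complex.norm_intCast, sq_abs, wt]
    linarith
  choose v hv using hj
  exact ⟨v, isWeakGradient_of_coeff hv⟩

lemma dirichlet_eq {f : L2 d} {v : Fin d → L2 d} (h : IsWeakGradient f v) :
    dirichlet f = ∑ j, ∫⁻ x, ‖v j x‖ₑ ^ 2 := by
  have huniq : ∀ v', IsWeakGradient f v' → v' = v := fun v' h' =>
    funext fun j => ext_coeff fun k => by rw [coeff_weakGradient h', coeff_weakGradient h]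
  have hsum : ∫⁻ x, ∑ j, ‖v j x‖ₑ ^ 2 = ∑ j, ∫⁻ x, ‖v j x‖ₑ ^ 2 :=
    lintegral_finsetSum' _ fun j _ => (Lp.aestronglyMeasurable (v j)).enorm.pow_const 2
  refine le_antisymm ((iInf_le _ (⟨v, h⟩ : {v // IsWeakGradient f v})).trans_eq hsum)
    (le_iInf fun v' => ?_)
  rw [huniq v'.1 v'.2, hsum]

lemma energy_eq {f : L2 d} (h : h1Sq f < ⊤) :
    energy f = 1 / 2 * (ENNReal.ofReal (vol d) * h1Sq f) + 1 / 4 * ∫⁻ x, ‖f x‖ₑ ^ 4 := by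
  obtain ⟨v, hv⟩ := exists_isWeakGradient h
  rw [energy, dirichlet_eq hv, vol_mul_h1Sq hv, mul_add]

/-- The weak gradient of a smooth function is its classical gradient. -/
lemma isWeakGradient_contL2 {F : Torus d → ℂ} (hF : IsSmooth F) :
    IsWeakGradient (contL2 F hF.continuous)
      (fun j => contL2 (partialDeriv j F) (hF.partialDeriv j).continuous) := by
  intro j ψ hψ
  have h1 : ∫ x, contL2 F hF.continuous x * partialDeriv j ψ x = ∫ x, F x * partialDeriv j ψ x := by
    refine integral_congr_ae ?_
    filter_upwards [coeFn_contL2 hF.continuous] with x hx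
    rw [hx]
  have h2 : ∫ x, contL2 (partialDeriv j F) (hF.partialDeriv j).continuous x * ψ x =
      ∫ x, partialDeriv j F x * ψ x := by
    refine integral_congr_ae ?_
    filter_upwards [coeFn_contL2 (hF.partialDeriv j).continuous] with x hx
    rw [hx]
  rw [h1, h2, integral_mul_partialDeriv hF hψ]

lemma add_sq_le_ennreal (p q : ℝ≥0∞) : (p + q) ^ 2 ≤ 2 * (p ^ 2 + q ^ 2) := by
  have := ENNReal.rpow_add_le_mul_rpow_add_rpow p q (p := 2) (by norm_num)
  norm_num at this
  exact this

/-- Multiplication by a smooth function on `H¹`. -/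
lemma exists_mul_smooth {a : Torus d → ℂ} (ha : IsSmooth a) :
    ∃ C : ℝ≥0∞, C < ⊤ ∧ ∀ f : L2 d, ∃ h : L2 d, (h =ᵐ[volume] fun x => a x * f x) ∧
      h1Sq h ≤ C * h1Sq f := by
  obtain ⟨M, hM⟩ := isCompact_univ.exists_bound_of_continuousOn ha.continuous.continuousOn
  have hM' : ∀ j, ∃ M', ∀ x, ‖partialDeriv j a x‖ ≤ M' := fun j => by
    obtain ⟨M', h⟩ := isCompact_univ.exists_bound_of_continuousOn
      (ha.partialDeriv j).continuous.continuousOn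
    exact ⟨M', fun x => h x (mem_univ x)⟩
  choose M' hM' using hM'
  set A : ℝ≥0∞ := ENNReal.ofReal M with hA
  set A' : ℝ≥0∞ := ∑ j, ENNReal.ofReal (M' j) with hA'
  have hAtop : A ≠ ⊤ := ENNReal.ofReal_ne_top
  have hA'top : A' ≠ ⊤ := by simp [hA']
  have hae : ∀ x, ‖a x‖ₑ ≤ A := fun x => by
    rw [← ofReal_norm]; exact ENNReal.ofReal_le_ofReal (hM x (mem_univ x))
  have hae' : ∀ j x, ‖partialDeriv j a x‖ₑ ≤ A' := fun j x => by
    rw [← ofReal_norm]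
    exact (ENNReal.ofReal_le_ofReal (hM' j x)).trans
      (Finset.single_le_sum (f := fun j => ENNReal.ofReal (M' j)) (fun _ _ => zero_le)
        (Finset.mem_univ j))
  have hmul : ∀ φ : Torus d → ℂ, Continuous φ → ∀ f : L2 d, MemLp (fun x => φ x * f x) 2 :=
    fun φ hφ f => (Lp.memLp f).mul' (memLp_of_continuous (p := ⊤) hφ)
  -- The `+ 1` keeps the constant nonzero, so that the right side is infinite when `f` is not in
  -- `H¹`.
  refine ⟨A ^ 2 + 2 * (A ^ 2 + d * A' ^ 2) + 1, by finiteness, fun f => ?_⟩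
  refine ⟨(hmul a ha.continuous f).toLp _, MemLp.coeFn_toLp _, ?_⟩
  rcases eq_or_ne (h1Sq f) ⊤ with htop | htop
  · rw [htop, ENNReal.mul_top (by simp)]
    exact le_top
  obtain ⟨v, hv⟩ := exists_isWeakGradient htop.lt_top
  have hw : ∀ j, MemLp (fun x => a x * v j x + partialDeriv j a x * f x) 2 := fun j =>
    (hmul a ha.continuous (v j)).add (hmul _ (ha.partialDeriv j).continuous f)
  -- The Leibniz rule in weak form: `aψ` is again a test function, and `a ∂ψ = ∂(aψ) - (∂a)ψ`.
  have hgrad : IsWeakGradient ((hmul a ha.continuous f).toLp _) (fun j => (hw j).toLp _) := by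
    intro j ψ hψ
    have e1 : ∫ x, (hmul a ha.continuous f).toLp _ x * partialDeriv j ψ x =
        ∫ x, (f x * partialDeriv j (fun x => a x * ψ x) x - f x * (partialDeriv j a x * ψ x)) := by
      refine integral_congr_ae ?_
      filter_upwards [(hmul a ha.continuous f).coeFn_toLp] with x hx
      rw [hx, partialDeriv_mul ha hψ]
      ring
    have e2 : ∫ x, (hw j).toLp _ x * ψ x =
        ∫ x, (v j x * (a x * ψ x) + f x * (partialDeriv j a x * ψ x)) := by
      refine integral_congr_ae ?_
      filter_upwards [(hw j).coeFn_toLp] with x hx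
      rw [hx]
      ring
    have c1 : Continuous fun x => a x * ψ x := ha.continuous.mul hψ.continuous
    have c2 : Continuous fun x => partialDeriv j a x * ψ x :=
      (ha.partialDeriv j).continuous.mul hψ.continuous
    rw [e1, e2, integral_sub (integrable_L2_mul f ((ha.mul hψ).partialDeriv j).continuous)
      (integrable_L2_mul f c2), integral_add (integrable_L2_mul (v j) c1) (integrable_L2_mul f c2),
      hv j _ (ha.mul hψ)]
    ring
  have hV : ENNReal.ofReal (vol d) ≠ 0 := by simp [vol_pos d]
  rw [← ENNReal.mul_le_mul_iff_right hV ENNReal.ofReal_ne_top, vol_mul_h1Sq hgrad, mul_left_comm,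
    vol_mul_h1Sq hv]
  set I0 := ∫⁻ x, ‖f x‖ₑ ^ 2 with hI0
  have b0 : ∫⁻ x, ‖(hmul a ha.continuous f).toLp _ x‖ₑ ^ 2 ≤ A ^ 2 * I0 := by
    rw [hI0, ← lintegral_const_mul' _ _ (by finiteness)]
    refine lintegral_mono_ae ?_
    filter_upwards [(hmul a ha.continuous f).coeFn_toLp] with x hx
    rw [hx, enorm_mul, mul_pow]
    gcongr
    exact hae x
  have b1 : ∀ j, ∫⁻ x, ‖(hw j).toLp _ x‖ₑ ^ 2 ≤
      2 * (A ^ 2 * (∫⁻ x, ‖v j x‖ₑ ^ 2) + A' ^ 2 * I0) := by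
    intro j
    rw [hI0, ← lintegral_const_mul' _ _ (by finiteness), ← lintegral_const_mul' _ _ (by finiteness),
      ← lintegral_add_left' (((Lp.aestronglyMeasurable (v j)).enorm.pow_const 2).const_mul _),
      ← lintegral_const_mul' _ _ (by finiteness)]
    refine lintegral_mono_ae ?_
    filter_upwards [(hw j).coeFn_toLp] with x hx
    rw [hx]
    calc ‖a x * v j x + partialDeriv j a x * f x‖ₑ ^ 2
        ≤ (‖a x * v j x‖ₑ + ‖partialDeriv j a x * f x‖ₑ) ^ 2 := by
          gcongr; exact enorm_add_le _ _
      _ ≤ 2 * (‖a x * v j x‖ₑ ^ 2 + ‖partialDeriv j a x * f x‖ₑ ^ 2) := add_sq_le_ennreal _ _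
      _ ≤ _ := by
          rw [enorm_mul, enorm_mul, mul_pow, mul_pow]
          gcongr
          · exact hae x
          · exact hae' j x
  calc _ ≤ A ^ 2 * I0 + ∑ j, 2 * (A ^ 2 * (∫⁻ x, ‖v j x‖ₑ ^ 2) + A' ^ 2 * I0) :=
        add_le_add b0 (Finset.sum_le_sum fun j _ => b1 j)
    _ = A ^ 2 * I0 + 2 * (A ^ 2 * (∑ j, ∫⁻ x, ‖v j x‖ₑ ^ 2) + d * A' ^ 2 * I0) := by
        rw [← Finset.mul_sum, Finset.sum_add_distrib, ← Finset.mul_sum, Finset.sum_const,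
          Finset.card_univ, Fintype.card_fin, nsmul_eq_mul]
        ring
    _ ≤ _ := by
        set I1 := ∑ j, ∫⁻ x, ‖v j x‖ₑ ^ 2
        have : (A ^ 2 + 2 * (A ^ 2 + d * A' ^ 2) + 1) * (I0 + I1) =
          (A ^ 2 * I0 + 2 * (A ^ 2 * I1 + d * A' ^ 2 * I0)) +
            (A ^ 2 * I1 + 2 * A ^ 2 * I0 + 2 * d * A' ^ 2 * I1 + I0 + I1) := by ring
        rw [this]
        exact le_self_add

/-! ### The embedding `H¹ ⊂ L⁴` -/

/-- The constant in the embedding `H¹ ⊂ L⁴`. -/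
def embedConst (d : ℕ) : ℝ≥0∞ := ENNReal.ofReal (vol d * 221184)

lemma lintegral_trig_pow_four_le' (hd : d = 1 ∨ d = 2 ∨ d = 3) (S : Finset (Fin d → ℤ))
    (c : (Fin d → ℤ) → ℂ) :
    ∫⁻ x, ‖trig S c x‖ₑ ^ 4 ≤
      embedConst d * (∑ k ∈ S, ENNReal.ofReal (wt k) * ‖c k‖ₑ ^ 2) ^ 2 := by
  refine (lintegral_trig_pow_four_le hd S c).trans_eq ?_
  have h0 : ∀ k ∈ S, 0 ≤ wt k * ‖c k‖ ^ 2 := fun k _ => mul_nonneg (wt_pos k).le (sq_nonneg _)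
  rw [← mul_assoc, ENNReal.ofReal_mul (mul_nonneg (vol_pos d).le (by norm_num)),
    ENNReal.ofReal_pow (Finset.sum_nonneg h0), ENNReal.ofReal_sum_of_nonneg h0, embedConst]
  simp only [ENNReal.ofReal_mul (wt_pos _).le, ofReal_norm_pow]

/-- Fatou's lemma along a subsequence of the truncations that converges almost everywhere; the bound
for trigonometric polynomials is uniform in the truncation. -/
lemma lintegral_pow_four_le (hd : d = 1 ∨ d = 2 ∨ d = 3) (f : L2 d) :
    ∫⁻ x, ‖f x‖ₑ ^ 4 ≤ embedConst d * h1Sq f ^ 2 := by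
  have h1 := tendstoInMeasure_of_tendsto_Lp (tendsto_trigL2_coeff f)
  obtain ⟨ns, -, hns⟩ := h1.exists_seq_tendsto_ae
  have h2 : ∀ᵐ x, Tendsto (fun i => ‖trigL2 (box d (ns i)) (coeff f) x‖ₑ ^ 4) atTop
      (𝓝 (‖f x‖ₑ ^ 4)) := by
    filter_upwards [hns] with x hx
    exact ((ENNReal.continuous_pow 4).tendsto _).comp hx.enorm
  calc ∫⁻ x, ‖f x‖ₑ ^ 4
      = ∫⁻ x, liminf (fun i => ‖trigL2 (box d (ns i)) (coeff f) x‖ₑ ^ 4) atTop := by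
        refine lintegral_congr_ae ?_
        filter_upwards [h2] with x hx
        exact hx.liminf_eq.symm
    _ ≤ liminf (fun i => ∫⁻ x, ‖trigL2 (box d (ns i)) (coeff f) x‖ₑ ^ 4) atTop :=
        lintegral_liminf_le' fun i => (Lp.aestronglyMeasurable _).enorm.pow_const 4
    _ ≤ liminf (fun _ : ℕ => embedConst d * h1Sq f ^ 2) atTop := by
        refine liminf_le_liminf (Eventually.of_forall fun i => ?_)
        have : ∫⁻ x, ‖trigL2 (box d (ns i)) (coeff f) x‖ₑ ^ 4 =
            ∫⁻ x, ‖trig (box d (ns i)) (coeff f) x‖ₑ ^ 4 := by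
          refine lintegral_congr_ae ?_
          filter_upwards [coeFn_trigL2 (box d (ns i)) (coeff f)] with x hx
          rw [hx]
        change ∫⁻ x, ‖trigL2 (box d (ns i)) (coeff f) x‖ₑ ^ 4 ≤ _
        rw [this]
        refine (lintegral_trig_pow_four_le' hd _ _).trans ?_
        gcongr
        exact ENNReal.sum_le_tsum _
    _ = _ := by simp

/-- The embedding in terms of the classical gradient. It is meant for products of waves, whose
gradient is given by the Leibniz rule while their Fourier coefficients are unwieldy. -/
lemma lintegral_smooth_pow_four_le (hd : d = 1 ∨ d = 2 ∨ d = 3) {F : Torus d → ℂ}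
    (hF : IsSmooth F) :
    ENNReal.ofReal (vol d) ^ 2 * ∫⁻ x, ‖F x‖ₑ ^ 4 ≤
      embedConst d * ((∫⁻ x, ‖F x‖ₑ ^ 2) + ∑ j, ∫⁻ x, ‖partialDeriv j F x‖ₑ ^ 2) ^ 2 := by
  have h := lintegral_pow_four_le hd (contL2 F hF.continuous)
  have h2 := vol_mul_h1Sq (isWeakGradient_contL2 hF)
  have e : ∀ (G : Torus d → ℂ) (hG : Continuous G) (n : ℕ),
      ∫⁻ x, ‖contL2 G hG x‖ₑ ^ n = ∫⁻ x, ‖G x‖ₑ ^ n := fun G hG n => by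
    refine lintegral_congr_ae ?_
    filter_upwards [coeFn_contL2 hG] with x hx
    rw [hx]
  simp only [e] at h h2
  rw [← h2, mul_pow]
  calc _ ≤ ENNReal.ofReal (vol d) ^ 2 * (embedConst d * h1Sq (contL2 F hF.continuous) ^ 2) := by
        gcongr
    _ = _ := by ring

/-! ### Fourier representation of elements of Bourgain spaces -/

section Representation

variable {d : ℕ}

open FourierTransform

/-- Fourier inversion for a mode of a square integrable function with integrable transform. -/
lemma coeff_eq_fourierInv (v : Lp (L2 d) 2 (volume : Measure ℝ)) (k : Fin d → ℤ)
    (hV : Integrable fun ξ => coeff ((𝓕 v : Lp (L2 d) 2 (volume : Measure ℝ)) ξ) k) :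
    (fun t => coeff (v t) k) =ᵐ[volume]
      𝓕⁻ (fun ξ => coeff ((𝓕 v : Lp (L2 d) 2 (volume : Measure ℝ)) ξ) k) := by
  set V : ℝ → ℂ := fun ξ => coeff ((𝓕 v : Lp (L2 d) 2 (volume : Measure ℝ)) ξ) k with hVdef
  have hVneg : Integrable fun ξ => V (-ξ) := hV.comp_neg
  have hw : Continuous (𝓕⁻ V) := by
    rw [Real.fourierInv_eq_fourier_comp_neg]
    exact VectorFourier.fourierIntegral_continuous Real.continuous_fourierChar
      (by exact continuous_inner) hVneg
  have hv : LocallyIntegrable fun t => coeff (v t) k := by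
    have h1 : MemLp (fun t => coeffCLM k (v t)) 2 := (coeffCLM k).comp_memLp v
    simp only [coeffCLM_apply] at h1
    exact h1.locallyIntegrable (by norm_num)
  have hint : ∀ (w : Lp (L2 d) 2 (volume : Measure ℝ)) (φ : SchwartzMap ℝ ℂ),
      coeffCLM k (∫ t, φ t • w t) = ∫ t, φ t * coeff (w t) k := by
    intro w φ
    rw [← ContinuousLinearMap.integral_comp_comm]
    · simp only [map_smul, coeffCLM_apply, smul_eq_mul]
    · exact memLp_one_iff_integrable.mp ((Lp.memLp w).smul (φ.memLp 2))
  have hzero : ∀ᵐ t, coeff (v t) k - 𝓕⁻ V t = 0 := by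
    refine ae_eq_zero_of_integral_contDiff_smul_eq_zero (hv.sub hw.locallyIntegrable) ?_
    intro θ hθ hθc
    have hg₁ : HasCompactSupport (Complex.ofRealCLM ∘ θ) := hθc.comp_left rfl
    have hg₂ : ContDiff ℝ ∞ (Complex.ofRealCLM ∘ θ) := by fun_prop
    set φ : SchwartzMap ℝ ℂ := hg₁.toSchwartzMap hg₂ with hφ
    have hφt : ∀ t, φ t = (θ t : ℂ) := fun t => rfl
    -- The transform on `L²` agrees with that of tempered distributions, so testing against `𝓕⁻ φ`
    -- moves it off `v`. Applying the `k`-th coefficient turns this identity of vector-valued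
    -- integrals into a scalar one, where `V` is integrable and the transform can be moved onto it.
    have h0 := DFunLike.congr_fun (Lp.fourier_toTemperedDistribution_eq v) (𝓕⁻ φ)
    rw [TemperedDistribution.fourier_apply, FourierTransform.fourier_fourierInv_eq,
      Lp.toTemperedDistribution_apply, Lp.toTemperedDistribution_apply] at h0
    have h1 : ∫ t, φ t * coeff (v t) k = ∫ ξ, (𝓕⁻ φ) ξ * V ξ :=
      (hint v φ).symm.trans ((congrArg (coeffCLM k) h0).trans (hint _ _))
    have h2 : ∫ ξ, (𝓕⁻ φ) ξ * V ξ = ∫ t, φ t * 𝓕⁻ V t := by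
      rw [Real.fourierInv_eq_fourier_comp_neg V, SchwartzMap.fourierInv_coe]
      have h3 : ∫ ξ, 𝓕⁻ (φ : ℝ → ℂ) ξ * V ξ = ∫ ξ, 𝓕 (φ : ℝ → ℂ) ξ * V (-ξ) := by
        rw [← integral_neg_eq_self]
        refine integral_congr_ae (ae_of_all _ fun ξ => ?_)
        simp only [Real.fourierInv_eq_fourier_neg, neg_neg]
      rw [h3]
      simpa using! VectorFourier.integral_fourierIntegral_smul_eq_flip (L := innerₗ ℝ)
        Real.continuous_fourierChar continuous_inner φ.integrable hVneg
    rw [h2] at h1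
    have i1 : Integrable fun t => θ t • coeff (v t) k :=
      hv.integrable_smul_left_of_hasCompactSupport hθ.continuous hθc
    have i2 : Integrable fun t => θ t • 𝓕⁻ V t :=
      (hw.locallyIntegrable).integrable_smul_left_of_hasCompactSupport hθ.continuous hθc
    simp only [smul_sub]
    rw [integral_sub i1 i2, sub_eq_zero]
    simpa only [hφt, Complex.real_smul] using h1
  filter_upwards [hzero] with t ht
  exact sub_eq_zero.mp ht

lemma bracket_sqrt_freqSq_sq (k : Fin d → ℤ) : bracket (Real.sqrt (freqSq k)) ^ 2 = wt k := by
  rw [bracket, Real.sq_sqrt (by positivity), Real.sq_sqrt (freqSq_nonneg k), wt]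

lemma wt_le_bracket_rpow {s : ℝ} (hs : 1 ≤ s) (k : Fin d → ℤ) :
    wt k ≤ bracket (Real.sqrt (freqSq k)) ^ (2 * s) := by
  rw [← bracket_sqrt_freqSq_sq, ← Real.rpow_natCast]
  exact Real.rpow_le_rpow_of_exponent_le (one_le_bracket _) (by push_cast; linarith)

lemma h1Sq_le_sobolevNormSq {s : ℝ} (hs : 1 ≤ s) (f : L2 d) : h1Sq f ≤ sobolevNormSq s f :=
  ENNReal.tsum_le_tsum fun k =>
    mul_le_mul_left (ENNReal.ofReal_le_ofReal (wt_le_bracket_rpow hs k)) _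

lemma sobolevNormSq_one (f : L2 d) : sobolevNormSq 1 f = h1Sq f := by
  refine tsum_congr fun k => ?_
  rw [← bracket_sqrt_freqSq_sq, ← Real.rpow_natCast]
  norm_num

/-- The amplitudes of an element of a Bourgain space. -/
def bourgainAmp (v : Lp (L2 d) 2 (volume : Measure ℝ)) (k : Fin d → ℤ) (σ : ℝ) : ℂ :=
  ((2 * Real.pi : ℝ) : ℂ)⁻¹ * spacetimeFourier v (σ - freqSq k) k

lemma measurable_spacetimeFourier (v : Lp (L2 d) 2 (volume : Measure ℝ)) (k : Fin d → ℤ) :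
    Measurable fun τ => spacetimeFourier v τ k := by
  have h1 : Measurable fun τ => coeffCLM k ((𝓕 v : Lp (L2 d) 2 (volume : Measure ℝ)) τ) :=
    ((coeffCLM k).continuous.comp_stronglyMeasurable (Lp.stronglyMeasurable _)).measurable
  simp only [coeffCLM_apply] at h1
  exact h1.comp (by fun_prop : Measurable fun τ : ℝ => τ / (2 * Real.pi))

lemma measurable_bourgainAmp (v : Lp (L2 d) 2 (volume : Measure ℝ)) (k : Fin d → ℤ) :
    Measurable (bourgainAmp v k) :=
  ((measurable_spacetimeFourier v k).comp (by fun_prop : Measurable fun σ : ℝ => σ - freqSq k)).const_mul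
    _

lemma tsum_bourgainAmp_lt_top {s b : ℝ} (hs : 1 ≤ s) {v : Lp (L2 d) 2 (volume : Measure ℝ)}
    (hv : bourgainNorm s b v < ⊤) :
    ∑' k, ENNReal.ofReal (wt k) * ∫⁻ σ, modWeight b σ * ‖bourgainAmp v k σ‖ₑ ^ 2 < ⊤ := by
  rw [bourgainNorm, ENNReal.rpow_lt_top_iff_of_pos (by norm_num)] at hv
  have h1 : ∀ k : Fin d → ℤ, ENNReal.ofReal (wt k) *
      (∫⁻ σ, modWeight b σ * ‖bourgainAmp v k σ‖ₑ ^ 2) ≤ ‖((2 * Real.pi : ℝ) : ℂ)⁻¹‖ₑ ^ 2 *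
      ∫⁻ τ : ℝ, ENNReal.ofReal (bracket (Real.sqrt (freqSq k)) ^ (2 * s) *
        bracket (τ + freqSq k) ^ (2 * b)) * ‖spacetimeFourier v τ k‖ₑ ^ 2 := by
    intro k
    rw [← lintegral_add_right_eq_self _ (freqSq k), ← lintegral_const_mul' _ _ ENNReal.ofReal_ne_top,
      ← lintegral_const_mul' _ _ (by finiteness)]
    refine lintegral_mono fun τ => ?_
    have hbr : 0 ≤ bracket (τ + freqSq k) ^ (2 * b) :=
      Real.rpow_nonneg (zero_le_one.trans (one_le_bracket _)) _
    rw [bourgainAmp, add_sub_cancel_right, enorm_mul, mul_pow, modWeight,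
      ENNReal.ofReal_mul' hbr]
    have h2 := ENNReal.ofReal_le_ofReal (wt_le_bracket_rpow hs k)
    calc _ = ‖((2 * Real.pi : ℝ) : ℂ)⁻¹‖ₑ ^ 2 * (ENNReal.ofReal (wt k) *
          ENNReal.ofReal (bracket (τ + freqSq k) ^ (2 * b)) *
            ‖spacetimeFourier v τ k‖ₑ ^ 2) := by ring
      _ ≤ _ := by gcongr
  refine (ENNReal.tsum_le_tsum h1).trans_lt ?_
  rw [ENNReal.tsum_mul_left]
  exact ENNReal.mul_lt_top (by finiteness) hv

/-- Substitute `σ = τ + |k|²` and `τ = 2πξ`. The factor `(2π)⁻¹` in the amplitude is the Jacobian of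
the second substitution. -/
lemma fourierInv_coeff_eq (v : Lp (L2 d) 2 (volume : Measure ℝ)) (k : Fin d → ℤ) (t : ℝ) :
    𝓕⁻ (fun ξ => coeff ((𝓕 v : Lp (L2 d) 2 (volume : Measure ℝ)) ξ) k) t =
      ∫ σ, bourgainAmp v k σ * Complex.exp (Complex.I * ((t * (σ - freqSq k) : ℝ) : ℂ)) := by
  rw [Real.fourierInv_eq']
  have h1 := integral_sub_right_eq_self (fun τ : ℝ => ((2 * Real.pi : ℝ) : ℂ)⁻¹ *
    spacetimeFourier v τ k * Complex.exp (Complex.I * ((t * τ : ℝ) : ℂ))) (freqSq k) (μ := volume)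
  simp only [bourgainAmp]
  rw [h1]
  have h2 := Measure.integral_comp_div (fun ξ : ℝ => ((2 * Real.pi : ℝ) : ℂ)⁻¹ *
    coeff ((𝓕 v : Lp (L2 d) 2 (volume : Measure ℝ)) ξ) k *
      Complex.exp (Complex.I * ((t * (2 * Real.pi * ξ) : ℝ) : ℂ))) (2 * Real.pi)
  have h3 : ∀ τ : ℝ, 2 * Real.pi * (τ / (2 * Real.pi)) = τ := fun τ => by field_simp
  simp only [h3] at h2
  simp only [spacetimeFourier]
  rw [h2, abs_of_pos Real.two_pi_pos, ← integral_smul]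
  refine integral_congr_ae (ae_of_all _ fun ξ => ?_)
  have : ((2 * Real.pi : ℝ) : ℂ) ≠ 0 := by exact_mod_cast Real.two_pi_pos.ne'
  simp only [RCLike.inner_apply, conj_trivial, smul_eq_mul, Complex.real_smul]
  rw [mul_assoc (((2 * Real.pi : ℝ) : ℂ)⁻¹), mul_inv_cancel_left₀ this, mul_comm]
  congr 2
  push_cast
  ring

/-- A continuous function in a restricted Bourgain space is a superposition of modulated free
solutions on the closed time interval. -/
lemma exists_waveData {T s b : ℝ} (hT : 0 < T) (hs : 1 ≤ s) (hb : 1 / 2 < b) {u : ℝ → L2 d}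
    (hu : MemBourgain T s b u) (hc : ContinuousOn u (Icc 0 T)) :
    ∃ W : WaveData d b, (∑' k, ENNReal.ofReal (wt k) * W.modeSq k < ⊤) ∧
      ∀ t ∈ Icc 0 T, ∀ k, coeff (u t) k = W.mode k t := by
  obtain ⟨⟨v, hvu⟩, hv⟩ := iInf_lt_iff.mp hu
  have hsum := tsum_bourgainAmp_lt_top hs hv
  let W : WaveData d b :=
    { amp := bourgainAmp v
      measurable_amp := measurable_bourgainAmp v
      lintegral_lt_top := fun k => by
        have h1 := (ENNReal.le_tsum k).trans_lt hsum
        have h2 : ENNReal.ofReal (wt k) ≠ 0 := by simp [wt_pos k]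
        by_contra hcon
        rw [not_lt, top_le_iff] at hcon
        rw [hcon, ENNReal.mul_top h2] at h1
        exact lt_irrefl _ h1 }
  refine ⟨W, hsum, fun t ht k => ?_⟩
  have hV : Integrable fun ξ => coeff ((𝓕 v : Lp (L2 d) 2 (volume : Measure ℝ)) ξ) k := by
    have h1 := W.integrable_amp hb k
    have h2 : Integrable fun τ => spacetimeFourier v τ k := by
      have h3 := (h1.comp_add_right (freqSq k)).const_mul ((2 * Real.pi : ℝ) : ℂ)
      refine h3.congr (ae_of_all _ fun τ => ?_)
      have : ((2 * Real.pi : ℝ) : ℂ) ≠ 0 := by exact_mod_cast Real.two_pi_pos.ne'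
      simp only [W, bourgainAmp, add_sub_cancel_right]
      rw [mul_inv_cancel_left₀ this]
    exact (integrable_comp_div_iff (fun ξ => coeff ((𝓕 v : Lp (L2 d) 2 (volume : Measure ℝ)) ξ) k)
      Real.two_pi_pos.ne').mp h2
  have hae : ∀ᵐ t ∂(volume.restrict (Ioo 0 T)), coeff (u t) k = W.mode k t := by
    filter_upwards [hvu, ae_restrict_of_ae (coeff_eq_fourierInv v k hV)] with t h1 h2
    rw [← h1, h2, fourierInv_coeff_eq]
    rfl
  have hc1 : ContinuousOn (fun t => coeff (u t) k) (Icc 0 T) := by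
    have := (coeffCLM (d := d) k).continuous.comp_continuousOn hc
    simpa only [Function.comp_def, coeffCLM_apply] using this
  have hIcc : volume.restrict (Ioo 0 T) = volume.restrict (Icc 0 T) :=
    Measure.restrict_congr_set Ioo_ae_eq_Icc
  rw [hIcc] at hae
  -- The identity holds for almost every time; as both sides are continuous it holds at every time
  -- of the closed interval, in particular at `0`.
  exact Measure.eqOn_Icc_of_ae_eq (μ := volume) hT.ne hae hc1
    ((W.continuous_mode hb k).continuousOn) ht

end Representation

/-! ### Multilinear space-time estimates -/

/-- The cubic nonlinearity `|z|² z`. -/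
def nl (z : ℂ) : ℂ := (‖z‖ ^ 2 : ℝ) * z

lemma nl_eq (z : ℂ) : nl z = z * conj z * z := by
  rw [nl, Complex.mul_conj']
  norm_cast

@[fun_prop]
lemma continuous_nl : Continuous nl := by
  unfold nl
  fun_prop

lemma norm_nl (z : ℂ) : ‖nl z‖ = ‖z‖ ^ 3 := by
  rw [nl, norm_mul, Complex.norm_real, norm_pow, norm_norm]
  ring

lemma enorm_nl (z : ℂ) : ‖nl z‖ₑ = ‖z‖ₑ ^ 3 := by
  rw [← ofReal_norm, norm_nl, ofReal_norm_pow]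

/-- Telescoping. Every term has the shape `X · conj Y · Z` with the difference occurring once, so
one Leibniz estimate serves for all three. -/
lemma nl_sub_nl (z w : ℂ) : nl z - nl w =
    ((z - w) * conj z * z + w * conj (z - w) * z) + w * conj w * (z - w) := by
  rw [nl_eq, nl_eq, map_sub]
  ring

lemma enorm_conj (z : ℂ) : ‖conj z‖ₑ = ‖z‖ₑ := by
  rw [← ofReal_norm, RCLike.norm_conj, ofReal_norm]

lemma enorm_nl_sub_nl_le (z w : ℂ) : ‖nl z - nl w‖ₑ ≤
    ‖z - w‖ₑ * ‖z‖ₑ * ‖z‖ₑ + ‖w‖ₑ * ‖z - w‖ₑ * ‖z‖ₑ + ‖w‖ₑ * ‖w‖ₑ * ‖z - w‖ₑ := by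
  rw [nl_sub_nl]
  refine (enorm_add_le _ _).trans (add_le_add ((enorm_add_le _ _).trans (add_le_add ?_ ?_)) ?_) <;>
  simp only [enorm_mul, enorm_conj, le_refl]

/-! ### Leibniz rules for the cubic nonlinearity -/

section PartialDeriv

variable {d : ℕ}

lemma IsSmooth.conj {ψ : Torus d → ℂ} (h : IsSmooth ψ) : IsSmooth fun x => conj (ψ x) :=
  ContDiff.comp Complex.conjCLE.contDiff h

lemma IsSmooth.add {φ ψ : Torus d → ℂ} (hφ : IsSmooth φ) (hψ : IsSmooth ψ) :
    IsSmooth fun x => φ x + ψ x := ContDiff.add hφ hψ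

lemma IsSmooth.sub {φ ψ : Torus d → ℂ} (hφ : IsSmooth φ) (hψ : IsSmooth ψ) :
    IsSmooth fun x => φ x - ψ x := ContDiff.sub hφ hψ

lemma IsSmooth.nl {ψ : Torus d → ℂ} (h : IsSmooth ψ) : IsSmooth fun x => nl (ψ x) := by
  simp only [nl_eq]
  exact (h.mul h.conj).mul h

lemma partialDeriv_conj {ψ : Torus d → ℂ} (h : IsSmooth ψ) (j : Fin d) (x : Torus d) :
    partialDeriv j (fun x => conj (ψ x)) x = conj (partialDeriv j ψ x) :=
  (Complex.conjCLE.hasFDerivAt.comp_hasDerivAt (0 : ℝ) (hasDerivAt_zero_of_isSmooth h j x)).deriv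

lemma partialDeriv_add {φ ψ : Torus d → ℂ} (hφ : IsSmooth φ) (hψ : IsSmooth ψ) (j : Fin d)
    (x : Torus d) : partialDeriv j (fun x => φ x + ψ x) x =
      partialDeriv j φ x + partialDeriv j ψ x :=
  ((hasDerivAt_zero_of_isSmooth hφ j x).fun_add (hasDerivAt_zero_of_isSmooth hψ j x)).deriv

lemma partialDeriv_sub {φ ψ : Torus d → ℂ} (hφ : IsSmooth φ) (hψ : IsSmooth ψ) (j : Fin d)
    (x : Torus d) : partialDeriv j (fun x => φ x - ψ x) x =
      partialDeriv j φ x - partialDeriv j ψ x :=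
  ((hasDerivAt_zero_of_isSmooth hφ j x).fun_sub (hasDerivAt_zero_of_isSmooth hψ j x)).deriv

lemma enorm_partialDeriv_triple_le {X Y Z : Torus d → ℂ} (hX : IsSmooth X) (hY : IsSmooth Y)
    (hZ : IsSmooth Z) (j : Fin d) (x : Torus d) :
    ‖partialDeriv j (fun x => X x * conj (Y x) * Z x) x‖ₑ ≤
      ‖partialDeriv j X x‖ₑ * ‖Y x‖ₑ * ‖Z x‖ₑ + ‖partialDeriv j Y x‖ₑ * ‖X x‖ₑ * ‖Z x‖ₑ +
        ‖partialDeriv j Z x‖ₑ * ‖X x‖ₑ * ‖Y x‖ₑ := by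
  rw [partialDeriv_mul (hX.mul hY.conj) hZ, partialDeriv_mul hX hY.conj, partialDeriv_conj hY,
    add_mul]
  refine (enorm_add_le _ _).trans (add_le_add ((enorm_add_le _ _).trans (add_le_add ?_ ?_)) ?_) <;>
  simp only [enorm_mul, enorm_conj]
  · rfl
  · exact le_of_eq (by ring)
  · exact le_of_eq (by ring)

/-- Three telescoped products with three factors each give nine terms. In every term the
differentiated factor stands first and exactly one factor is the difference or its derivative, which
later supplies the smallness. -/
lemma enorm_partialDeriv_nl_sub_nl_le {X Y : Torus d → ℂ} (hX : IsSmooth X) (hY : IsSmooth Y)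
    (j : Fin d) (x : Torus d) :
    ‖partialDeriv j (fun x => nl (X x) - nl (Y x)) x‖ₑ ≤
      (‖partialDeriv j X x - partialDeriv j Y x‖ₑ * ‖X x‖ₑ * ‖X x‖ₑ +
        ‖partialDeriv j X x‖ₑ * ‖X x - Y x‖ₑ * ‖X x‖ₑ +
        ‖partialDeriv j X x‖ₑ * ‖X x - Y x‖ₑ * ‖X x‖ₑ) +
      (‖partialDeriv j Y x‖ₑ * ‖X x - Y x‖ₑ * ‖X x‖ₑ +
        ‖partialDeriv j X x - partialDeriv j Y x‖ₑ * ‖Y x‖ₑ * ‖X x‖ₑ +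
        ‖partialDeriv j X x‖ₑ * ‖Y x‖ₑ * ‖X x - Y x‖ₑ) +
      (‖partialDeriv j Y x‖ₑ * ‖Y x‖ₑ * ‖X x - Y x‖ₑ +
        ‖partialDeriv j Y x‖ₑ * ‖Y x‖ₑ * ‖X x - Y x‖ₑ +
        ‖partialDeriv j X x - partialDeriv j Y x‖ₑ * ‖Y x‖ₑ * ‖Y x‖ₑ) := by
  have hR := hX.sub hY
  simp only [nl_sub_nl]
  rw [partialDeriv_add (((hR.mul hX.conj).mul hX).add ((hY.mul hR.conj).mul hX))
    ((hY.mul hY.conj).mul hR), partialDeriv_add ((hR.mul hX.conj).mul hX) ((hY.mul hR.conj).mul hX),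
    ← partialDeriv_sub hX hY]
  exact (enorm_add_le _ _).trans (add_le_add ((enorm_add_le _ _).trans
    (add_le_add (enorm_partialDeriv_triple_le hR hX hX j x)
      (enorm_partialDeriv_triple_le hY hR hX j x))) (enorm_partialDeriv_triple_le hY hY hR j x))

end PartialDeriv

/-- The Cauchy–Schwarz inequality for lower Lebesgue integrals. -/
lemma lintegral_mul_le_sqrt {X : Type*} [MeasurableSpace X] {μ : Measure X} {f g : X → ℝ≥0∞}
    (hf : AEMeasurable f μ) (hg : AEMeasurable g μ) :
    ∫⁻ x, f x * g x ∂μ ≤ (∫⁻ x, f x ^ 2 ∂μ) ^ (1 / 2 : ℝ) * (∫⁻ x, g x ^ 2 ∂μ) ^ (1 / 2 : ℝ) := by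
  have h := ENNReal.lintegral_mul_le_Lp_mul_Lq μ Real.HolderConjugate.two_two hf hg
  simpa only [Pi.mul_apply, ENNReal.rpow_ofNat] using h

lemma sqrt_mul_self_ennreal (x : ℝ≥0∞) : x ^ (1 / 2 : ℝ) * x ^ (1 / 2 : ℝ) = x := by
  rw [← ENNReal.rpow_add_of_nonneg _ _ (by norm_num) (by norm_num)]
  norm_num

namespace WaveData

variable {d : ℕ} {b : ℝ} (W : WaveData d b)

/-- The square of the `X^{1,b}` norm of the part with modes in `S`. -/
def xSq (S : Finset (Fin d → ℤ)) : ℝ≥0∞ := ∑ k ∈ S, ENNReal.ofReal (wt k) * W.modeSq k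

/-- The spatial derivative `∂_j`. -/
def grad (j : Fin d) : WaveData d b := W.mult fun k => Complex.I * k j

lemma wave_grad (j : Fin d) (S : Finset (Fin d → ℤ)) (t : ℝ) (x : Torus d) :
    (W.grad j).wave S (t, x) = partialDeriv j (fun x => W.wave S (t, x)) x := by
  unfold wave
  have h := partialDeriv_trig S (fun k => W.mode k t) j x
  simp only [grad, mode_mult] at h ⊢
  exact h.symm

lemma isSmooth_wave (S : Finset (Fin d → ℤ)) (t : ℝ) : IsSmooth fun x => W.wave S (t, x) :=
  isSmooth_trig S (fun k => W.mode k t)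

lemma sum_modeSq_le (S : Finset (Fin d → ℤ)) : ∑ k ∈ S, W.modeSq k ≤ W.xSq S := by
  refine Finset.sum_le_sum fun k _ => le_mul_of_one_le_left zero_le ?_
  rw [ENNReal.one_le_ofReal]
  exact one_le_wt k

lemma sum_modeSq_grad_le (j : Fin d) (S : Finset (Fin d → ℤ)) :
    ∑ k ∈ S, (W.grad j).modeSq k ≤ W.xSq S := by
  refine Finset.sum_le_sum fun k _ => ?_
  rw [grad, modeSq_mult, ← ofReal_norm_pow]
  gcongr
  rw [norm_mul, Complex.norm_I, one_mul, Complex.norm_intCast, sq_abs]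
  have h3 : ((k j : ℝ)) ^ 2 ≤ freqSq k :=
    Finset.single_le_sum (f := fun j => (k j : ℝ) ^ 2) (fun _ _ => sq_nonneg _)
      (Finset.mem_univ j)
  unfold wt
  linarith

lemma lintegral_wave_mul_wave (hd : d = 1 ∨ d = 2 ∨ d = 3) (hb : 1 / 2 < b) (T : ℝ)
    (S S' : Finset (Fin d → ℤ)) :
    ∫⁻ y, ‖W.wave S y * W.wave S' y‖ₑ ^ 2 ∂(spaceTime d T) ≤
      bilinearConst d T b * (W.xSq S * W.xSq S') :=
  (lintegral_wave_mul_wave_le hd hb T W W S S').trans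
    (mul_le_mul_right (mul_le_mul_right (W.sum_modeSq_le S') _) _)

lemma lintegral_wave_mul_grad (hd : d = 1 ∨ d = 2 ∨ d = 3) (hb : 1 / 2 < b) (T : ℝ)
    (j : Fin d) (S S' : Finset (Fin d → ℤ)) :
    ∫⁻ y, ‖W.wave S y * (W.grad j).wave S' y‖ₑ ^ 2 ∂(spaceTime d T) ≤
      bilinearConst d T b * (W.xSq S * W.xSq S') :=
  (lintegral_wave_mul_wave_le hd hb T W (W.grad j) S S').trans
    (mul_le_mul_right (mul_le_mul_right (W.sum_modeSq_grad_le j S') _) _)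

/-- Cauchy–Schwarz after pairing `P` with `Y` and `X` with `Z`. The pairing is chosen for the case
where `P` and `X` are differentiated: each pair then contains one derivative, and the bilinear
estimate places its weight on the undifferentiated member. -/
lemma lintegral_four_le {ν : Measure (ℝ × Torus d)} {P X Y Z : ℝ × Torus d → ℂ}
    (hP : Continuous P) (hX : Continuous X) (hY : Continuous Y) (hZ : Continuous Z) {B p x y z : ℝ≥0∞}
    (h1 : ∫⁻ q, ‖Y q * P q‖ₑ ^ 2 ∂ν ≤ B * (y * p)) (h2 : ∫⁻ q, ‖Z q * X q‖ₑ ^ 2 ∂ν ≤ B * (z * x)) :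
    ∫⁻ q, ‖P q‖ₑ * (‖X q‖ₑ * ‖Y q‖ₑ * ‖Z q‖ₑ) ∂ν ≤ B * (p * (x * y * z)) ^ (1 / 2 : ℝ) := by
  have e : ∀ q, ‖P q‖ₑ * (‖X q‖ₑ * ‖Y q‖ₑ * ‖Z q‖ₑ) = ‖Y q * P q‖ₑ * ‖Z q * X q‖ₑ := fun q => by
    rw [enorm_mul, enorm_mul]; ring
  simp only [e]
  refine (lintegral_mul_le_sqrt (by fun_prop) (by fun_prop)).trans ?_
  calc _ ≤ (B * (y * p)) ^ (1 / 2 : ℝ) * (B * (z * x)) ^ (1 / 2 : ℝ) := by gcongr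
    _ = B ^ (1 / 2 : ℝ) * B ^ (1 / 2 : ℝ) * (p * (x * y * z)) ^ (1 / 2 : ℝ) := by
      rw [← ENNReal.mul_rpow_of_nonneg _ _ (by norm_num),
        ← ENNReal.mul_rpow_of_nonneg _ _ (by norm_num),
        ← ENNReal.mul_rpow_of_nonneg _ _ (by norm_num)]
      congr 1
      ring
    _ = _ := by rw [sqrt_mul_self_ennreal]

lemma lintegral_quad (hd : d = 1 ∨ d = 2 ∨ d = 3) (hb : 1 / 2 < b) (T : ℝ)
    (S₁ S₂ S₃ S₄ : Finset (Fin d → ℤ)) :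
    ∫⁻ y, ‖W.wave S₁ y‖ₑ * (‖W.wave S₂ y‖ₑ * ‖W.wave S₃ y‖ₑ * ‖W.wave S₄ y‖ₑ) ∂(spaceTime d T) ≤
      bilinearConst d T b * (W.xSq S₁ * (W.xSq S₂ * W.xSq S₃ * W.xSq S₄)) ^ (1 / 2 : ℝ) :=
  lintegral_four_le (W.continuous_wave hb _) (W.continuous_wave hb _) (W.continuous_wave hb _)
    (W.continuous_wave hb _) (W.lintegral_wave_mul_wave hd hb T S₃ S₁)
    (W.lintegral_wave_mul_wave hd hb T S₄ S₂)

lemma lintegral_quad_grad (hd : d = 1 ∨ d = 2 ∨ d = 3) (hb : 1 / 2 < b) (T : ℝ)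
    (j : Fin d) (S₁ S₂ S₃ S₄ : Finset (Fin d → ℤ)) :
    ∫⁻ y, ‖(W.grad j).wave S₁ y‖ₑ * (‖(W.grad j).wave S₂ y‖ₑ * ‖W.wave S₃ y‖ₑ * ‖W.wave S₄ y‖ₑ)
        ∂(spaceTime d T) ≤
      bilinearConst d T b * (W.xSq S₁ * (W.xSq S₂ * W.xSq S₃ * W.xSq S₄)) ^ (1 / 2 : ℝ) :=
  lintegral_four_le ((W.grad j).continuous_wave hb _) ((W.grad j).continuous_wave hb _)
    (W.continuous_wave hb _) (W.continuous_wave hb _) (W.lintegral_wave_mul_grad hd hb T j S₃ S₁)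
    (W.lintegral_wave_mul_grad hd hb T j S₄ S₂)

lemma sum_wt_mode_sq_le (S : Finset (Fin d → ℤ)) (t : ℝ) :
    ∑ k ∈ S, ENNReal.ofReal (wt k) * ‖W.mode k t‖ₑ ^ 2 ≤ invMass b * W.xSq S := by
  rw [xSq, Finset.mul_sum]
  refine Finset.sum_le_sum fun k _ => ?_
  calc _ ≤ ENNReal.ofReal (wt k) * (invMass b * W.modeSq k) := by
        gcongr; exact W.enorm_mode_sq_le k t
    _ = _ := by ring

/-- A majorant of the squares of the product of two waves and its gradient. -/
def prodSq (S₁ S₂ : Finset (Fin d → ℤ)) (y : ℝ × Torus d) : ℝ≥0∞ :=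
  ‖W.wave S₁ y * W.wave S₂ y‖ₑ ^ 2 + ∑ j, 2 * (‖W.wave S₂ y * (W.grad j).wave S₁ y‖ₑ ^ 2 +
      ‖W.wave S₁ y * (W.grad j).wave S₂ y‖ₑ ^ 2)

lemma measurable_wave_mul (hb : 1 / 2 < b) (W' : WaveData d b) (S₁ S₂ : Finset (Fin d → ℤ)) :
    Measurable fun y => ‖W.wave S₁ y * W'.wave S₂ y‖ₑ ^ 2 := by
  have c1 := W.continuous_wave hb S₁
  have c2 := W'.continuous_wave hb S₂
  exact (c1.mul c2).measurable.enorm.pow_const 2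

lemma measurable_prodSq_summand (hb : 1 / 2 < b) (S₁ S₂ : Finset (Fin d → ℤ)) (j : Fin d) :
    Measurable fun y => 2 * (‖W.wave S₂ y * (W.grad j).wave S₁ y‖ₑ ^ 2 +
      ‖W.wave S₁ y * (W.grad j).wave S₂ y‖ₑ ^ 2) :=
  ((W.measurable_wave_mul hb (W.grad j) S₂ S₁).add
    (W.measurable_wave_mul hb (W.grad j) S₁ S₂)).const_mul 2

lemma measurable_prodSq (hb : 1 / 2 < b) (S₁ S₂ : Finset (Fin d → ℤ)) :
    Measurable (W.prodSq S₁ S₂) :=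
  (W.measurable_wave_mul hb W S₁ S₂).add
    (Finset.measurable_sum _ fun j _ => W.measurable_prodSq_summand hb S₁ S₂ j)

lemma lintegral_prodSq_le (hd : d = 1 ∨ d = 2 ∨ d = 3) (hb : 1 / 2 < b) (T : ℝ)
    (S₁ S₂ : Finset (Fin d → ℤ)) : ∫⁻ y, W.prodSq S₁ S₂ y ∂(spaceTime d T) ≤
      (1 + 4 * d) * bilinearConst d T b * (W.xSq S₁ * W.xSq S₂) := by
  have hj : ∀ j, ∫⁻ y, 2 * (‖W.wave S₂ y * (W.grad j).wave S₁ y‖ₑ ^ 2 +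
      ‖W.wave S₁ y * (W.grad j).wave S₂ y‖ₑ ^ 2) ∂(spaceTime d T) ≤
      4 * (bilinearConst d T b * (W.xSq S₁ * W.xSq S₂)) := fun j => by
    rw [lintegral_const_mul' _ _ (by norm_num),
      lintegral_add_left (W.measurable_wave_mul hb (W.grad j) S₂ S₁)]
    calc _ ≤ 2 * (bilinearConst d T b * (W.xSq S₂ * W.xSq S₁) +
          bilinearConst d T b * (W.xSq S₁ * W.xSq S₂)) := by
          gcongr
          · exact W.lintegral_wave_mul_grad hd hb T j S₂ S₁
          · exact W.lintegral_wave_mul_grad hd hb T j S₁ S₂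
      _ = _ := by ring
  unfold prodSq
  rw [lintegral_add_left (W.measurable_wave_mul hb W S₁ S₂),
    lintegral_finsetSum _ fun j _ => W.measurable_prodSq_summand hb S₁ S₂ j]
  refine (add_le_add (W.lintegral_wave_mul_wave hd hb T S₁ S₂)
    (Finset.sum_le_sum fun j _ => hj j)).trans_eq ?_
  rw [Finset.sum_const, Finset.card_univ, Fintype.card_fin, nsmul_eq_mul]
  ring

lemma lintegral_product_h1_le (hb : 1 / 2 < b) (S₁ S₂ : Finset (Fin d → ℤ)) (t : ℝ) :
    (∫⁻ x, ‖W.wave S₁ (t, x) * W.wave S₂ (t, x)‖ₑ ^ 2) +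
      ∑ j, ∫⁻ x, ‖partialDeriv j (fun x => W.wave S₁ (t, x) * W.wave S₂ (t, x)) x‖ₑ ^ 2 ≤
      ∫⁻ x, W.prodSq S₁ S₂ (t, x) := by
  have s1 := W.isSmooth_wave S₁ t
  have s2 := W.isSmooth_wave S₂ t
  unfold prodSq
  have m1 : Measurable fun x => ‖W.wave S₁ (t, x) * W.wave S₂ (t, x)‖ₑ ^ 2 :=
    (W.measurable_wave_mul hb W S₁ S₂).comp measurable_prodMk_left
  have m2 : ∀ j, Measurable fun x => 2 * (‖W.wave S₂ (t, x) * (W.grad j).wave S₁ (t, x)‖ₑ ^ 2 +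
      ‖W.wave S₁ (t, x) * (W.grad j).wave S₂ (t, x)‖ₑ ^ 2) := fun j =>
    (W.measurable_prodSq_summand hb S₁ S₂ j).comp measurable_prodMk_left
  rw [lintegral_add_left m1, lintegral_finsetSum _ fun j _ => m2 j]
  refine add_le_add le_rfl (Finset.sum_le_sum fun j _ => lintegral_mono fun x => ?_)
  rw [partialDeriv_mul s1 s2, ← W.wave_grad, ← W.wave_grad]
  refine (pow_le_pow_left₀ zero_le (enorm_add_le _ _) 2).trans
    ((add_sq_le_ennreal _ _).trans_eq ?_)
  rw [mul_comm ((W.grad j).wave S₁ (t, x))]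

/-- At a fixed time all is put in `L⁴`. The product of the first two waves is in `L⁴` through its
`H¹` norm, whose square is integrable in time by the bilinear estimate; the third wave is in `L⁴`
uniformly in time because its modes are bounded. -/
lemma lintegral_slice_trilinear (hd : d = 1 ∨ d = 2 ∨ d = 3) (hb : 1 / 2 < b)
    (S₁ S₂ S₃ : Finset (Fin d → ℤ)) (t : ℝ) : ENNReal.ofReal (vol d) *
      (∫⁻ x, ‖W.wave S₁ (t, x) * W.wave S₂ (t, x) * W.wave S₃ (t, x)‖ₑ ^ 2) ≤
      embedConst d * (invMass b * W.xSq S₃) * ∫⁻ x, W.prodSq S₁ S₂ (t, x) := by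
  have s1 := W.isSmooth_wave S₁ t
  have s2 := W.isSmooth_wave S₂ t
  have hF := lintegral_smooth_pow_four_le hd (s1.mul s2)
  have hZ := lintegral_trig_pow_four_le' hd S₃ (fun k => W.mode k t)
  have hcs : (∫⁻ x, ‖W.wave S₁ (t, x) * W.wave S₂ (t, x) * W.wave S₃ (t, x)‖ₑ ^ 2) ^ 2 ≤
      (∫⁻ x, ‖W.wave S₁ (t, x) * W.wave S₂ (t, x)‖ₑ ^ 4) * ∫⁻ x, ‖W.wave S₃ (t, x)‖ₑ ^ 4 := by
    have c4 : Continuous fun x => W.wave S₁ (t, x) * W.wave S₂ (t, x) := (s1.mul s2).continuous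
    have c5 : Continuous fun x => W.wave S₃ (t, x) := (W.isSmooth_wave S₃ t).continuous
    have h := lintegral_mul_le_sqrt (μ := (volume : Measure (Torus d)))
      (f := fun x => ‖W.wave S₁ (t, x) * W.wave S₂ (t, x)‖ₑ ^ 2)
      (g := fun x => ‖W.wave S₃ (t, x)‖ₑ ^ 2) (c4.measurable.enorm.pow_const 2).aemeasurable
      (c5.measurable.enorm.pow_const 2).aemeasurable
    simp only [← mul_pow, ← enorm_mul, ← pow_mul] at h
    refine (pow_le_pow_left₀ zero_le h 2).trans_eq ?_
    rw [mul_pow, sq, sqrt_mul_self_ennreal, sq, sqrt_mul_self_ennreal]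
  have hgrad := W.lintegral_product_h1_le hb S₁ S₂ t
  have hZ2 : ∫⁻ x, ‖W.wave S₃ (t, x)‖ₑ ^ 4 ≤ embedConst d * (invMass b * W.xSq S₃) ^ 2 :=
    hZ.trans (mul_le_mul_right (pow_le_pow_left₀ zero_le (W.sum_wt_mode_sq_le S₃ t) 2) _)
  have hF2 := hF.trans (mul_le_mul_right (pow_le_pow_left₀ zero_le hgrad 2) _)
  -- Comparing squares matches the two `L⁴` bounds, which are both quadratic, without taking roots.
  refine (ENNReal.pow_le_pow_left_iff two_ne_zero).mp ?_
  rw [mul_pow]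
  refine (mul_le_mul_right hcs _).trans ?_
  rw [← mul_assoc]
  refine (mul_le_mul' hF2 hZ2).trans_eq ?_
  ring

/-- The trilinear estimate in `L²`. -/
lemma lintegral_trilinear (hd : d = 1 ∨ d = 2 ∨ d = 3) (hb : 1 / 2 < b) (T : ℝ)
    (S₁ S₂ S₃ : Finset (Fin d → ℤ)) :
    ENNReal.ofReal (vol d) *
        ∫⁻ y, ‖W.wave S₁ y * W.wave S₂ y * W.wave S₃ y‖ₑ ^ 2 ∂(spaceTime d T) ≤
      embedConst d * invMass b * ((1 + 4 * d) * bilinearConst d T b) *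
        (W.xSq S₁ * W.xSq S₂ * W.xSq S₃) := by
  have hm : Measurable fun y => ‖W.wave S₁ y * W.wave S₂ y * W.wave S₃ y‖ₑ ^ 2 :=
    (((W.continuous_wave hb S₁).mul (W.continuous_wave hb S₂)).mul
      (W.continuous_wave hb S₃)).measurable.enorm.pow_const 2
  have hQm := W.measurable_prodSq hb S₁ S₂
  have hQint := W.lintegral_prodSq_le hd hb T S₁ S₂
  unfold spaceTime at hQint ⊢
  rw [lintegral_prod _ hQm.aemeasurable] at hQint
  rw [lintegral_prod _ hm.aemeasurable, ← lintegral_const_mul' _ _ ENNReal.ofReal_ne_top]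
  refine (lintegral_mono (W.lintegral_slice_trilinear hd hb S₁ S₂ S₃)).trans ?_
  rw [lintegral_const_mul _ hQm.lintegral_prod_right']
  refine (mul_le_mul_right hQint _).trans_eq ?_
  ring

end WaveData

/-! ### The error in the energy identity of a truncation -/

lemma fcoeff_partialDeriv {d : ℕ} {F : Torus d → ℂ} (hF : IsSmooth F) (j : Fin d)
    (k : Fin d → ℤ) : fcoeff (partialDeriv j F) k = Complex.I * k j * fcoeff F k := by
  have h := integral_mul_partialDeriv hF (isSmooth_character (-k)) j
  have h2 : ∫ x, F x * partialDeriv j (character (-k)) x =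
      -(Complex.I * k j) * ∫ x, F x * character (-k) x := by
    rw [← integral_const_mul]
    refine integral_congr_ae (ae_of_all _ fun x => ?_)
    simp only [partialDeriv_character, Pi.neg_apply, Int.cast_neg]
    ring
  rw [h2] at h
  rw [fcoeff_def, fcoeff_def]
  linear_combination ((vol d : ℂ))⁻¹ * h

/-- Since `⟨k⟩² = 1 + ∑ k_j²`, the weighted sum is the `H¹` inner product with `F`. Writing it with
integrals distributes the derivatives evenly and makes the quadrilinear estimates applicable. -/
lemma sum_wt_conj_mul_fcoeff {d : ℕ} {F : Torus d → ℂ} (hF : IsSmooth F)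
    (S : Finset (Fin d → ℤ)) (c : (Fin d → ℤ) → ℂ) :
    (vol d : ℂ) * ∑ k ∈ S, (wt k : ℂ) * conj (c k) * fcoeff F k =
      (∫ x, conj (trig S c x) * F x) +
        ∑ j, ∫ x, conj (partialDeriv j (trig S c) x) * partialDeriv j F x := by
  have hj : ∀ j, ∫ x, conj (partialDeriv j (trig S c) x) * partialDeriv j F x =
      (vol d : ℂ) * ∑ k ∈ S, ((k j : ℂ)) ^ 2 * (conj (c k) * fcoeff F k) := fun j => by
    simp only [partialDeriv_trig]
    rw [integral_conj_trig_mul (integrable_of_continuous (hF.partialDeriv j).continuous)]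
    congr 1
    refine Finset.sum_congr rfl fun k _ => ?_
    rw [fcoeff_partialDeriv hF]
    simp only [map_mul, Complex.conj_I, map_intCast]
    linear_combination -((k j : ℂ)) ^ 2 * (conj (c k) * fcoeff F k) * Complex.I_sq
  simp only [hj]
  rw [integral_conj_trig_mul (integrable_of_continuous hF.continuous), ← Finset.mul_sum, ← mul_add,
    Finset.sum_comm, ← Finset.sum_add_distrib]
  congr 1
  refine Finset.sum_congr rfl fun k _ => ?_
  rw [← Finset.sum_mul, wt, freqSq]
  push_cast
  ring

/-- Bessel's inequality. -/
lemma vol_mul_sum_fcoeff_sq_le {d : ℕ} {F : Torus d → ℂ} (hF : Continuous F)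
    (S : Finset (Fin d → ℤ)) :
    ENNReal.ofReal (vol d) * ∑ k ∈ S, ‖fcoeff F k‖ₑ ^ 2 ≤ ∫⁻ x, ‖F x‖ₑ ^ 2 := by
  have h := lintegral_enorm_sq_eq (contL2 F hF)
  have e : ∫⁻ x, ‖contL2 F hF x‖ₑ ^ 2 = ∫⁻ x, ‖F x‖ₑ ^ 2 := by
    refine lintegral_congr_ae ?_
    filter_upwards [coeFn_contL2 hF] with x hx
    rw [hx]
  have e2 : ∀ k, coeff (contL2 F hF) k = fcoeff F k := fun k => fcoeff_congr (coeFn_contL2 hF) k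
  simp only [e2] at h
  rw [← e, h]
  gcongr
  exact ENNReal.sum_le_tsum _

/-- Cauchy–Schwarz and Bessel: restricting the frequencies to `S` costs nothing in `L²`. It handles
the pairing of two cubic terms, where no structure beyond `L²` is needed. -/
lemma vol_mul_sum_conj_le {d : ℕ} {F G : Torus d → ℂ} (hF : Continuous F) (hG : Continuous G)
    (S : Finset (Fin d → ℤ)) :
    ENNReal.ofReal (vol d) * ‖∑ k ∈ S, conj (fcoeff F k) * fcoeff G k‖ₑ ≤
      (∫⁻ x, ‖F x‖ₑ ^ 2) ^ (1 / 2 : ℝ) * (∫⁻ x, ‖G x‖ₑ ^ 2) ^ (1 / 2 : ℝ) := by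
  have h1 : ‖∑ k ∈ S, conj (fcoeff F k) * fcoeff G k‖ₑ ≤
      (∑ k ∈ S, ‖fcoeff F k‖ₑ ^ 2) ^ (1 / 2 : ℝ) * (∑ k ∈ S, ‖fcoeff G k‖ₑ ^ 2) ^ (1 / 2 : ℝ) := by
    refine (enorm_sum_le _ _).trans ?_
    simp only [enorm_mul, enorm_conj]
    have := ENNReal.inner_le_Lp_mul_Lq S (fun k => ‖fcoeff F k‖ₑ) (fun k => ‖fcoeff G k‖ₑ)
      Real.HolderConjugate.two_two
    simpa only [ENNReal.rpow_ofNat] using this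
  calc _ ≤ ENNReal.ofReal (vol d) * ((∑ k ∈ S, ‖fcoeff F k‖ₑ ^ 2) ^ (1 / 2 : ℝ) *
        (∑ k ∈ S, ‖fcoeff G k‖ₑ ^ 2) ^ (1 / 2 : ℝ)) := by gcongr
    _ = (ENNReal.ofReal (vol d) * ∑ k ∈ S, ‖fcoeff F k‖ₑ ^ 2) ^ (1 / 2 : ℝ) *
        (ENNReal.ofReal (vol d) * ∑ k ∈ S, ‖fcoeff G k‖ₑ ^ 2) ^ (1 / 2 : ℝ) := by
      rw [ENNReal.mul_rpow_of_nonneg _ _ (by norm_num), ENNReal.mul_rpow_of_nonneg _ _ (by norm_num),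
        mul_mul_mul_comm, sqrt_mul_self_ennreal]
    _ ≤ _ := by
      gcongr
      · exact vol_mul_sum_fcoeff_sq_le hF S
      · exact vol_mul_sum_fcoeff_sq_le hG S

lemma lintegral_add_three_le {α : Type*} [MeasurableSpace α] {μ : Measure α} {f g h : α → ℝ≥0∞}
    (hg : Measurable g) (hh : Measurable h) {p q r : ℝ≥0∞} (h1 : ∫⁻ y, f y ∂μ ≤ p)
    (h2 : ∫⁻ y, g y ∂μ ≤ q) (h3 : ∫⁻ y, h y ∂μ ≤ r) :
    ∫⁻ y, (f y + g y + h y) ∂μ ≤ p + q + r := by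
  rw [lintegral_add_right _ hh, lintegral_add_right _ hg]
  gcongr

namespace WaveData

variable {d : ℕ} {b : ℝ} (W : WaveData d b)

/-- The difference of the nonlinearities of two truncations. -/
def nlDiff (S S' : Finset (Fin d → ℤ)) (y : ℝ × Torus d) : ℂ := nl (W.wave S' y) - nl (W.wave S y)

/-- The error in the energy identity for the truncation to `S`, when the solution is replaced by
its truncation to `S'`. -/
def energyError (S S' : Finset (Fin d → ℤ)) (t : ℝ) : ℂ :=
  ∑ k ∈ S, ((wt k : ℂ) * conj (W.mode k t) + conj (fcoeff (fun x => nl (W.wave S (t, x))) k)) *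
    fcoeff (fun x => W.nlDiff S S' (t, x)) k

lemma isSmooth_nlDiff (S S' : Finset (Fin d → ℤ)) (t : ℝ) :
    IsSmooth fun x => W.nlDiff S S' (t, x) :=
  (W.isSmooth_wave S' t).nl.sub (W.isSmooth_wave S t).nl

lemma continuous_nlDiff (hb : 1 / 2 < b) (S S' : Finset (Fin d → ℤ)) :
    Continuous (W.nlDiff S S') :=
  (continuous_nl.comp (W.continuous_wave hb S')).sub (continuous_nl.comp (W.continuous_wave hb S))

lemma wave_sub_wave {S S' : Finset (Fin d → ℤ)} (h : S ⊆ S') (y : ℝ × Torus d) :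
    W.wave S' y - W.wave S y = W.wave (S' \ S) y := by
  classical
  simp only [wave, trig]
  rw [← Finset.sum_sdiff h]
  ring

lemma enorm_nlDiff_le {S S' : Finset (Fin d → ℤ)} (h : S ⊆ S') (y : ℝ × Torus d) :
    ‖W.nlDiff S S' y‖ₑ ≤ ‖W.wave (S' \ S) y‖ₑ * ‖W.wave S' y‖ₑ * ‖W.wave S' y‖ₑ +
      ‖W.wave S y‖ₑ * ‖W.wave (S' \ S) y‖ₑ * ‖W.wave S' y‖ₑ +
      ‖W.wave S y‖ₑ * ‖W.wave S y‖ₑ * ‖W.wave (S' \ S) y‖ₑ := by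
  rw [← W.wave_sub_wave h]
  exact enorm_nl_sub_nl_le _ _

/-- A majorant of the gradient of the difference of the nonlinearities. -/
def gradMajorant (j : Fin d) (S S' : Finset (Fin d → ℤ)) (y : ℝ × Torus d) : ℝ≥0∞ :=
  (‖(W.grad j).wave (S' \ S) y‖ₑ * ‖W.wave S' y‖ₑ * ‖W.wave S' y‖ₑ +
    ‖(W.grad j).wave S' y‖ₑ * ‖W.wave (S' \ S) y‖ₑ * ‖W.wave S' y‖ₑ +
    ‖(W.grad j).wave S' y‖ₑ * ‖W.wave (S' \ S) y‖ₑ * ‖W.wave S' y‖ₑ) +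
  (‖(W.grad j).wave S y‖ₑ * ‖W.wave (S' \ S) y‖ₑ * ‖W.wave S' y‖ₑ +
    ‖(W.grad j).wave (S' \ S) y‖ₑ * ‖W.wave S y‖ₑ * ‖W.wave S' y‖ₑ +
    ‖(W.grad j).wave S' y‖ₑ * ‖W.wave S y‖ₑ * ‖W.wave (S' \ S) y‖ₑ) +
  (‖(W.grad j).wave S y‖ₑ * ‖W.wave S y‖ₑ * ‖W.wave (S' \ S) y‖ₑ +
    ‖(W.grad j).wave S y‖ₑ * ‖W.wave S y‖ₑ * ‖W.wave (S' \ S) y‖ₑ +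
    ‖(W.grad j).wave (S' \ S) y‖ₑ * ‖W.wave S y‖ₑ * ‖W.wave S y‖ₑ)

lemma enorm_partialDeriv_nlDiff_le (j : Fin d) {S S' : Finset (Fin d → ℤ)} (h : S ⊆ S')
    (t : ℝ) (x : Torus d) :
    ‖partialDeriv j (fun x => W.nlDiff S S' (t, x)) x‖ₑ ≤ W.gradMajorant j S S' (t, x) := by
  have := enorm_partialDeriv_nl_sub_nl_le (W.isSmooth_wave S' t) (W.isSmooth_wave S t) j x
  simp only [← W.wave_grad, W.wave_sub_wave h, (W.grad j).wave_sub_wave h] at this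
  exact this

/-! ### Space-time bounds for the terms of the energy error -/

section Bounds

variable {S S' : Finset (Fin d → ℤ)} {X : ℝ≥0∞}

lemma xSq_mono (h : S ⊆ S') : W.xSq S ≤ W.xSq S' :=
  Finset.sum_le_sum_of_subset h

lemma measurable_enorm_wave (hb : 1 / 2 < b) (S : Finset (Fin d → ℤ)) :
    Measurable fun y => ‖W.wave S y‖ₑ := (W.continuous_wave hb S).measurable.enorm

/-- Each of the three telescoped terms contains one factor with modes in `S' \ S` only; the other
three factors are bounded by `X`. -/
lemma lintegral_wave_mul_nlDiff_le (hd : d = 1 ∨ d = 2 ∨ d = 3) (hb : 1 / 2 < b) (T : ℝ)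
    (h : S ⊆ S') (hX : W.xSq S' ≤ X) :
    ∫⁻ y, ‖W.wave S y‖ₑ * ‖W.nlDiff S S' y‖ₑ ∂(spaceTime d T) ≤
      3 * (bilinearConst d T b * (X ^ 3 * W.xSq (S' \ S)) ^ (1 / 2 : ℝ)) := by
  have hS : W.xSq S ≤ X := (W.xSq_mono h).trans hX
  have m := W.measurable_enorm_wave hb
  have m4 : ∀ S₁ S₂ S₃, Measurable fun y =>
      ‖W.wave S y‖ₑ * (‖W.wave S₁ y‖ₑ * ‖W.wave S₂ y‖ₑ * ‖W.wave S₃ y‖ₑ) :=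
    fun S₁ S₂ S₃ => (m _).mul (((m _).mul (m _)).mul (m _))
  have hterm : ∀ S₁ S₂ S₃, W.xSq S₁ * W.xSq S₂ * W.xSq S₃ ≤ X ^ 2 * W.xSq (S' \ S) →
      ∫⁻ y, ‖W.wave S y‖ₑ * (‖W.wave S₁ y‖ₑ * ‖W.wave S₂ y‖ₑ * ‖W.wave S₃ y‖ₑ) ∂(spaceTime d T) ≤
      bilinearConst d T b * (X ^ 3 * W.xSq (S' \ S)) ^ (1 / 2 : ℝ) := by
    intro S₁ S₂ S₃ h3
    refine (W.lintegral_quad hd hb T S S₁ S₂ S₃).trans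
      (mul_le_mul_right (ENNReal.rpow_le_rpow ?_ (by norm_num)) _)
    calc _ ≤ X * (X ^ 2 * W.xSq (S' \ S)) := mul_le_mul' hS h3
      _ = _ := by ring
  calc _ ≤ ∫⁻ y, (‖W.wave S y‖ₑ * (‖W.wave (S' \ S) y‖ₑ * ‖W.wave S' y‖ₑ * ‖W.wave S' y‖ₑ) +
        ‖W.wave S y‖ₑ * (‖W.wave S y‖ₑ * ‖W.wave (S' \ S) y‖ₑ * ‖W.wave S' y‖ₑ) +
        ‖W.wave S y‖ₑ * (‖W.wave S y‖ₑ * ‖W.wave S y‖ₑ * ‖W.wave (S' \ S) y‖ₑ)) ∂(spaceTime d T) := by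
        refine lintegral_mono fun y => ?_
        rw [← mul_add, ← mul_add]
        exact mul_le_mul_right (W.enorm_nlDiff_le h y) _
    _ ≤ bilinearConst d T b * (X ^ 3 * W.xSq (S' \ S)) ^ (1 / 2 : ℝ) +
        bilinearConst d T b * (X ^ 3 * W.xSq (S' \ S)) ^ (1 / 2 : ℝ) +
        bilinearConst d T b * (X ^ 3 * W.xSq (S' \ S)) ^ (1 / 2 : ℝ) := by
        refine lintegral_add_three_le (m4 _ _ _) (m4 _ _ _) (hterm _ _ _ ?_) (hterm _ _ _ ?_)
          (hterm _ _ _ ?_)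
        · calc _ ≤ W.xSq (S' \ S) * X * X := by gcongr
            _ = _ := by ring
        · calc _ ≤ X * W.xSq (S' \ S) * X := by gcongr
            _ = _ := by ring
        · calc _ ≤ X * X * W.xSq (S' \ S) := by gcongr
            _ = _ := by ring
    _ = _ := by ring

lemma measurable_gradMajorant (hb : 1 / 2 < b) (j : Fin d) (S S' : Finset (Fin d → ℤ)) :
    Measurable (W.gradMajorant j S S') := by
  have m := W.measurable_enorm_wave hb
  have mg := (W.grad j).measurable_enorm_wave hb
  have m3 : ∀ S₁ S₂ S₃, Measurable fun y =>
      ‖(W.grad j).wave S₁ y‖ₑ * ‖W.wave S₂ y‖ₑ * ‖W.wave S₃ y‖ₑ :=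
    fun S₁ S₂ S₃ => ((mg _).mul (m _)).mul (m _)
  exact ((((m3 _ _ _).add (m3 _ _ _)).add (m3 _ _ _)).add
    (((m3 _ _ _).add (m3 _ _ _)).add (m3 _ _ _))).add
    (((m3 _ _ _).add (m3 _ _ _)).add (m3 _ _ _))

lemma lintegral_grad_mul_gradMajorant_le (hd : d = 1 ∨ d = 2 ∨ d = 3) (hb : 1 / 2 < b) (T : ℝ)
    (j : Fin d) (h : S ⊆ S') (hX : W.xSq S' ≤ X) :
    ∫⁻ y, ‖(W.grad j).wave S y‖ₑ * W.gradMajorant j S S' y ∂(spaceTime d T) ≤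
      9 * (bilinearConst d T b * (X ^ 3 * W.xSq (S' \ S)) ^ (1 / 2 : ℝ)) := by
  have hS : W.xSq S ≤ X := (W.xSq_mono h).trans hX
  have m := W.measurable_enorm_wave hb
  have mg := (W.grad j).measurable_enorm_wave hb
  set β := bilinearConst d T b * (X ^ 3 * W.xSq (S' \ S)) ^ (1 / 2 : ℝ) with hβ
  have hterm : ∀ S₁ S₂ S₃, W.xSq S₁ * W.xSq S₂ * W.xSq S₃ ≤ X ^ 2 * W.xSq (S' \ S) →
      ∫⁻ y, ‖(W.grad j).wave S y‖ₑ *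
        (‖(W.grad j).wave S₁ y‖ₑ * ‖W.wave S₂ y‖ₑ * ‖W.wave S₃ y‖ₑ) ∂(spaceTime d T) ≤ β := by
    intro S₁ S₂ S₃ h3
    refine (W.lintegral_quad_grad hd hb T j S S₁ S₂ S₃).trans
      (mul_le_mul_right (ENNReal.rpow_le_rpow ?_ (by norm_num)) _)
    calc _ ≤ X * (X ^ 2 * W.xSq (S' \ S)) := mul_le_mul' hS h3
      _ = _ := by ring
  have m4 : ∀ S₁ S₂ S₃, Measurable fun y => ‖(W.grad j).wave S y‖ₑ *
      (‖(W.grad j).wave S₁ y‖ₑ * ‖W.wave S₂ y‖ₑ * ‖W.wave S₃ y‖ₑ) :=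
    fun S₁ S₂ S₃ => (mg _).mul (((mg _).mul (m _)).mul (m _))
  -- The three cases are the three positions that the high-frequency factor can take among the
  -- factors of a majorant term.
  have o1 : ∀ S₂ S₃, W.xSq S₂ ≤ X → W.xSq S₃ ≤ X →
      W.xSq (S' \ S) * W.xSq S₂ * W.xSq S₃ ≤ X ^ 2 * W.xSq (S' \ S) := fun S₂ S₃ h2 h3 => by
    calc _ ≤ W.xSq (S' \ S) * X * X := by gcongr
      _ = _ := by ring
  have o2 : ∀ S₂ S₃, W.xSq S₂ ≤ X → W.xSq S₃ ≤ X →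
      W.xSq S₂ * W.xSq (S' \ S) * W.xSq S₃ ≤ X ^ 2 * W.xSq (S' \ S) := fun S₂ S₃ h2 h3 => by
    calc _ ≤ X * W.xSq (S' \ S) * X := by gcongr
      _ = _ := by ring
  have o3 : ∀ S₂ S₃, W.xSq S₂ ≤ X → W.xSq S₃ ≤ X →
      W.xSq S₂ * W.xSq S₃ * W.xSq (S' \ S) ≤ X ^ 2 * W.xSq (S' \ S) := fun S₂ S₃ h2 h3 => by
    calc _ ≤ X * X * W.xSq (S' \ S) := by gcongr
      _ = _ := by ring
  simp only [gradMajorant, mul_add]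
  have m5 : ∀ S₁ S₂ S₃ S₄ S₅ S₆ S₇ S₈ S₉, Measurable fun y => ‖(W.grad j).wave S y‖ₑ *
      (‖(W.grad j).wave S₁ y‖ₑ * ‖W.wave S₂ y‖ₑ * ‖W.wave S₃ y‖ₑ) + ‖(W.grad j).wave S y‖ₑ *
      (‖(W.grad j).wave S₄ y‖ₑ * ‖W.wave S₅ y‖ₑ * ‖W.wave S₆ y‖ₑ) + ‖(W.grad j).wave S y‖ₑ *
      (‖(W.grad j).wave S₇ y‖ₑ * ‖W.wave S₈ y‖ₑ * ‖W.wave S₉ y‖ₑ) :=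
    fun _ _ _ _ _ _ _ _ _ => ((m4 _ _ _).add (m4 _ _ _)).add (m4 _ _ _)
  calc _ ≤ (β + β + β) + (β + β + β) + (β + β + β) := by
        refine lintegral_add_three_le (m5 _ _ _ _ _ _ _ _ _) (m5 _ _ _ _ _ _ _ _ _)
          (lintegral_add_three_le (m4 _ _ _) (m4 _ _ _) ?_ ?_ ?_)
          (lintegral_add_three_le (m4 _ _ _) (m4 _ _ _) ?_ ?_ ?_)
          (lintegral_add_three_le (m4 _ _ _) (m4 _ _ _) ?_ ?_ ?_)
        · exact hterm _ _ _ (o1 _ _ hX hX)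
        · exact hterm _ _ _ (o2 _ _ hX hX)
        · exact hterm _ _ _ (o2 _ _ hX hX)
        · exact hterm _ _ _ (o2 _ _ hS hX)
        · exact hterm _ _ _ (o1 _ _ hS hX)
        · exact hterm _ _ _ (o3 _ _ hX hS)
        · exact hterm _ _ _ (o3 _ _ hS hS)
        · exact hterm _ _ _ (o3 _ _ hS hS)
        · exact hterm _ _ _ (o1 _ _ hS hS)
    _ = _ := by ring

/-- The constant in the trilinear estimate. -/
def trilinearConst (d : ℕ) (T b : ℝ) : ℝ≥0∞ :=
  embedConst d * invMass b * ((1 + 4 * d) * bilinearConst d T b)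

lemma lintegral_nl_sq_le (hd : d = 1 ∨ d = 2 ∨ d = 3) (hb : 1 / 2 < b) (T : ℝ)
    (hX : W.xSq S ≤ X) :
    ENNReal.ofReal (vol d) * ∫⁻ y, ‖nl (W.wave S y)‖ₑ ^ 2 ∂(spaceTime d T) ≤
      trilinearConst d T b * X ^ 3 := by
  have h := W.lintegral_trilinear hd hb T S S S
  have e : ∀ y, ‖nl (W.wave S y)‖ₑ = ‖W.wave S y * W.wave S y * W.wave S y‖ₑ := fun y => by
    rw [enorm_nl, enorm_mul, enorm_mul]; ring
  simp only [e]
  refine h.trans ?_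
  rw [trilinearConst]
  calc _ ≤ embedConst d * invMass b * ((1 + 4 * d) * bilinearConst d T b) * (X * X * X) := by gcongr
    _ = _ := by ring

lemma lintegral_nlDiff_sq_le (hd : d = 1 ∨ d = 2 ∨ d = 3) (hb : 1 / 2 < b) (T : ℝ)
    (h : S ⊆ S') (hX : W.xSq S' ≤ X) :
    ENNReal.ofReal (vol d) * ∫⁻ y, ‖W.nlDiff S S' y‖ₑ ^ 2 ∂(spaceTime d T) ≤
      12 * (trilinearConst d T b * (X ^ 2 * W.xSq (S' \ S))) := by
  have hS : W.xSq S ≤ X := (W.xSq_mono h).trans hX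
  have c := W.continuous_wave hb
  have m3 : ∀ S₁ S₂ S₃, Measurable fun y => ‖W.wave S₁ y * W.wave S₂ y * W.wave S₃ y‖ₑ ^ 2 :=
    fun S₁ S₂ S₃ => (((c _).mul (c _)).mul (c _)).measurable.enorm.pow_const 2
  have hterm : ∀ S₁ S₂ S₃, W.xSq S₁ * W.xSq S₂ * W.xSq S₃ ≤ X ^ 2 * W.xSq (S' \ S) →
      ENNReal.ofReal (vol d) *
        ∫⁻ y, ‖W.wave S₁ y * W.wave S₂ y * W.wave S₃ y‖ₑ ^ 2 ∂(spaceTime d T) ≤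
      trilinearConst d T b * (X ^ 2 * W.xSq (S' \ S)) := fun S₁ S₂ S₃ h3 =>
    (W.lintegral_trilinear hd hb T S₁ S₂ S₃).trans (mul_le_mul_right h3 _)
  set γ := trilinearConst d T b * (X ^ 2 * W.xSq (S' \ S)) with hγ
  have hpt : ∀ y, ‖W.nlDiff S S' y‖ₑ ^ 2 ≤
      4 * (‖W.wave (S' \ S) y * W.wave S' y * W.wave S' y‖ₑ ^ 2 +
        ‖W.wave S y * W.wave (S' \ S) y * W.wave S' y‖ₑ ^ 2 +
        ‖W.wave S y * W.wave S y * W.wave (S' \ S) y‖ₑ ^ 2) := by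
    intro y
    refine (pow_le_pow_left₀ zero_le (W.enorm_nlDiff_le h y) 2).trans ?_
    simp only [← enorm_mul]
    refine (add_sq_le_ennreal _ _).trans ?_
    set p := ‖W.wave (S' \ S) y * W.wave S' y * W.wave S' y‖ₑ
    set q := ‖W.wave S y * W.wave (S' \ S) y * W.wave S' y‖ₑ
    set r := ‖W.wave S y * W.wave S y * W.wave (S' \ S) y‖ₑ
    calc 2 * ((p + q) ^ 2 + r ^ 2) ≤ 2 * (2 * (p ^ 2 + q ^ 2) + r ^ 2 + r ^ 2) := by
          gcongr
          exact (add_sq_le_ennreal p q).trans le_self_add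
      _ = _ := by ring
  calc _ ≤ ENNReal.ofReal (vol d) *
        ∫⁻ y, 4 * (‖W.wave (S' \ S) y * W.wave S' y * W.wave S' y‖ₑ ^ 2 +
        ‖W.wave S y * W.wave (S' \ S) y * W.wave S' y‖ₑ ^ 2 +
        ‖W.wave S y * W.wave S y * W.wave (S' \ S) y‖ₑ ^ 2) ∂(spaceTime d T) :=
        mul_le_mul_right (lintegral_mono hpt) _
    _ ≤ 4 * (γ + γ + γ) := by
        rw [lintegral_const_mul' _ _ (by norm_num), lintegral_add_right _ (m3 _ _ _),
          lintegral_add_right _ (m3 _ _ _), mul_left_comm, mul_add (ENNReal.ofReal _),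
          mul_add (ENNReal.ofReal _)]
        refine mul_le_mul_right (add_le_add (add_le_add ?_ ?_) ?_) _
        · refine hterm _ _ _ ?_
          calc _ ≤ W.xSq (S' \ S) * X * X := by gcongr
            _ = _ := by ring
        · refine hterm _ _ _ ?_
          calc _ ≤ X * W.xSq (S' \ S) * X := by gcongr
            _ = _ := by ring
        · refine hterm _ _ _ ?_
          calc _ ≤ X * X * W.xSq (S' \ S) := by gcongr
            _ = _ := by ring
    _ = _ := by ring

/-- The quadratic part of the energy produces an `H¹` pairing, written as integrals of the functions
and of their gradients. The quartic part produces an `L²` pairing of two cubic expressions, bounded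
by Bessel's inequality. -/
lemma enorm_energyError_le (h : S ⊆ S') (t : ℝ) :
    ENNReal.ofReal (vol d) * ‖W.energyError S S' t‖ₑ ≤
      (∫⁻ x, ‖W.wave S (t, x)‖ₑ * ‖W.nlDiff S S' (t, x)‖ₑ) +
      (∑ j, ∫⁻ x, ‖(W.grad j).wave S (t, x)‖ₑ * W.gradMajorant j S S' (t, x)) +
      (∫⁻ x, ‖nl (W.wave S (t, x))‖ₑ ^ 2) ^ (1 / 2 : ℝ) *
        (∫⁻ x, ‖W.nlDiff S S' (t, x)‖ₑ ^ 2) ^ (1 / 2 : ℝ) := by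
  have hD := W.isSmooth_nlDiff S S' t
  have hvol : ‖(vol d : ℂ)‖ₑ = ENNReal.ofReal (vol d) := by
    rw [← ofReal_norm, Complex.norm_real, Real.norm_of_nonneg (vol_pos d).le]
  have e : (vol d : ℂ) * W.energyError S S' t =
      ((∫ x, conj (W.wave S (t, x)) * W.nlDiff S S' (t, x)) +
      ∑ j, ∫ x, conj ((W.grad j).wave S (t, x)) *
        partialDeriv j (fun x => W.nlDiff S S' (t, x)) x) +
      (vol d : ℂ) * ∑ k ∈ S, conj (fcoeff (fun x => nl (W.wave S (t, x))) k) *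
        fcoeff (fun x => W.nlDiff S S' (t, x)) k := by
    have h1 := sum_wt_conj_mul_fcoeff hD S (fun k => W.mode k t)
    simp only [energyError, add_mul, Finset.sum_add_distrib, mul_add]
    rw [h1]
    simp only [wave_grad]
    rfl
  rw [← hvol, ← enorm_mul, e]
  refine (enorm_add_le _ _).trans (add_le_add ((enorm_add_le _ _).trans (add_le_add ?_ ?_)) ?_)
  · refine (enorm_integral_le_lintegral_enorm _).trans_eq (lintegral_congr fun x => ?_)
    rw [enorm_mul, enorm_conj]
  · refine (enorm_sum_le _ _).trans (Finset.sum_le_sum fun j _ => ?_)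
    refine (enorm_integral_le_lintegral_enorm _).trans (lintegral_mono fun x => ?_)
    rw [enorm_mul, enorm_conj]
    exact mul_le_mul_right (W.enorm_partialDeriv_nlDiff_le j h t x) _
  · rw [enorm_mul, hvol]
    exact vol_mul_sum_conj_le (W.isSmooth_wave S t).nl.continuous hD.continuous S

/-- The constant in the estimate of the energy error. -/
def errorConst (d : ℕ) (T b : ℝ) (X : ℝ≥0∞) : ℝ≥0∞ :=
  3 * (bilinearConst d T b * (X ^ 3) ^ (1 / 2 : ℝ)) +
    d * (9 * (bilinearConst d T b * (X ^ 3) ^ (1 / 2 : ℝ))) +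
    (ENNReal.ofReal (vol d))⁻¹ * ((trilinearConst d T b * X ^ 3) ^ (1 / 2 : ℝ) *
      (12 * (trilinearConst d T b * X ^ 2)) ^ (1 / 2 : ℝ))

lemma errorConst_lt_top (hb : 1 / 2 < b) (T : ℝ) (hX : X < ⊤) : errorConst d T b X < ⊤ := by
  have h1 := bilinearConst_lt_top (d := d) hb T
  have h2 := invMass_lt_top hb
  have h3 : trilinearConst d T b < ⊤ :=
    ENNReal.mul_lt_top (ENNReal.mul_lt_top (by unfold embedConst; exact ENNReal.ofReal_lt_top) h2)
      (ENNReal.mul_lt_top (by finiteness) h1)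
  have h4 : ENNReal.ofReal (vol d) ≠ 0 := by simp [vol_pos d]
  have h5 : (ENNReal.ofReal (vol d))⁻¹ < ⊤ := (ENNReal.inv_ne_top.mpr h4).lt_top
  have hr : ∀ z : ℝ≥0∞, z < ⊤ → z ^ (1 / 2 : ℝ) < ⊤ := fun z hz =>
    ENNReal.rpow_lt_top_of_nonneg (by norm_num) hz.ne
  have h6 : bilinearConst d T b * (X ^ 3) ^ (1 / 2 : ℝ) < ⊤ :=
    ENNReal.mul_lt_top h1 (hr _ (ENNReal.pow_lt_top hX))
  exact ENNReal.add_lt_top.2 ⟨ENNReal.add_lt_top.2 ⟨ENNReal.mul_lt_top (by finiteness) h6,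
    ENNReal.mul_lt_top (by finiteness) (ENNReal.mul_lt_top (by finiteness) h6)⟩,
    ENNReal.mul_lt_top h5 (ENNReal.mul_lt_top
      (hr _ (ENNReal.mul_lt_top h3 (ENNReal.pow_lt_top hX)))
      (hr _ (ENNReal.mul_lt_top (by finiteness) (ENNReal.mul_lt_top h3 (ENNReal.pow_lt_top hX)))))⟩

/-- The energy error tends to zero with the high frequency part of the solution. -/
lemma lintegral_energyError_le (hd : d = 1 ∨ d = 2 ∨ d = 3) (hb : 1 / 2 < b) (T : ℝ)
    (h : S ⊆ S') (hX : W.xSq S' ≤ X) :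
    ENNReal.ofReal (vol d) * ∫⁻ t in Ioo 0 T, ‖W.energyError S S' t‖ₑ ≤
      errorConst d T b X * W.xSq (S' \ S) ^ (1 / 2 : ℝ) := by
  have hS : W.xSq S ≤ X := (W.xSq_mono h).trans hX
  have hv0 : ENNReal.ofReal (vol d) ≠ 0 := by simp [vol_pos d]
  have m1 : Measurable fun y => ‖W.wave S y‖ₑ * ‖W.nlDiff S S' y‖ₑ :=
    (W.measurable_enorm_wave hb S).mul (W.continuous_nlDiff hb S S').measurable.enorm
  have m2 : ∀ j, Measurable fun y => ‖(W.grad j).wave S y‖ₑ * W.gradMajorant j S S' y := fun j =>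
    ((W.grad j).measurable_enorm_wave hb S).mul (W.measurable_gradMajorant hb j S S')
  have m3 : Measurable fun y => ‖nl (W.wave S y)‖ₑ ^ 2 :=
    (continuous_nl.comp (W.continuous_wave hb S)).measurable.enorm.pow_const 2
  have m4 : Measurable fun y => ‖W.nlDiff S S' y‖ₑ ^ 2 :=
    (W.continuous_nlDiff hb S S').measurable.enorm.pow_const 2
  have h1 := W.lintegral_wave_mul_nlDiff_le hd hb T h hX
  have h2 := fun j => W.lintegral_grad_mul_gradMajorant_le hd hb T j h hX
  have h3 := W.lintegral_nl_sq_le hd hb T hS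
  have h4 := W.lintegral_nlDiff_sq_le hd hb T h hX
  unfold spaceTime at h1 h2 h3 h4
  rw [lintegral_prod _ m1.aemeasurable] at h1
  simp only [lintegral_prod _ (m2 _).aemeasurable] at h2
  rw [lintegral_prod _ m3.aemeasurable] at h3
  rw [lintegral_prod _ m4.aemeasurable] at h4
  rw [← lintegral_const_mul' _ _ ENNReal.ofReal_ne_top]
  refine (lintegral_mono fun t => W.enorm_energyError_le h t).trans ?_
  have m5 : Measurable fun t => (∫⁻ x, ‖nl (W.wave S (t, x))‖ₑ ^ 2) ^ (1 / 2 : ℝ) :=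
    m3.lintegral_prod_right'.pow_const _
  have m6 : Measurable fun t => (∫⁻ x, ‖W.nlDiff S S' (t, x)‖ₑ ^ 2) ^ (1 / 2 : ℝ) :=
    m4.lintegral_prod_right'.pow_const _
  have m7 : Measurable fun t => (∫⁻ x, ‖nl (W.wave S (t, x))‖ₑ ^ 2) ^ (1 / 2 : ℝ) *
      (∫⁻ x, ‖W.nlDiff S S' (t, x)‖ₑ ^ 2) ^ (1 / 2 : ℝ) := m5.mul m6
  rw [lintegral_add_right _ m7, lintegral_add_left m1.lintegral_prod_right',
    lintegral_finsetSum _ fun j _ => (m2 j).lintegral_prod_right']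
  set η := W.xSq (S' \ S) with hη
  -- Cauchy–Schwarz in time turns the last term into a product of space-time `L²` norms, to which
  -- the trilinear bounds apply.
  have hcs := lintegral_mul_le_sqrt (μ := (volume : Measure ℝ).restrict (Ioo 0 T))
    m5.aemeasurable m6.aemeasurable
  have hsq : ∀ z : ℝ≥0∞, (z ^ (1 / 2 : ℝ)) ^ 2 = z := fun z => by rw [sq, sqrt_mul_self_ennreal]
  simp only [hsq] at hcs
  have hv : ∀ z : ℝ≥0∞, z = (ENNReal.ofReal (vol d))⁻¹ * (ENNReal.ofReal (vol d) * z) := fun z => by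
    rw [← mul_assoc, ENNReal.inv_mul_cancel hv0 ENNReal.ofReal_ne_top, one_mul]
  have h5 : (∫⁻ t in Ioo 0 T, ∫⁻ x, ‖nl (W.wave S (t, x))‖ₑ ^ 2) ^ (1 / 2 : ℝ) *
      (∫⁻ t in Ioo 0 T, ∫⁻ x, ‖W.nlDiff S S' (t, x)‖ₑ ^ 2) ^ (1 / 2 : ℝ) ≤
      (ENNReal.ofReal (vol d))⁻¹ * ((trilinearConst d T b * X ^ 3) ^ (1 / 2 : ℝ) *
        (12 * (trilinearConst d T b * X ^ 2)) ^ (1 / 2 : ℝ)) * η ^ (1 / 2 : ℝ) := by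
    rw [hv (∫⁻ t in Ioo 0 T, ∫⁻ x, ‖nl (W.wave S (t, x))‖ₑ ^ 2),
      hv (∫⁻ t in Ioo 0 T, ∫⁻ x, ‖W.nlDiff S S' (t, x)‖ₑ ^ 2),
      ENNReal.mul_rpow_of_nonneg (ENNReal.ofReal (vol d))⁻¹ _ (by norm_num),
      ENNReal.mul_rpow_of_nonneg (ENNReal.ofReal (vol d))⁻¹ _ (by norm_num), mul_mul_mul_comm,
      sqrt_mul_self_ennreal, mul_assoc]
    gcongr _ * ?_
    calc _ ≤ (trilinearConst d T b * X ^ 3) ^ (1 / 2 : ℝ) *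
          (12 * (trilinearConst d T b * (X ^ 2 * η))) ^ (1 / 2 : ℝ) := by gcongr
      _ = _ := by
        rw [mul_assoc, ← ENNReal.mul_rpow_of_nonneg _ η (by norm_num)]
        congr 2
        ring
  refine (add_le_add (add_le_add h1 (Finset.sum_le_sum fun j _ => h2 j)) (hcs.trans h5)).trans_eq ?_
  rw [Finset.sum_const, Finset.card_univ, Fintype.card_fin, nsmul_eq_mul,
    ENNReal.mul_rpow_of_nonneg _ η (by norm_num), errorConst]
  ring

end Bounds

end WaveData

/-! ### Primitives of integrable functions -/

/-- On `[0,T]`, the function `z` is the primitive of the integrable function `z'`. -/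
structure IsPrimitive {E : Type*} [NormedAddCommGroup E] [NormedSpace ℝ E] (T : ℝ) (z z' : ℝ → E) :
    Prop where
  intervalIntegrable : IntervalIntegrable z' volume 0 T
  eq_add_integral : ∀ t ∈ Icc 0 T, z t = z 0 + ∫ s in (0 : ℝ)..t, z' s

lemma continuousOn_primitive_Icc {E : Type*} [NormedAddCommGroup E] [NormedSpace ℝ E] {T : ℝ}
    (hT : 0 ≤ T) {z' : ℝ → E} (h : IntervalIntegrable z' volume 0 T) :
    ContinuousOn (fun t => ∫ s in (0 : ℝ)..t, z' s) (Icc 0 T) := by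
  rw [← uIcc_of_le hT]
  refine intervalIntegral.continuousOn_primitive_interval ?_
  rw [uIcc_of_le hT]
  exact (intervalIntegrable_iff_integrableOn_Icc_of_le hT).mp h

namespace IsPrimitive

variable {E F : Type*} [NormedAddCommGroup E] [NormedSpace ℝ E] [NormedAddCommGroup F]
  [NormedSpace ℝ F] {T : ℝ}

lemma intervalIntegrable_of_mem {z z' : ℝ → E} (h : IsPrimitive T z z') {t : ℝ}
    (ht : t ∈ Icc 0 T) : IntervalIntegrable z' volume 0 t :=
  h.intervalIntegrable.mono_set (by
    rw [uIcc_of_le ht.1, uIcc_of_le (ht.1.trans ht.2)]; exact Icc_subset_Icc_right ht.2)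

lemma continuousOn {z z' : ℝ → E} (h : IsPrimitive T z z') : ContinuousOn z (Icc 0 T) := by
  rcases lt_or_ge T 0 with hT | hT
  · rw [Icc_eq_empty hT.not_ge]
    exact continuousOn_empty _
  have h2 : ContinuousOn (fun t => z 0 + ∫ s in (0 : ℝ)..t, z' s) (Icc 0 T) :=
    
    ContinuousOn.add continuousOn_const (continuousOn_primitive_Icc hT h.intervalIntegrable)
  exact ContinuousOn.congr h2 fun t ht => h.eq_add_integral t ht

lemma map [CompleteSpace E] [CompleteSpace F] {z z' : ℝ → E} (h : IsPrimitive T z z')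
    (A : E →L[ℝ] F) : IsPrimitive T (fun t => A (z t)) fun t => A (z' t) := by
  refine ⟨⟨?_, ?_⟩, fun t ht => ?_⟩
  · exact ContinuousLinearMap.integrable_comp A h.intervalIntegrable.1
  · exact ContinuousLinearMap.integrable_comp A h.intervalIntegrable.2
  · have := A.intervalIntegral_comp_comm (h.intervalIntegrable_of_mem ht)
    rw [this, h.eq_add_integral t ht, map_add]

lemma sum {ι : Type*} (S : Finset ι) {z z' : ι → ℝ → E} (h : ∀ i ∈ S, IsPrimitive T (z i) (z' i)) :
    IsPrimitive T (fun t => ∑ i ∈ S, z i t) fun t => ∑ i ∈ S, z' i t where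
  intervalIntegrable := by
    have := IntervalIntegrable.sum S (fun i hi => (h i hi).intervalIntegrable)
    exact this.congr (by simp [EqOn, Finset.sum_apply])
  eq_add_integral t ht := by
    rw [intervalIntegral.integral_finsetSum fun i hi => (h i hi).intervalIntegrable_of_mem ht,
      ← Finset.sum_add_distrib]
    exact Finset.sum_congr rfl fun i hi => (h i hi).eq_add_integral t ht

lemma add {z z' w w' : ℝ → E} (h : IsPrimitive T z z') (h' : IsPrimitive T w w') :
    IsPrimitive T (fun t => z t + w t) fun t => z' t + w' t where
  intervalIntegrable := h.intervalIntegrable.add h'.intervalIntegrable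
  eq_add_integral t ht := by
    rw [intervalIntegral.integral_add (h.intervalIntegrable_of_mem ht)
      (h'.intervalIntegrable_of_mem ht), h.eq_add_integral t ht, h'.eq_add_integral t ht]
    abel

/-- Integration by parts for absolutely continuous functions: the primitives have the given
derivatives almost everywhere. -/
lemma mul (hT : 0 ≤ T) {p p' q q' : ℝ → ℝ} (hp : IsPrimitive T p p') (hq : IsPrimitive T q q') :
    IsPrimitive T (fun t => p t * q t) fun t => p' t * q t + p t * q' t := by
  have hu : uIcc 0 T = Icc 0 T := uIcc_of_le hT
  refine ⟨(hp.intervalIntegrable.mul_continuousOn (hu ▸ hq.continuousOn)).add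
    (hq.intervalIntegrable.continuousOn_mul (hu ▸ hp.continuousOn)), fun t ht => ?_⟩
  have ac : ∀ {r r' : ℝ → ℝ}, IsPrimitive T r r' → AbsolutelyContinuousOnInterval
      (fun x => r 0 + ∫ s in (0 : ℝ)..x, r' s) 0 t := fun {r r'} hr =>
    (LipschitzOnWith.absolutelyContinuousOnInterval (K := 0)
      ((LipschitzWith.const (r 0)).lipschitzOnWith)).add
    ((hr.intervalIntegrable_of_mem ht).absolutelyContinuousOnInterval_intervalIntegral (by simp))
  have dv : ∀ {r r' : ℝ → ℝ}, IsPrimitive T r r' → ∀ᵐ x, x ∈ uIcc 0 t →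
      deriv (fun x => r 0 + ∫ s in (0 : ℝ)..x, r' s) x = r' x := fun {r r'} hr => by
    filter_upwards [(hr.intervalIntegrable_of_mem ht).ae_hasDerivAt_integral] with x hx hxt
    exact ((hx hxt 0 (by simp)).const_add _).deriv
  have key := (ac hp).integral_deriv_mul_eq_sub (ac hq)
  simp only [intervalIntegral.integral_same, add_zero] at key
  rw [← hp.eq_add_integral t ht, ← hq.eq_add_integral t ht] at key
  rw [← sub_eq_iff_eq_add', ← key]
  refine intervalIntegral.integral_congr_ae ?_
  filter_upwards [dv hp, dv hq] with x h1 h2 hx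
  have hx' := uIoc_subset_uIcc hx
  have hxT : x ∈ Icc 0 T := by
    rw [uIcc_of_le ht.1] at hx'
    exact ⟨hx'.1, hx'.2.trans ht.2⟩
  rw [h1 hx', h2 hx', ← hp.eq_add_integral x hxT, ← hq.eq_add_integral x hxT]

lemma normSq (hT : 0 ≤ T) {z z' : ℝ → ℂ} (h : IsPrimitive T z z') :
    IsPrimitive T (fun t => ‖z t‖ ^ 2) fun t => 2 * (conj (z t) * z' t).re := by
  have hr := h.map Complex.reCLM
  have hi := h.map Complex.imCLM
  convert (hr.mul hT hr).add (hi.mul hT hi) using 2 with t t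
  · rw [← Complex.normSq_eq_norm_sq, Complex.normSq_apply]
    rfl
  · simp only [Complex.mul_re, Complex.conj_re, Complex.conj_im, Complex.reCLM_apply,
      Complex.imCLM_apply]
    ring

lemma normPowFour (hT : 0 ≤ T) {z z' : ℝ → ℂ} (h : IsPrimitive T z z') :
    IsPrimitive T (fun t => ‖z t‖ ^ 4) fun t => 4 * (conj (nl (z t)) * z' t).re := by
  convert (h.normSq hT).mul hT (h.normSq hT) using 2 with t t
  · ring
  · rw [nl, map_mul, Complex.conj_ofReal, mul_assoc, Complex.re_ofReal_mul]
    ring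

lemma const_mul {z z' : ℝ → ℝ} (h : IsPrimitive T z z') (c : ℝ) :
    IsPrimitive T (fun t => c * z t) fun t => c * z' t where
  intervalIntegrable := h.intervalIntegrable.const_mul c
  eq_add_integral t ht := by
    rw [intervalIntegral.integral_const_mul, h.eq_add_integral t ht, mul_add]

lemma mul_const {z z' : ℝ → ℂ} (h : IsPrimitive T z z') (c : ℂ) :
    IsPrimitive T (fun t => z t * c) fun t => z' t * c where
  intervalIntegrable := h.intervalIntegrable.mul_const c
  eq_add_integral t ht := by
    rw [intervalIntegral.integral_mul_const, h.eq_add_integral t ht, add_mul]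

end IsPrimitive

/-! ### Functions with an integrable weak derivative -/

section WeakDerivative

variable {T : ℝ}

/-- A bump function of integral one, supported in the ball of radius `1 / (n + 1)`. -/
def mollifier (n : ℕ) : ContDiffBump (0 : ℝ) where
  rIn := 1 / (n + 1) / 2
  rOut := 1 / (n + 1)
  rIn_pos := by positivity
  rIn_lt_rOut := half_lt_self (by positivity)

/-- A smooth approximation of the indicator function of `[s,t]`. -/
def plateau (s t : ℝ) (n : ℕ) (x : ℝ) : ℝ := ∫ y in (x - t)..(x - s), (mollifier n).normed volume y

lemma intervalIntegrable_mollifier (n : ℕ) (p q : ℝ) :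
    IntervalIntegrable ((mollifier n).normed volume) volume p q :=
  ((mollifier n).continuous_normed).intervalIntegrable _ _

lemma plateau_eq (s t : ℝ) (n : ℕ) (x : ℝ) : plateau s t n x =
    (∫ y in (0 : ℝ)..(x - s), (mollifier n).normed volume y) -
      ∫ y in (0 : ℝ)..(x - t), (mollifier n).normed volume y :=
  (intervalIntegral.integral_interval_sub_left (intervalIntegrable_mollifier n _ _)
    (intervalIntegrable_mollifier n _ _)).symm

lemma hasDerivAt_plateau (s t : ℝ) (n : ℕ) (x : ℝ) : HasDerivAt (plateau s t n)
    ((mollifier n).normed volume (x - s) - (mollifier n).normed volume (x - t)) x := by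
  have h : ∀ r, HasDerivAt (fun x => ∫ y in (0 : ℝ)..(x - r), (mollifier n).normed volume y)
      ((mollifier n).normed volume (x - r)) x := fun r =>
    (((mollifier n).continuous_normed.integral_hasStrictDerivAt 0 (x - r)).hasDerivAt).comp_sub_const
      x r
  exact ((h s).sub (h t)).congr_of_eventuallyEq (.of_forall fun x => plateau_eq s t n x)

lemma contDiff_plateau (s t : ℝ) (n : ℕ) : ContDiff ℝ ∞ (plateau s t n) := by
  rw [contDiff_infty_iff_deriv]
  refine ⟨fun x => (hasDerivAt_plateau s t n x).differentiableAt, ?_⟩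
  have h : deriv (plateau s t n) = fun x =>
      (mollifier n).normed volume (x - s) - (mollifier n).normed volume (x - t) :=
    funext fun x => (hasDerivAt_plateau s t n x).deriv
  rw [h]
  have hc : ContDiff ℝ ∞ ((mollifier n).normed volume) := (mollifier n).contDiff_normed
  exact (hc.comp (contDiff_id.sub contDiff_const)).sub (hc.comp (contDiff_id.sub contDiff_const))

lemma mollifier_eq_zero {n : ℕ} {y : ℝ} (h : 1 / ((n : ℝ) + 1) ≤ |y|) :
    (mollifier n).normed volume y = 0 := by
  by_contra hne
  have h1 : y ∈ Function.support ((mollifier n).normed volume) := hne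
  rw [ContDiffBump.support_normed_eq, mem_ball_zero_iff, Real.norm_eq_abs] at h1
  exact absurd h1 h.not_gt

lemma plateau_nonneg {s t : ℝ} (hst : s ≤ t) (n : ℕ) (x : ℝ) : 0 ≤ plateau s t n x :=
  intervalIntegral.integral_nonneg (by linarith) fun y _ => (mollifier n).nonneg_normed y

lemma plateau_le_one {s t : ℝ} (hst : s ≤ t) (n : ℕ) (x : ℝ) : plateau s t n x ≤ 1 := by
  rw [plateau, intervalIntegral.integral_of_le (by linarith),
    ← (mollifier n).integral_normed (μ := (volume : Measure ℝ))]
  exact setIntegral_le_integral (mollifier n).integrable_normed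
    (ae_of_all _ fun y => (mollifier n).nonneg_normed y)

lemma plateau_eq_zero {s t : ℝ} (hst : s ≤ t) {n : ℕ} {x : ℝ}
    (h : x ≤ s - 1 / ((n : ℝ) + 1) ∨ t + 1 / ((n : ℝ) + 1) ≤ x) : plateau s t n x = 0 := by
  have h0 : 0 < 1 / ((n : ℝ) + 1) := by positivity
  rw [plateau]
  refine (intervalIntegral.integral_congr (g := fun _ => 0) fun y hy => ?_).trans (by simp)
  rw [uIcc_of_le (by linarith)] at hy
  refine mollifier_eq_zero (le_abs.mpr ?_)
  rcases h with h | h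
  · right; linarith [hy.2]
  · left; linarith [hy.1]

lemma plateau_eq_one {s t : ℝ} {n : ℕ} {x : ℝ} (h1 : s + 1 / ((n : ℝ) + 1) ≤ x)
    (h2 : x ≤ t - 1 / ((n : ℝ) + 1)) : plateau s t n x = 1 := by
  rw [plateau, intervalIntegral.integral_eq_integral_of_support_subset, ContDiffBump.integral_normed]
  rw [ContDiffBump.support_normed_eq, Real.ball_eq_Ioo]
  refine Ioo_subset_Ioc_self.trans (Ioc_subset_Ioc ?_ ?_) <;> simp only [mollifier] <;> linarith

lemma tendsto_integral_mollifier {c : ℝ → ℂ} (hc : Continuous c) (s : ℝ) :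
    Tendsto (fun n => ∫ x, (mollifier n).normed volume (x - s) • c x) atTop (𝓝 (c s)) := by
  have h := ContDiffBump.convolution_tendsto_right_of_continuous (μ := (volume : Measure ℝ))
    (φ := mollifier) (l := atTop) tendsto_one_div_add_atTop_nhds_zero_nat hc s
  refine h.congr fun n => ?_
  rw [convolution_def, ← integral_sub_left_eq_self _ volume s]
  refine integral_congr_ae (ae_of_all _ fun x => ?_)
  simp only [ContinuousLinearMap.lsmul_apply, sub_sub_cancel]
  -- The bump is even, which reconciles its argument `x - s` with the `s - x` of a convolution.
  rw [← ContDiffBump.normed_neg, neg_sub]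

lemma tsupport_plateau_subset {s t : ℝ} (hst : s ≤ t) (n : ℕ) :
    tsupport (plateau s t n) ⊆ Icc (s - 1 / ((n : ℝ) + 1)) (t + 1 / ((n : ℝ) + 1)) := by
  refine closure_minimal (fun x hx => ?_) isClosed_Icc
  by_contra hcon
  rw [mem_Icc, not_and_or, not_le, not_le] at hcon
  exact hx (plateau_eq_zero hst (hcon.imp le_of_lt le_of_lt))

lemma integrable_mollifier_smul {c : ℝ → ℂ} (hc : Continuous c) (n : ℕ) (r : ℝ) :
    Integrable fun x => (mollifier n).normed volume (x - r) • c x := by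
  have h1 : Continuous fun x : ℝ => (mollifier n).normed volume (x - r) :=
    (mollifier n).continuous_normed.comp (continuous_sub_right r)
  have h2 : HasCompactSupport fun x : ℝ => (mollifier n).normed volume (x - r) :=
    (mollifier n).hasCompactSupport_normed.comp_homeomorph (Homeomorph.subRight r)
  exact (h1.smul hc).integrable_of_hasCompactSupport h2.smul_right

lemma tendsto_integral_deriv_plateau {c : ℝ → ℂ} (hc : Continuous c) (s t : ℝ) :
    Tendsto (fun n => ∫ x, deriv (plateau s t n) x • c x) atTop (𝓝 (c s - c t)) := by
  refine ((tendsto_integral_mollifier hc s).sub (tendsto_integral_mollifier hc t)).congr fun n => ?_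
  rw [← integral_sub (integrable_mollifier_smul hc n s) (integrable_mollifier_smul hc n t)]
  refine integral_congr_ae (ae_of_all _ fun x => ?_)
  simp only [(hasDerivAt_plateau s t n x).deriv, sub_smul]

lemma tendsto_plateau {s t : ℝ} (hst : s < t) {x : ℝ} (h1 : x ≠ s) (h2 : x ≠ t) :
    Tendsto (fun n => plateau s t n x) atTop (𝓝 ((Ioo s t).indicator (fun _ => 1) x)) := by
  have hlim := tendsto_one_div_add_atTop_nhds_zero_nat (𝕜 := ℝ)
  refine tendsto_const_nhds.congr' ?_
  by_cases hx : x ∈ Ioo s t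
  · filter_upwards [hlim.eventually_lt_const (sub_pos.2 hx.1),
      hlim.eventually_lt_const (sub_pos.2 hx.2)] with n h3 h4
    rw [plateau_eq_one (by linarith) (by linarith), indicator_of_mem hx]
  · rw [indicator_of_notMem hx]
    have hx' : x < s ∨ t < x := by
      by_contra hcon
      push Not at hcon
      exact hx ⟨lt_of_le_of_ne hcon.1 (Ne.symm h1), lt_of_le_of_ne hcon.2 h2⟩
    rcases hx' with hx' | hx'
    · filter_upwards [hlim.eventually_lt_const (sub_pos.2 hx')] with n h3
      rw [plateau_eq_zero hst.le (Or.inl (by linarith))]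
    · filter_upwards [hlim.eventually_lt_const (sub_pos.2 hx')] with n h3
      rw [plateau_eq_zero hst.le (Or.inr (by linarith))]

lemma tendsto_integral_plateau {h : ℝ → ℂ} (hh : IntegrableOn h (Ioo 0 T)) {s t : ℝ} (hs : 0 < s)
    (hst : s < t) (ht : t < T) :
    Tendsto (fun n => ∫ x in Ioo 0 T, plateau s t n x • h x) atTop (𝓝 (∫ x in s..t, h x)) := by
  have e : ∫ x in s..t, h x =
      ∫ x in Ioo 0 T, (Ioo s t).indicator (fun _ => (1 : ℝ)) x • h x := by
    have h1 := setIntegral_indicator (μ := volume) (f := h) (s := Ioo 0 T)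
      (measurableSet_Ioo (a := s) (b := t))
    rw [inter_eq_right.mpr (Ioo_subset_Ioo hs.le ht.le)] at h1
    rw [intervalIntegral.integral_of_le hst.le, integral_Ioc_eq_integral_Ioo, ← h1]
    refine integral_congr_ae (ae_of_all _ fun x => ?_)
    by_cases hx : x ∈ Ioo s t <;> simp [hx]
  rw [e]
  refine tendsto_integral_of_dominated_convergence (fun x => ‖h x‖) ?_ hh.norm ?_ ?_
  · intro n
    exact (contDiff_plateau s t n).continuous.aestronglyMeasurable.smul hh.aestronglyMeasurable
  · intro n
    refine ae_of_all _ fun x => ?_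
    rw [norm_smul, Real.norm_of_nonneg (plateau_nonneg hst.le n x)]
    exact mul_le_of_le_one_left (norm_nonneg _) (plateau_le_one hst.le n x)
  · have hne : ∀ r : ℝ, ∀ᵐ x ∂(volume.restrict (Ioo 0 T)), x ≠ r := fun r =>
      ae_restrict_of_ae (Measure.ae_ne volume r)
    filter_upwards [hne s, hne t] with x h1 h2
    exact (tendsto_plateau hst h1 h2).smul_const _

/-- A continuous function with an integrable weak derivative is a primitive of it. -/
lemma isPrimitive_of_weak_deriv (hT : 0 < T) {c h : ℝ → ℂ} (hc : ContinuousOn c (Icc 0 T))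
    (hh : IntegrableOn h (Ioo 0 T))
    (H : ∀ η : ℝ → ℝ, ContDiff ℝ ∞ η → tsupport η ⊆ Ioo 0 T →
      ∫ t in Ioo 0 T, deriv η t • c t = -∫ t in Ioo 0 T, η t • h t) : IsPrimitive T c h := by
  have hi : IntervalIntegrable h volume 0 T :=
    (intervalIntegrable_iff_integrableOn_Ioo_of_le hT.le).mpr hh
  refine ⟨hi, ?_⟩
  -- The extension by the end values is continuous on the line, as the convergence of mollifications
  -- requires.
  set c' := IccExtend hT.le ((Icc (0 : ℝ) T).domRestrict c) with hc'
  have hc'c : Continuous c' := hc.domRestrict.Icc_extend'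
  have hcc' : ∀ x ∈ Icc 0 T, c' x = c x := fun x hx => by
    rw [hc', IccExtend_of_mem _ _ hx]; rfl
  -- Test with plateau functions. They tend to the indicator of the interval, while their
  -- derivatives tend to a unit mass at `s` minus one at `t`.
  have key : ∀ s t, 0 < s → s < t → t < T → c t - c s = ∫ x in s..t, h x := by
    intro s t hs hst ht
    have hlim := tendsto_one_div_add_atTop_nhds_zero_nat (𝕜 := ℝ)
    have l1 := tendsto_integral_deriv_plateau hc'c s t
    rw [hcc' s ⟨hs.le, (hst.trans ht).le⟩, hcc' t ⟨(hs.trans hst).le, ht.le⟩] at l1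
    have l2 := (tendsto_integral_plateau hh hs hst ht).neg
    have l3 : (fun n => -∫ x in Ioo 0 T, plateau s t n x • h x) =ᶠ[atTop]
        fun n => ∫ x, deriv (plateau s t n) x • c' x := by
      filter_upwards [hlim.eventually_lt_const hs, hlim.eventually_lt_const (sub_pos.2 ht)]
        with n h1 h2
      have hn : tsupport (plateau s t n) ⊆ Ioo 0 T := (tsupport_plateau_subset hst.le n).trans
        (Icc_subset_Ioo (by linarith) (by linarith))
      rw [← H _ (contDiff_plateau s t n) hn]
      have h3 : ∀ x ∉ Ioo 0 T, deriv (plateau s t n) x • c' x = 0 := fun x hx => by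
        have : deriv (plateau s t n) x = 0 := by
          by_contra hne
          exact hx (hn (support_deriv_subset hne))
        rw [this, zero_smul]
      rw [← setIntegral_eq_integral_of_forall_compl_eq_zero h3]
      exact setIntegral_congr_fun measurableSet_Ioo fun x hx => by
        simp only [hcc' x (Ioo_subset_Icc_self hx)]
    have h1 := tendsto_nhds_unique l1 (l2.congr' l3)
    rw [← neg_sub, h1, neg_neg]
  set D : ℝ → ℂ := fun t => c t - ∫ x in (0 : ℝ)..t, h x with hD
  have hDc : ContinuousOn D (Icc 0 T) := ContinuousOn.sub hc (continuousOn_primitive_Icc hT.le hi)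
  have hii : ∀ r ∈ Ioo 0 T, IntervalIntegrable h volume 0 r := fun r hr =>
    hi.mono_set (by rw [uIcc_of_le hr.1.le, uIcc_of_le hT.le]; exact Icc_subset_Icc_right hr.2.le)
  have hDlt : ∀ s ∈ Ioo 0 T, ∀ t ∈ Ioo 0 T, s < t → D t = D s := fun s hs t ht hst => by
    have h1 := key s t hs.1 hst ht.2
    have h2 := intervalIntegral.integral_interval_sub_left (hii t ht) (hii s hs)
    simp only [hD]
    rw [← h2] at h1
    linear_combination h1
  have hDconst : ∀ t ∈ Ioo 0 T, D t = D (T / 2) := fun t ht => by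
    have hm : T / 2 ∈ Ioo 0 T := ⟨by linarith, by linarith⟩
    rcases lt_trichotomy t (T / 2) with h1 | h1 | h1
    · exact (hDlt t ht _ hm h1).symm
    · rw [h1]
    · exact hDlt _ hm t ht h1
  -- The plateaus must be supported inside the open interval, so the end points are reached only by
  -- continuity.
  have hDall : EqOn D (fun _ => D (T / 2)) (Icc 0 T) := by
    have : EqOn D (fun _ => D (T / 2)) (Ioo 0 T) := hDconst
    exact this.of_subset_closure hDc continuousOn_const Ioo_subset_Icc_self
      (by rw [closure_Ioo hT.ne])
  intro t ht
  have h1 := (hDall ht).trans (hDall ⟨le_rfl, hT.le⟩).symm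
  simp only [hD, intervalIntegral.integral_same, sub_zero] at h1
  rw [← h1]
  ring

end WeakDerivative

/-! ### Truncation in `H¹` and in `L⁴` -/

section Truncation

variable {d : ℕ}

lemma coeff_add (f g : L2 d) (k : Fin d → ℤ) : coeff (f + g) k = coeff f k + coeff g k := by
  simp only [← coeffCLM_apply, map_add]

lemma coeff_sub (f g : L2 d) (k : Fin d → ℤ) : coeff (f - g) k = coeff f k - coeff g k := by
  simp only [← coeffCLM_apply, map_sub]

lemma coeff_neg (f : L2 d) (k : Fin d → ℤ) : coeff (-f) k = -coeff f k := by
  simp only [← coeffCLM_apply, map_neg]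

lemma coeff_smul (c : ℂ) (f : L2 d) (k : Fin d → ℤ) : coeff (c • f) k = c * coeff f k := by
  simp only [← coeffCLM_apply, map_smul, smul_eq_mul]

lemma coeff_trigL2 (S : Finset (Fin d → ℤ)) (c : (Fin d → ℤ) → ℂ) (k : Fin d → ℤ) :
    coeff (trigL2 S c) k = if k ∈ S then c k else 0 := by
  rw [coeff_eq_fcoeff, fcoeff_congr (coeFn_trigL2 S c), fcoeff_trig]

/-- The Fourier truncation of a square integrable function. -/
def trunc (N : ℕ) (f : L2 d) : L2 d := trigL2 (box d N) (coeff f)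

lemma coeFn_trunc (N : ℕ) (f : L2 d) : trunc N f =ᵐ[volume] trig (box d N) (coeff f) :=
  coeFn_trigL2 _ _

lemma coeff_trunc (N : ℕ) (f : L2 d) (k : Fin d → ℤ) :
    coeff (trunc N f) k = if k ∈ box d N then coeff f k else 0 := coeff_trigL2 _ _ k

lemma coeff_sub_trunc (N : ℕ) (f : L2 d) (k : Fin d → ℤ) :
    coeff (f - trunc N f) k = if k ∈ box d N then 0 else coeff f k := by
  rw [coeff_sub, coeff_trunc]
  split_ifs <;> simp

lemma h1Sq_trunc (N : ℕ) (f : L2 d) :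
    h1Sq (trunc N f) = ∑ k ∈ box d N, ENNReal.ofReal (wt k) * ‖coeff f k‖ₑ ^ 2 := by
  rw [h1Sq, tsum_eq_sum (s := box d N)]
  · exact Finset.sum_congr rfl fun k hk => by rw [coeff_trunc, if_pos hk]
  · intro k hk
    simp [coeff_trunc, hk]

lemma h1Sq_trunc_le (N : ℕ) (f : L2 d) : h1Sq (trunc N f) ≤ h1Sq f :=
  (h1Sq_trunc N f).trans_le (ENNReal.sum_le_tsum _)

lemma h1Sq_sub_trunc (N : ℕ) (f : L2 d) : h1Sq (f - trunc N f) =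
    ∑' k : {k // k ∉ box d N}, ENNReal.ofReal (wt k.1) * ‖coeff f k‖ₑ ^ 2 := by
  have h := tsum_subtype {k | k ∉ box d N} fun k => ENNReal.ofReal (wt k) * ‖coeff f k‖ₑ ^ 2
  refine Eq.trans (tsum_congr fun k => ?_) h.symm
  rw [coeff_sub_trunc]
  by_cases hk : k ∈ box d N <;> simp [hk]

lemma h1Sq_sub_trunc_le (N : ℕ) (f : L2 d) : h1Sq (f - trunc N f) ≤ h1Sq f := by
  refine ENNReal.tsum_le_tsum fun k => ?_
  rw [coeff_sub_trunc]
  split_ifs <;> simp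

lemma tendsto_h1Sq_sub_trunc {f : L2 d} (hf : h1Sq f < ⊤) :
    Tendsto (fun N => h1Sq (f - trunc N f)) atTop (𝓝 0) := by
  simp only [h1Sq_sub_trunc]
  exact (ENNReal.tendsto_tsum_compl_atTop_zero hf.ne).comp tendsto_box

lemma lintegral_enorm_sq_le (f : L2 d) :
    ∫⁻ x, ‖f x‖ₑ ^ 2 ≤ ENNReal.ofReal (vol d) * h1Sq f := by
  rw [lintegral_enorm_sq_eq]
  refine mul_le_mul_right (ENNReal.tsum_le_tsum fun k => ?_) _
  exact le_mul_of_one_le_left zero_le (by simpa using one_le_wt k)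

lemma h1Sq_add_le (f g : L2 d) : h1Sq (f + g) ≤ 2 * (h1Sq f + h1Sq g) := by
  simp only [h1Sq]
  rw [← ENNReal.tsum_add, ← ENNReal.tsum_mul_left]
  refine ENNReal.tsum_le_tsum fun k => ?_
  rw [← mul_add, mul_left_comm]
  refine mul_le_mul_right ?_ _
  rw [coeff_add]
  exact (pow_le_pow_left₀ zero_le (enorm_add_le _ _) 2).trans (add_sq_le_ennreal _ _)

/-- The `L⁴` norm. -/
def norm4 (F : Torus d → ℂ) : ℝ≥0∞ := eLpNorm F 4 volume

lemma norm4_pow (F : Torus d → ℂ) : norm4 F ^ 4 = ∫⁻ x, ‖F x‖ₑ ^ 4 := by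
  rw [norm4, eLpNorm_eq_lintegral_rpow_enorm_toReal (by norm_num) (by norm_num),
    ← ENNReal.rpow_natCast, ← ENNReal.rpow_mul]
  norm_num

lemma norm4_congr {F G : Torus d → ℂ} (h : F =ᵐ[volume] G) : norm4 F = norm4 G :=
  eLpNorm_congr_ae h

lemma pow_four_rpow (z : ℝ≥0∞) : (z ^ 4) ^ (1 / 4 : ℝ) = z := by
  rw [← ENNReal.rpow_natCast, ← ENNReal.rpow_mul]
  norm_num

/-- The constant in the embedding `H¹ ⊂ L⁴` for the norms. -/
def embedConst' (d : ℕ) : ℝ≥0∞ := embedConst d ^ (1 / 4 : ℝ)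

lemma embedConst_lt_top (d : ℕ) : embedConst d < ⊤ := ENNReal.ofReal_lt_top

lemma embedConst'_lt_top (d : ℕ) : embedConst' d < ⊤ :=
  ENNReal.rpow_lt_top_of_nonneg (by norm_num) (embedConst_lt_top d).ne

lemma norm4_le (hd : d = 1 ∨ d = 2 ∨ d = 3) (f : L2 d) :
    norm4 f ≤ embedConst' d * h1Sq f ^ (1 / 2 : ℝ) := by
  rw [← pow_four_rpow (norm4 f), norm4_pow]
  calc _ ≤ (embedConst d * h1Sq f ^ 2) ^ (1 / 4 : ℝ) :=
        ENNReal.rpow_le_rpow (lintegral_pow_four_le hd f) (by norm_num)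
    _ = _ := by
        rw [ENNReal.mul_rpow_of_nonneg _ _ (by norm_num), embedConst', ← ENNReal.rpow_natCast (h1Sq f),
          ← ENNReal.rpow_mul]
        norm_num

lemma norm4_lt_top (hd : d = 1 ∨ d = 2 ∨ d = 3) {f : L2 d} (hf : h1Sq f < ⊤) : norm4 f < ⊤ :=
  (norm4_le hd f).trans_lt
    (ENNReal.mul_lt_top (embedConst'_lt_top d) (ENNReal.rpow_lt_top_of_nonneg (by norm_num) hf.ne))

lemma norm4_add_le (f g : L2 d) : norm4 (f + g : L2 d) ≤ norm4 f + norm4 g := by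
  rw [norm4_congr (Lp.coeFn_add f g)]
  exact eLpNorm_add_le (Lp.aestronglyMeasurable f) (Lp.aestronglyMeasurable g) (by norm_num)

lemma norm4_neg (f : L2 d) : norm4 (-f : L2 d) = norm4 f := by
  rw [norm4_congr (Lp.coeFn_neg f)]
  exact eLpNorm_neg _ _ _

/-- Convergence in `L⁴` is deduced from convergence in `H¹`, so no boundedness of the truncation on
`L⁴` is needed. -/
lemma tendsto_norm4_sub_trunc (hd : d = 1 ∨ d = 2 ∨ d = 3) {f : L2 d} (hf : h1Sq f < ⊤) :
    Tendsto (fun N => norm4 (f - trunc N f : L2 d)) atTop (𝓝 0) := by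
  have h : Tendsto (fun N => embedConst' d * h1Sq (f - trunc N f) ^ (1 / 2 : ℝ)) atTop (𝓝 0) := by
    have h1 := (ENNReal.continuous_rpow_const (y := (1 / 2 : ℝ))).tendsto 0
    rw [ENNReal.zero_rpow_of_pos (by norm_num)] at h1
    have h2 := ENNReal.Tendsto.const_mul (a := embedConst' d) (h1.comp (tendsto_h1Sq_sub_trunc hf))
      (Or.inr (embedConst'_lt_top d).ne)
    rwa [mul_zero] at h2
  exact tendsto_of_tendsto_of_tendsto_of_le_of_le tendsto_const_nhds h (fun _ => zero_le)
    fun N => norm4_le hd _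

lemma norm4_trunc_le (f : L2 d) (N : ℕ) :
    norm4 (trunc N f) ≤ norm4 f + norm4 (f - trunc N f : L2 d) := by
  have h : trunc N f = f + -(f - trunc N f) := by abel
  calc norm4 (trunc N f) = norm4 (f + -(f - trunc N f) : L2 d) := by rw [← h]
    _ ≤ _ := (norm4_add_le _ _).trans_eq (by rw [norm4_neg])

lemma tendsto_norm4_trunc (hd : d = 1 ∨ d = 2 ∨ d = 3) {f : L2 d} (hf : h1Sq f < ⊤) :
    Tendsto (fun N => norm4 (trunc N f)) atTop (𝓝 (norm4 f)) := by
  have h0 := tendsto_norm4_sub_trunc hd hf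
  have h1 := (tendsto_const_nhds (x := norm4 f)).add h0
  have h2 := ENNReal.Tendsto.sub (tendsto_const_nhds (x := norm4 f)) h0
    (Or.inl (norm4_lt_top hd hf).ne)
  rw [add_zero] at h1
  rw [tsub_zero] at h2
  refine tendsto_of_tendsto_of_tendsto_of_le_of_le h2 h1 (fun N => ?_) (norm4_trunc_le f)
  rw [tsub_le_iff_right]
  calc norm4 f = norm4 (trunc N f + (f - trunc N f) : L2 d) := by rw [add_sub_cancel]
    _ ≤ _ := norm4_add_le _ _

/-- The nonlinearity is locally Lipschitz from `L²` to `L¹` on bounded subsets of `L⁴`. -/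
lemma lintegral_nl_sub_nl_le (f g : L2 d) : ∫⁻ x, ‖nl (f x) - nl (g x)‖ₑ ≤
    2 * (∫⁻ x, ‖(f - g : L2 d) x‖ₑ ^ 2) ^ (1 / 2 : ℝ) *
      (2 * (norm4 f ^ 4 + norm4 g ^ 4)) ^ (1 / 2 : ℝ) := by
  have mf := (Lp.aestronglyMeasurable f).enorm
  have mg := (Lp.aestronglyMeasurable g).enorm
  have md := (Lp.aestronglyMeasurable (f - g)).enorm
  have m2 : AEMeasurable (fun x => ‖f x‖ₑ ^ 2 + ‖g x‖ₑ ^ 2) volume :=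
    (mf.pow_const 2).add (mg.pow_const 2)
  calc _ ≤ ∫⁻ x, 2 * (‖(f - g : L2 d) x‖ₑ * (‖f x‖ₑ ^ 2 + ‖g x‖ₑ ^ 2)) := by
        refine lintegral_mono_ae ?_
        filter_upwards [Lp.coeFn_sub f g] with x hx
        rw [hx, Pi.sub_apply]
        refine (enorm_nl_sub_nl_le _ _).trans ?_
        set p := ‖f x‖ₑ
        set q := ‖g x‖ₑ
        set r := ‖f x - g x‖ₑ
        have hpq : q * p ≤ p ^ 2 + q ^ 2 := by
          rcases le_total p q with h | h
          · exact (mul_le_mul_right h q).trans ((sq q).symm.le.trans le_add_self)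
          · exact (mul_le_mul_left h p).trans ((sq p).symm.le.trans le_self_add)
        calc r * p * p + q * r * p + q * q * r = r * (p ^ 2 + q * p + q ^ 2) := by ring
          _ ≤ r * (p ^ 2 + (p ^ 2 + q ^ 2) + q ^ 2) := by gcongr
          _ = _ := by ring
    _ = 2 * ∫⁻ x, ‖(f - g : L2 d) x‖ₑ * (‖f x‖ₑ ^ 2 + ‖g x‖ₑ ^ 2) :=
        lintegral_const_mul' _ _ (by norm_num)
    _ ≤ 2 * ((∫⁻ x, ‖(f - g : L2 d) x‖ₑ ^ 2) ^ (1 / 2 : ℝ) *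
        (∫⁻ x, (‖f x‖ₑ ^ 2 + ‖g x‖ₑ ^ 2) ^ 2) ^ (1 / 2 : ℝ)) := by
        gcongr
        exact lintegral_mul_le_sqrt md m2
    _ ≤ 2 * ((∫⁻ x, ‖(f - g : L2 d) x‖ₑ ^ 2) ^ (1 / 2 : ℝ) *
        (2 * (norm4 f ^ 4 + norm4 g ^ 4)) ^ (1 / 2 : ℝ)) := by
        gcongr
        rw [norm4_pow, norm4_pow, ← lintegral_add_left' (mf.pow_const 4),
          ← lintegral_const_mul' _ _ (by norm_num)]
        refine lintegral_mono fun x => (add_sq_le_ennreal _ _).trans_eq ?_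
        ring
    _ = _ := by ring

lemma lintegral_nl_le (f : L2 d) : ∫⁻ x, ‖nl (f x)‖ₑ ≤
    2 * (∫⁻ x, ‖f x‖ₑ ^ 2) ^ (1 / 2 : ℝ) * (2 * norm4 f ^ 4) ^ (1 / 2 : ℝ) := by
  have h := lintegral_nl_sub_nl_le f 0
  have h0 : norm4 (0 : L2 d) = 0 := by
    rw [norm4_congr (Lp.coeFn_zero ℂ 2 volume)]
    exact eLpNorm_zero
  rw [sub_zero, h0, zero_pow (by norm_num), add_zero] at h
  refine le_trans (lintegral_mono_ae ?_) h
  filter_upwards [Lp.coeFn_zero ℂ 2 (volume : Measure (Torus d))] with x hx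
  rw [hx]
  simp [nl]

lemma lintegral_nl_le' (hd : d = 1 ∨ d = 2 ∨ d = 3) {f : L2 d} {H : ℝ≥0∞} (hf : h1Sq f ≤ H) :
    ∫⁻ x, ‖nl (f x)‖ₑ ≤ 2 * (ENNReal.ofReal (vol d) * H) ^ (1 / 2 : ℝ) *
      (2 * (embedConst d * H ^ 2)) ^ (1 / 2 : ℝ) := by
  refine (lintegral_nl_le f).trans ?_
  rw [norm4_pow]
  gcongr
  · exact (lintegral_enorm_sq_le f).trans (by gcongr)
  · exact (lintegral_pow_four_le hd f).trans (by gcongr)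

lemma integrable_nl (hd : d = 1 ∨ d = 2 ∨ d = 3) {f : L2 d} (hf : h1Sq f < ⊤) :
    Integrable fun x => nl (f x) := by
  refine ⟨continuous_nl.comp_aestronglyMeasurable (Lp.aestronglyMeasurable f), ?_⟩
  refine (lintegral_nl_le' hd le_rfl).trans_lt ?_
  have := embedConst_lt_top d
  exact ENNReal.mul_lt_top (ENNReal.mul_lt_top (by norm_num)
    (ENNReal.rpow_lt_top_of_nonneg (by norm_num) (ENNReal.mul_lt_top (by simp) hf).ne))
    (ENNReal.rpow_lt_top_of_nonneg (by norm_num) (ENNReal.mul_lt_top (by norm_num)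
      (ENNReal.mul_lt_top this (ENNReal.pow_lt_top hf))).ne)

lemma enorm_fcoeff_le {F : Torus d → ℂ} (hF : Integrable F) (k : Fin d → ℤ) :
    ‖fcoeff F k‖ₑ ≤ ENNReal.ofReal (vol d)⁻¹ * ∫⁻ x, ‖F x‖ₑ := by
  rw [← ofReal_norm, ← ofReal_integral_norm_eq_lintegral_enorm hF,
    ← ENNReal.ofReal_mul (inv_nonneg.mpr (vol_pos d).le)]
  exact ENNReal.ofReal_le_ofReal (norm_fcoeff_le k)

/-- Convergence of the nonlinearities in `L¹` is enough for a single coefficient, and it follows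
from convergence of the truncations in `L²` with bounded `L⁴` norms. -/
lemma tendsto_fcoeff_nl (hd : d = 1 ∨ d = 2 ∨ d = 3) {f : L2 d} (hf : h1Sq f < ⊤)
    (k : Fin d → ℤ) :
    Tendsto (fun N => fcoeff (fun x => nl (trig (box d N) (coeff f) x)) k) atTop
      (𝓝 (fcoeff (fun x => nl (f x)) k)) := by
  have e : ∀ N, fcoeff (fun x => nl (trig (box d N) (coeff f) x)) k =
      fcoeff (fun x => nl (trunc N f x)) k := fun N => by
    refine fcoeff_congr ?_ k
    filter_upwards [coeFn_trunc N f] with x hx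
    rw [hx]
  simp only [e]
  have hfN : ∀ N, h1Sq (trunc N f) < ⊤ := fun N => (h1Sq_trunc_le N f).trans_lt hf
  rw [tendsto_iff_edist_tendsto_0]
  have hb : ∀ N, edist (fcoeff (fun x => nl (trunc N f x)) k) (fcoeff (fun x => nl (f x)) k) ≤
      ENNReal.ofReal (vol d)⁻¹ * (2 * (ENNReal.ofReal (vol d) * h1Sq (f - trunc N f)) ^ (1 / 2 : ℝ) *
        (2 * (embedConst d * h1Sq f ^ 2 + embedConst d * h1Sq f ^ 2)) ^ (1 / 2 : ℝ)) := fun N => by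
    rw [edist_comm, edist_eq_enorm_sub, ← fcoeff_sub (integrable_nl hd hf) (integrable_nl hd (hfN N))]
    refine (enorm_fcoeff_le ((integrable_nl hd hf).sub (integrable_nl hd (hfN N))) k).trans ?_
    refine mul_le_mul_right ((lintegral_nl_sub_nl_le _ _).trans ?_) _
    rw [norm4_pow, norm4_pow]
    gcongr
    · exact lintegral_enorm_sq_le _
    · exact lintegral_pow_four_le hd f
    · exact (lintegral_pow_four_le hd _).trans (by gcongr; exact h1Sq_trunc_le N f)
  refine tendsto_of_tendsto_of_tendsto_of_le_of_le tendsto_const_nhds ?_ (fun _ => zero_le) hb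
  have h0 := tendsto_h1Sq_sub_trunc hf
  have h1 := ENNReal.Tendsto.const_mul (a := ENNReal.ofReal (vol d)) h0 (Or.inr (by simp))
  have h2 := ((ENNReal.continuous_rpow_const (y := (1 / 2 : ℝ))).tendsto _).comp h1
  have h3 := ENNReal.Tendsto.const_mul (a := 2) h2 (Or.inr (by simp))
  have h4 := ENNReal.Tendsto.mul_const (b := (2 * (embedConst d * h1Sq f ^ 2 +
    embedConst d * h1Sq f ^ 2)) ^ (1 / 2 : ℝ)) h3 (Or.inr ?_)
  · have h5 := ENNReal.Tendsto.const_mul (a := ENNReal.ofReal (vol d)⁻¹) h4 (Or.inr (by simp))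
    simpa using h5
  · have := ENNReal.mul_lt_top (embedConst_lt_top d) (ENNReal.pow_lt_top (n := 2) hf)
    exact (ENNReal.rpow_lt_top_of_nonneg (by norm_num) (ENNReal.mul_lt_top (by norm_num)
      (ENNReal.add_lt_top.2 ⟨this, this⟩)).ne).ne

/-! ### Multiplication by the damping coefficient on `L²`, `H¹` and `L⁴` -/

lemma memLp_mul {a : Torus d → ℂ} (ha : Continuous a) (f : L2 d) : MemLp (fun x => a x * f x) 2 :=
  (Lp.memLp f).mul' (memLp_of_continuous (p := ⊤) ha)

/-- Multiplication by a continuous function on `L²`. -/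
def mulL2 (a : Torus d → ℂ) (ha : Continuous a) (f : L2 d) : L2 d := (memLp_mul ha f).toLp _

lemma coeFn_mulL2 {a : Torus d → ℂ} (ha : Continuous a) (f : L2 d) :
    mulL2 a ha f =ᵐ[volume] fun x => a x * f x := MemLp.coeFn_toLp _

lemma exists_h1Sq_mulL2_le {a : Torus d → ℂ} (ha : IsSmooth a) :
    ∃ C : ℝ≥0∞, C < ⊤ ∧ ∀ f : L2 d, h1Sq (mulL2 a ha.continuous f) ≤ C * h1Sq f := by
  obtain ⟨C, hC, h⟩ := exists_mul_smooth ha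
  refine ⟨C, hC, fun f => ?_⟩
  obtain ⟨p, hp, hle⟩ := h f
  have : mulL2 a ha.continuous f = p := Lp.ext ((coeFn_mulL2 ha.continuous f).trans hp.symm)
  rwa [this]

lemma exists_norm4_mulL2_le {a : Torus d → ℂ} (ha : Continuous a) :
    ∃ C : ℝ≥0∞, C < ⊤ ∧ ∀ f : L2 d, norm4 (mulL2 a ha f) ≤ C * norm4 f := by
  obtain ⟨M, hM⟩ := isCompact_univ.exists_bound_of_continuousOn ha.continuousOn
  refine ⟨‖M‖ₑ, enorm_lt_top, fun f => ?_⟩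
  rw [norm4_congr (coeFn_mulL2 ha f), norm4, norm4, ← eLpNorm_const_smul]
  refine eLpNorm_mono fun x => ?_
  rw [norm_mul, Pi.smul_apply, norm_smul]
  gcongr
  exact (hM x (mem_univ x)).trans (Real.le_norm_self M)

lemma coeff_mulL2 {a : Torus d → ℂ} (ha : Continuous a) (f : L2 d) (k : Fin d → ℤ) :
    (vol d : ℂ) * coeff (mulL2 a ha f) k = pairCLM (fun x => a x * character (-k) x) (by fun_prop) f := by
  rw [coeff_eq_fcoeff, vol_mul_fcoeff, pairCLM_apply]
  refine integral_congr_ae ?_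
  filter_upwards [coeFn_mulL2 ha f] with x hx
  rw [hx]
  ring

end Truncation

/-! ### The evolution of the Fourier coefficients of a solution -/

section Evolution

variable {d : ℕ} {b T : ℝ}

namespace WaveData

/-- The weighted square norm of all modes. -/
def total (W : WaveData d b) : ℝ≥0∞ := ∑' k, ENNReal.ofReal (wt k) * W.modeSq k

/-- On `[0,T]`, the Fourier coefficients of `u` are the modes of `W`, which have a finite norm. -/
structure Represents (W : WaveData d b) (T : ℝ) (u : ℝ → L2 d) : Prop where
  coeff_eq : ∀ t ∈ Icc 0 T, ∀ k, coeff (u t) k = W.mode k t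
  total_lt_top : W.total < ⊤

variable {W : WaveData d b} {u : ℝ → L2 d}

lemma Represents.h1Sq_le (h : W.Represents T u) {t : ℝ} (ht : t ∈ Icc 0 T) :
    h1Sq (u t) ≤ invMass b * W.total := by
  rw [total, ← ENNReal.tsum_mul_left]
  refine ENNReal.tsum_le_tsum fun k => ?_
  rw [h.coeff_eq t ht, mul_left_comm]
  exact mul_le_mul_right (W.enorm_mode_sq_le k t) _

lemma Represents.bound_lt_top (h : W.Represents T u) (hb : 1 / 2 < b) : invMass b * W.total < ⊤ :=
  ENNReal.mul_lt_top (invMass_lt_top hb) h.total_lt_top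

lemma Represents.h1Sq_lt_top (h : W.Represents T u) (hb : 1 / 2 < b) {t : ℝ} (ht : t ∈ Icc 0 T) :
    h1Sq (u t) < ⊤ := (h.h1Sq_le ht).trans_lt (h.bound_lt_top hb)

lemma Represents.trig_eq (h : W.Represents T u) {t : ℝ} (ht : t ∈ Icc 0 T)
    (S : Finset (Fin d → ℤ)) (x : Torus d) : trig S (coeff (u t)) x = W.wave S (t, x) :=
  Finset.sum_congr rfl fun k _ => by rw [h.coeff_eq t ht]

end WaveData

/-- The Fourier coefficients of the nonlinearity. -/
def nlCoeff (u : ℝ → L2 d) (k : Fin d → ℤ) (t : ℝ) : ℂ := fcoeff (fun x => nl (u t x)) k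

lemma stronglyMeasurable_fcoeff {F : ℝ × Torus d → ℂ} (hF : Continuous F) (k : Fin d → ℤ) :
    StronglyMeasurable fun t => fcoeff (fun x => F (t, x)) k := by
  have h : Continuous fun y : ℝ × Torus d => F y * character (-k) y.2 := by fun_prop
  have h2 : StronglyMeasurable fun t => ∫ x, F (t, x) * character (-k) x :=
    h.stronglyMeasurable.integral_prod_right' (ν := (volume : Measure (Torus d)))
  simp only [fcoeff_def]
  exact h2.const_mul _

variable {W : WaveData d b} {u : ℝ → L2 d}

/-- A pointwise limit of the coefficients for truncations, whose waves are jointly continuous in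
time and space; the values `u t` are only classes of functions and give no joint measurability
directly. -/
lemma WaveData.Represents.aestronglyMeasurable_nlCoeff (h : W.Represents T u)
    (hd : d = 1 ∨ d = 2 ∨ d = 3) (hb : 1 / 2 < b) (k : Fin d → ℤ) :
    AEStronglyMeasurable (nlCoeff u k) (volume.restrict (Ioo 0 T)) := by
  refine aestronglyMeasurable_of_tendsto_ae atTop
    (f := fun N t => fcoeff (fun x => nl (W.wave (box d N) (t, x))) k) (fun N => ?_) ?_
  · exact (stronglyMeasurable_fcoeff (continuous_nl.comp (W.continuous_wave hb _))
      k).aestronglyMeasurable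
  · filter_upwards [ae_restrict_mem measurableSet_Ioo] with t ht
    have ht' := Ioo_subset_Icc_self ht
    have := tendsto_fcoeff_nl hd (h.h1Sq_lt_top hb ht') k
    simp only [h.trig_eq ht'] at this
    exact this

lemma WaveData.Represents.integrableOn_nlCoeff (h : W.Represents T u)
    (hd : d = 1 ∨ d = 2 ∨ d = 3) (hb : 1 / 2 < b) (k : Fin d → ℤ) :
    IntegrableOn (nlCoeff u k) (Ioo 0 T) := by
  set H := invMass b * W.total with hH
  have hHt : H < ⊤ := h.bound_lt_top hb
  set C := ENNReal.ofReal (vol d)⁻¹ * (2 * (ENNReal.ofReal (vol d) * H) ^ (1 / 2 : ℝ) *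
      (2 * (embedConst d * H ^ 2)) ^ (1 / 2 : ℝ)) with hC
  have hCt : C < ⊤ := by
    have h1 := embedConst_lt_top d
    exact ENNReal.mul_lt_top (by simp) (ENNReal.mul_lt_top (ENNReal.mul_lt_top (by norm_num)
      (ENNReal.rpow_lt_top_of_nonneg (by norm_num) (ENNReal.mul_lt_top (by simp) hHt).ne))
      (ENNReal.rpow_lt_top_of_nonneg (by norm_num) (ENNReal.mul_lt_top (by norm_num)
        (ENNReal.mul_lt_top h1 (ENNReal.pow_lt_top hHt))).ne))
  refine ⟨h.aestronglyMeasurable_nlCoeff hd hb k, ?_⟩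
  refine (setLIntegral_mono (g := fun _ => C) measurable_const fun t ht => ?_).trans_lt ?_
  · have ht' := Ioo_subset_Icc_self ht
    exact (enorm_fcoeff_le (integrable_nl hd (h.h1Sq_lt_top hb ht')) k).trans
      (mul_le_mul_right (lintegral_nl_le' hd (h.h1Sq_le ht')) _)
  · rw [setLIntegral_const, Real.volume_Ioo]
    exact ENNReal.mul_lt_top hCt ENNReal.ofReal_lt_top

/-- The linear part of the right hand side of the equation, apart from the Laplacian. -/
def forcing (a : Torus d → ℂ) (ha : Continuous a) (g u : ℝ → L2 d) (t : ℝ) : L2 d :=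
  -mulL2 a ha (u t) - Complex.I • g t

lemma coeff_forcing {a : Torus d → ℂ} (ha : Continuous a) (g u : ℝ → L2 d) (t : ℝ)
    (k : Fin d → ℤ) : coeff (forcing a ha g u t) k =
      -coeff (mulL2 a ha (u t)) k - Complex.I * coeff (g t) k := by
  rw [forcing, coeff_sub, coeff_neg, coeff_smul]

lemma continuousOn_coeff_mulL2 {a : Torus d → ℂ} (ha : Continuous a)
    (hu : ContinuousOn u (Icc 0 T)) (k : Fin d → ℤ) :
    ContinuousOn (fun t => coeff (mulL2 a ha (u t)) k) (Icc 0 T) := by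
  have h0 : (vol d : ℂ) ≠ 0 := by exact_mod_cast vol_ne_zero d
  have h : ∀ t, coeff (mulL2 a ha (u t)) k =
      (vol d : ℂ)⁻¹ * pairCLM (fun x => a x * character (-k) x) (by fun_prop) (u t) := fun t => by
    rw [← coeff_mulL2 ha, inv_mul_cancel_left₀ h0]
  simp only [h]
  exact continuousOn_const.mul
    ((pairCLM (fun x => a x * character (-k) x) (by fun_prop)).continuous.comp_continuousOn hu)

lemma enorm_coeff_sq_le (f : L2 d) (k : Fin d → ℤ) : ‖coeff f k‖ₑ ^ 2 ≤ h1Sq f :=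
  (le_mul_of_one_le_left zero_le (by simpa using one_le_wt k)).trans
    (ENNReal.le_tsum (f := fun k => ENNReal.ofReal (wt k) * ‖coeff f k‖ₑ ^ 2) k)

lemma aestronglyMeasurable_coeff {g : ℝ → L2 d} {μ : Measure ℝ} (hg : AEStronglyMeasurable g μ)
    (k : Fin d → ℤ) : AEStronglyMeasurable (fun t => coeff (g t) k) μ := by
  have := (coeffCLM (d := d) k).continuous.comp_aestronglyMeasurable hg
  simpa only [coeffCLM_apply] using this

lemma aemeasurable_h1Sq {g : ℝ → L2 d} {μ : Measure ℝ} (hg : AEStronglyMeasurable g μ) :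
    AEMeasurable (fun t => h1Sq (g t)) μ :=
  AEMeasurable.tsum fun k => ((aestronglyMeasurable_coeff hg k).enorm.pow_const 2).const_mul _

lemma integrableOn_coeff {g : ℝ → L2 d} (hg : AEStronglyMeasurable g (volume.restrict (Ioo 0 T)))
    (hg2 : ∫⁻ t in Ioo 0 T, h1Sq (g t) < ⊤) (k : Fin d → ℤ) :
    IntegrableOn (fun t => coeff (g t) k) (Ioo 0 T) := by
  have h1 := aestronglyMeasurable_coeff hg k
  have h2 : MemLp (fun t => coeff (g t) k) 2 (volume.restrict (Ioo 0 T)) := by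
    refine ⟨h1, ?_⟩
    rw [eLpNorm_lt_top_iff_lintegral_rpow_enorm_lt_top (by norm_num) (by norm_num)]
    refine (lintegral_mono fun t => ?_).trans_lt hg2
    simpa using enorm_coeff_sq_le (g t) k
  exact h2.integrable (by norm_num)

/-- The time derivative of the Fourier coefficients of a solution. -/
def rate (a : Torus d → ℂ) (ha : Continuous a) (g u : ℝ → L2 d) (k : Fin d → ℤ) (t : ℝ) : ℂ :=
  -(Complex.I * (freqSq k * coeff (u t) k + nlCoeff u k t)) + coeff (forcing a ha g u t) k

lemma integrableOn_coeff_forcing {a : Torus d → ℂ} (ha : Continuous a)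
    (hu : ContinuousOn u (Icc 0 T)) {g : ℝ → L2 d}
    (hg : AEStronglyMeasurable g (volume.restrict (Ioo 0 T)))
    (hg2 : ∫⁻ t in Ioo 0 T, h1Sq (g t) < ⊤) (k : Fin d → ℤ) :
    IntegrableOn (fun t => coeff (forcing a ha g u t) k) (Ioo 0 T) := by
  simp only [coeff_forcing]
  exact ((continuousOn_coeff_mulL2 ha hu k).integrableOn_Icc.mono_set Ioo_subset_Icc_self).neg.sub
    ((integrableOn_coeff hg hg2 k).const_mul _)

lemma continuousOn_coeff (hu : ContinuousOn u (Icc 0 T)) (k : Fin d → ℤ) :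
    ContinuousOn (fun t => coeff (u t) k) (Icc 0 T) := by
  have := (coeffCLM (d := d) k).continuous.comp_continuousOn hu
  simpa only [Function.comp_def, coeffCLM_apply] using this

lemma WaveData.Represents.integrableOn_rate (h : W.Represents T u)
    (hd : d = 1 ∨ d = 2 ∨ d = 3) (hb : 1 / 2 < b) {a : Torus d → ℂ} (ha : Continuous a)
    (hu : ContinuousOn u (Icc 0 T)) {g : ℝ → L2 d}
    (hg : AEStronglyMeasurable g (volume.restrict (Ioo 0 T)))
    (hg2 : ∫⁻ t in Ioo 0 T, h1Sq (g t) < ⊤) (k : Fin d → ℤ) :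
    IntegrableOn (rate a ha g u k) (Ioo 0 T) := by
  have h1 : IntegrableOn (fun t => coeff (u t) k) (Ioo 0 T) :=
    (continuousOn_coeff hu k).integrableOn_Icc.mono_set Ioo_subset_Icc_self
  exact (((h1.const_mul _).add (h.integrableOn_nlCoeff hd hb k)).const_mul _).neg.add
    (integrableOn_coeff_forcing ha hu hg hg2 k)

lemma isTestFunction_mul_character {η : ℝ → ℝ} (hη : ContDiff ℝ ∞ η) (hs : tsupport η ⊆ Ioo 0 T)
    (k : Fin d → ℤ) : IsTestFunction T fun t x => (η t : ℂ) * character k x := by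
  refine ⟨?_, (closure_mono ?_).trans hs⟩
  · exact (Complex.ofRealCLM.contDiff.comp (hη.comp contDiff_fst)).mul
      ((isSmooth_character k).comp contDiff_snd)
  · intro t ht h0
    refine ht ?_
    funext x
    simp [h0]

/-- The Fourier coefficients of a solution are primitives of their formal derivatives. -/
lemma isPrimitive_coeff (hd : d = 1 ∨ d = 2 ∨ d = 3) (hT : 0 < T) (hb : 1 / 2 < b)
    (h : W.Represents T u) {a : Torus d → ℝ} (ha : Continuous fun x => (a x : ℂ)) {g : ℝ → L2 d}
    (hg : AEStronglyMeasurable g (volume.restrict (Ioo 0 T)))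
    (hg2 : ∫⁻ t in Ioo 0 T, h1Sq (g t) < ⊤) {s : ℝ} {u₀ : L2 d}
    (hsol : IsBourgainSolution T s b a g u₀ u) (k : Fin d → ℤ) :
    IsPrimitive T (fun t => coeff (u t) k) (rate (fun x => (a x : ℂ)) ha g u k) := by
  have hu := hsol.continuousOn
  refine isPrimitive_of_weak_deriv hT (continuousOn_coeff hu k)
    (h.integrableOn_rate hd hb ha hu hg hg2 k) fun η hη hs => ?_
  -- Testing with `η(t) e^{-ik·x}` isolates the `k`-th Fourier coefficient and leaves a weak
  -- differential equation in time.
  have heq := hsol.equation _ (isTestFunction_mul_character hη hs (-k))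
  have hv : (vol d : ℂ) ≠ 0 := by exact_mod_cast vol_ne_zero d
  have e1 : ∀ t, ∫ x, u t x * (-(Complex.I * deriv (fun r => (η r : ℂ) * character (-k) x) t)) =
      -(Complex.I * vol d) * (deriv η t • coeff (u t) k) := by
    intro t
    have hdr : ∀ x, deriv (fun r => (η r : ℂ) * character (-k) x) t =
        ((deriv η t : ℝ) : ℂ) * character (-k) x := fun x =>
      by
      have := (hη.differentiable (by simp) t).hasDerivAt.ofReal_comp
      exact (this.mul_const _).deriv
    simp only [hdr]
    rw [Complex.real_smul, coeff_eq_fcoeff]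
    have h1 := vol_mul_fcoeff (u t) k
    calc _ = ∫ x, -(Complex.I * ((deriv η t : ℝ) : ℂ)) * (u t x * character (-k) x) := by
          congr 1 with x; ring
      _ = _ := by
          rw [integral_const_mul, ← h1]
          ring
  have e2 : ∀ t ∈ Ioo 0 T, ∫ x, (-(u t x * laplacian (fun x => (η t : ℂ) * character (-k) x) x) +
      ((‖u t x‖ ^ 2 : ℝ) * u t x - Complex.I * a x * u t x + g t x) *
        ((η t : ℂ) * character (-k) x)) =
      (Complex.I * vol d) * (η t • rate (fun x => (a x : ℂ)) ha g u k t) := by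
    intro t ht
    set F := forcing (fun x => (a x : ℂ)) ha g u t with hF
    have i1 : Integrable fun x => (freqSq k : ℂ) * u t x := (integrable_L2 (u t)).const_mul _
    have i2 := integrable_nl hd (h.h1Sq_lt_top hb (Ioo_subset_Icc_self ht))
    have i12 : Integrable fun x => (freqSq k : ℂ) * u t x + nl (u t x) := i1.add i2
    have i3 : Integrable fun x => Complex.I * F x := (integrable_L2 F).const_mul _
    have h1 : ∫ x, (((freqSq k : ℂ) * u t x + nl (u t x)) + Complex.I * F x) * character (-k) x =
        vol d * (Complex.I * rate (fun x => (a x : ℂ)) ha g u k t) := by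
      rw [← vol_mul_fcoeff, fcoeff_add i12 i3, fcoeff_add i1 i2, fcoeff_const_mul,
        fcoeff_const_mul, rate, ← coeff_eq_fcoeff, ← coeff_eq_fcoeff]
      simp only [nlCoeff, ← hF]
      linear_combination (vol d : ℂ) * ((freqSq k : ℂ) * coeff (u t) k +
        fcoeff (fun x => nl (u t x)) k) * Complex.I_sq
    rw [Complex.real_smul]
    calc _ = ∫ x, (η t : ℂ) * ((((freqSq k : ℂ) * u t x + nl (u t x)) + Complex.I * F x) *
          character (-k) x) := by
          refine integral_congr_ae ?_
          filter_upwards [Lp.coeFn_sub (-mulL2 (fun x => (a x : ℂ)) ha (u t)) (Complex.I • g t),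
            Lp.coeFn_neg (mulL2 (fun x => (a x : ℂ)) ha (u t)), coeFn_mulL2 ha (u t),
            Lp.coeFn_smul Complex.I (g t)] with x h1 h2 h3 h4
          have hFx : F x = -(a x * u t x) - Complex.I * g t x := by
            rw [hF, forcing, h1, Pi.sub_apply, h2, Pi.neg_apply, h3, h4, Pi.smul_apply, smul_eq_mul]
          rw [laplacian_const_mul_character, hFx]
          have : freqSq (-k) = freqSq k := by simp [freqSq]
          rw [this, nl]
          linear_combination (η t : ℂ) * character (-k) x * g t x * Complex.I_sq
      _ = _ := by
          rw [integral_const_mul, h1]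
          ring
  have heq' : ∫ t in Ioo 0 T, -(Complex.I * vol d) * (deriv η t • coeff (u t) k) =
      ∫ t in Ioo 0 T, (Complex.I * vol d) * (η t • rate (fun x => (a x : ℂ)) ha g u k t) := by
    rw [← setIntegral_congr_fun measurableSet_Ioo e2]
    simp only [← e1]
    exact heq
  rw [integral_const_mul, integral_const_mul] at heq'
  have hI : Complex.I * (vol d : ℂ) ≠ 0 := mul_ne_zero Complex.I_ne_zero hv
  refine mul_left_cancel₀ hI ?_
  linear_combination -heq'

end Evolution

/-! ### The energy identity of a truncation -/

section EnergyIdentity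

variable {d : ℕ} {b T : ℝ}

lemma IsPrimitive.congr {E : Type*} [NormedAddCommGroup E] [NormedSpace ℝ E] {z w z' : ℝ → E}
    (h : IsPrimitive T z z') (hT : 0 ≤ T) (hzw : EqOn z w (Icc 0 T)) : IsPrimitive T w z' where
  intervalIntegrable := h.intervalIntegrable
  eq_add_integral t ht := by
    rw [← hzw ht, ← hzw ⟨le_rfl, hT⟩]
    exact h.eq_add_integral t ht

/-- The pairing of the derivative of the energy of `trig S c` with `r`. -/
def energyPairing (S : Finset (Fin d → ℤ)) (c r : (Fin d → ℤ) → ℂ) : ℂ :=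
  ∑ k ∈ S, ((wt k : ℂ) * conj (c k) + conj (fcoeff (fun x => nl (trig S c x)) k)) * r k

lemma energyPairing_add (S : Finset (Fin d → ℤ)) (c r r' : (Fin d → ℤ) → ℂ) :
    energyPairing S c (fun k => r k + r' k) = energyPairing S c r + energyPairing S c r' := by
  simp only [energyPairing, mul_add, Finset.sum_add_distrib]

lemma vol_mul_energyPairing (S : Finset (Fin d → ℤ)) (c r : (Fin d → ℤ) → ℂ) :
    (vol d : ℂ) * energyPairing S c r = (vol d : ℂ) * (∑ k ∈ S, (wt k : ℂ) * (conj (c k) * r k)) +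
      ∫ x, conj (nl (trig S c x)) * trig S r x := by
  have h := integral_conj_trig_mul (F := fun x => nl (trig S c x))
    (integrable_of_continuous (continuous_nl.comp (continuous_trig S c))) S r
  have h2 := congrArg conj h
  rw [← integral_conj] at h2
  simp only [map_mul, map_sum, Complex.conj_conj, Complex.conj_ofReal] at h2
  have e : ∀ x, trig S r x * conj (nl (trig S c x)) = conj (nl (trig S c x)) * trig S r x :=
    fun x => mul_comm _ _
  simp only [e] at h2
  rw [h2, ← mul_add, energyPairing, ← Finset.sum_add_distrib]
  congr 1
  exact Finset.sum_congr rfl fun k _ => by ring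

/-- The energy is conserved by the Hamiltonian part of the truncated equation. -/
lemma re_energyPairing_hamiltonian (S : Finset (Fin d → ℤ)) (c : (Fin d → ℤ) → ℂ) :
    (energyPairing S c fun k => -(Complex.I * (freqSq k * c k +
      fcoeff (fun x => nl (trig S c x)) k))).re = 0 := by
  set m := fcoeff fun x => nl (trig S c x) with hm
  have h := integral_conj_trig_mul (F := fun x => nl (trig S c x))
    (integrable_of_continuous (continuous_nl.comp (continuous_trig S c))) S c
  have h2 : ∀ x, conj (trig S c x) * nl (trig S c x) = ((‖trig S c x‖ ^ 4 : ℝ) : ℂ) := fun x => by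
    rw [nl, mul_left_comm, Complex.conj_mul']
    push_cast
    ring
  simp only [h2, integral_complex_ofReal, ← hm] at h
  -- Up to the volume this sum is the integral of `|trig S c|⁴`, hence real.
  have him : (∑ k ∈ S, conj (c k) * m k).im = 0 := by
    have := congrArg Complex.im h
    rw [Complex.ofReal_im, Complex.im_ofReal_mul] at this
    exact (mul_eq_zero.mp this.symm).resolve_left (vol_ne_zero d)
  -- With `F = |k|² c + m` the derivative of the energy is `F + c` and the Hamiltonian velocity is
  -- `-iF`. Their pairing is `-i (|F|² + |k|²|c|² + conj c · m)`, summed over `k`, which is `-i`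
  -- times a real number.
  have key : (energyPairing S c fun k => -(Complex.I * (freqSq k * c k + m k))) =
      -(Complex.I * ((∑ k ∈ S, (‖(freqSq k : ℂ) * c k + m k‖ ^ 2 + freqSq k * ‖c k‖ ^ 2) : ℝ) +
        ∑ k ∈ S, conj (c k) * m k)) := by
    rw [energyPairing]
    push_cast
    rw [← Finset.sum_add_distrib, Finset.mul_sum, ← Finset.sum_neg_distrib]
    refine Finset.sum_congr rfl fun k _ => ?_
    rw [← hm, ← Complex.conj_mul', ← Complex.conj_mul', wt, map_add, map_mul, Complex.conj_ofReal]
    push_cast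
    ring
  rw [key]
  simp only [Complex.neg_re, Complex.mul_re, Complex.I_re, Complex.I_im, Complex.add_im,
    Complex.ofReal_im, him]
  ring

namespace WaveData

variable (W : WaveData d b)

/-- The continuous factor is bounded on the compact slab, while the rates are merely integrable in
time. This justifies the use of Fubini's theorem in the energy identity. -/
lemma integrable_nl_wave_mul (hb : 1 / 2 < b) (S : Finset (Fin d → ℤ)) {r : (Fin d → ℤ) → ℝ → ℂ}
    {t : ℝ} (hr : ∀ k ∈ S, IntegrableOn (r k) (Ioc 0 t)) :
    Integrable (fun y : ℝ × Torus d => conj (nl (W.wave S y)) * trig S (fun k => r k y.1) y.2)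
      ((volume.restrict (Ioc 0 t)).prod volume) := by
  have hc : Continuous fun y => conj (nl (W.wave S y)) :=
    Complex.continuous_conj.comp (continuous_nl.comp (W.continuous_wave hb S))
  obtain ⟨M, hM⟩ := (isCompact_Icc.prod isCompact_univ).exists_bound_of_continuousOn
    (s := Icc 0 t ×ˢ (univ : Set (Torus d))) hc.continuousOn
  have h1 : Integrable (fun y : ℝ × Torus d => trig S (fun k => r k y.1) y.2)
      ((volume.restrict (Ioc 0 t)).prod volume) := by
    unfold trig
    exact integrable_finsetSum _ fun k hk =>
      Integrable.mul_prod (hr k hk) (integrable_of_continuous (continuous_character k))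
  refine h1.bdd_mul (c := M) hc.aestronglyMeasurable ?_
  have : (volume.restrict (Ioc 0 t)).prod (volume : Measure (Torus d)) =
      (volume.prod volume).restrict (Ioc 0 t ×ˢ univ) := by
    rw [← Measure.prod_restrict, Measure.restrict_univ]
  rw [this]
  filter_upwards [ae_restrict_mem (measurableSet_Ioc.prod MeasurableSet.univ)] with y hy
  exact hM y ⟨Ioc_subset_Icc_self hy.1, hy.2⟩

/-- The energy of a truncation as a real number. -/
def truncEnergy (S : Finset (Fin d → ℤ)) (t : ℝ) : ℝ :=
  vol d / 2 * (∑ k ∈ S, wt k * ‖W.mode k t‖ ^ 2) + 1 / 4 * ∫ x, ‖W.wave S (t, x)‖ ^ 4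

/-- The energy identity of a truncation. -/
lemma truncEnergy_eq (hT : 0 ≤ T) (hb : 1 / 2 < b) (S : Finset (Fin d → ℤ))
    {r : (Fin d → ℤ) → ℝ → ℂ} (hr : ∀ k ∈ S, IsPrimitive T (W.mode k) (r k)) {t : ℝ}
    (ht : t ∈ Icc 0 T) :
    W.truncEnergy S t = W.truncEnergy S 0 + ∫ s in (0 : ℝ)..t,
      vol d * (energyPairing S (fun k => W.mode k s) fun k => r k s).re := by
  have hrt : ∀ k ∈ S, IntegrableOn (r k) (Ioc 0 t) := fun k hk =>
    (intervalIntegrable_iff_integrableOn_Ioc_of_le ht.1).mp ((hr k hk).intervalIntegrable_of_mem ht)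
  have h1 := (IsPrimitive.sum S fun k hk => ((hr k hk).normSq hT).const_mul (wt k)).const_mul
    (vol d / 2)
  have e1 := h1.eq_add_integral t ht
  -- For fixed `x` the wave is a finite combination of the modes, so the chain rule in time applies
  -- pointwise; the integration over `x` follows by Fubini.
  have hx : ∀ x, ‖W.wave S (t, x)‖ ^ 4 = ‖W.wave S (0, x)‖ ^ 4 + ∫ s in (0 : ℝ)..t,
      4 * (conj (nl (W.wave S (s, x))) * trig S (fun k => r k s) x).re := fun x =>
    ((IsPrimitive.sum S fun k hk => (hr k hk).mul_const (character k x)).normPowFour hT).eq_add_integral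
      t ht
  have hint := W.integrable_nl_wave_mul hb S hrt
  have hint4 : Integrable (fun y : ℝ × Torus d => 4 * (conj (nl (W.wave S y)) *
      trig S (fun k => r k y.1) y.2).re) ((volume.restrict (Ioc 0 t)).prod volume) :=
    hint.re.const_mul 4
  have hcw : ∀ t, Continuous fun x => ‖W.wave S (t, x)‖ ^ 4 := fun t =>
    ((W.isSmooth_wave S t).continuous.norm).pow 4
  have e2 : ∫ x, ‖W.wave S (t, x)‖ ^ 4 = (∫ x, ‖W.wave S (0, x)‖ ^ 4) +
      ∫ s in Ioc 0 t, ∫ x, 4 * (conj (nl (W.wave S (s, x))) * trig S (fun k => r k s) x).re := by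
    rw [integral_integral_swap hint4]
    simp only [hx]
    rw [integral_add]
    · simp only [intervalIntegral.integral_of_le ht.1]
    · exact (hcw 0).integrable_of_hasCompactSupport (HasCompactSupport.of_compactSpace _)
    · simp only [intervalIntegral.integral_of_le ht.1]
      exact hint4.integral_prod_right
  have e3 : ∀ s, ∫ x, 4 * (conj (nl (W.wave S (s, x))) * trig S (fun k => r k s) x).re =
      4 * (∫ x, conj (nl (W.wave S (s, x))) * trig S (fun k => r k s) x).re := fun s => by
    rw [integral_const_mul]
    congr 1
    have hc : Continuous fun x => conj (nl (W.wave S (s, x))) * trig S (fun k => r k s) x :=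
      (Complex.continuous_conj.comp (W.isSmooth_wave S s).nl.continuous).mul (continuous_trig _ _)
    exact integral_re (integrable_of_continuous hc)
  simp only [e3] at e2
  rw [truncEnergy, truncEnergy, e1, e2, intervalIntegral.integral_of_le ht.1,
    intervalIntegral.integral_of_le ht.1]
  have i1 : IntegrableOn (fun s => vol d / 2 * ∑ k ∈ S, wt k * (2 * (conj (W.mode k s) * r k s).re))
      (Ioc 0 t) :=
    (intervalIntegrable_iff_integrableOn_Ioc_of_le ht.1).mp (h1.intervalIntegrable_of_mem ht)
  have i2 : IntegrableOn (fun s => 1 / 4 * (4 * (∫ x, conj (nl (W.wave S (s, x))) *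
      trig S (fun k => r k s) x).re)) (Ioc 0 t) := by
    have := hint4.integral_prod_left
    simp only [e3] at this
    exact this.const_mul _
  have e4 : ∀ s, vol d * (energyPairing S (fun k => W.mode k s) fun k => r k s).re =
      vol d / 2 * (∑ k ∈ S, wt k * (2 * (conj (W.mode k s) * r k s).re)) +
      1 / 4 * (4 * (∫ x, conj (nl (W.wave S (s, x))) * trig S (fun k => r k s) x).re) := fun s => by
    have := congrArg Complex.re (vol_mul_energyPairing S (fun k => W.mode k s) fun k => r k s)
    rw [Complex.re_ofReal_mul, Complex.add_re, Complex.re_ofReal_mul, Complex.re_sum] at this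
    rw [this]
    simp only [Complex.re_ofReal_mul, wave, Finset.mul_sum]
    congr 1
    · exact Finset.sum_congr rfl fun k _ => by ring
    · ring
  simp only [e4]
  rw [integral_add i1 i2, integral_const_mul (1 / 4 : ℝ)]
  ring

end WaveData

end EnergyIdentity

/-! ### The energy inequality of a truncation of a solution -/

section TruncatedInequality

variable {d : ℕ} {b T : ℝ}

lemma energyPairing_const_mul (S : Finset (Fin d → ℤ)) (c r : (Fin d → ℤ) → ℂ) (z : ℂ) :
    energyPairing S c (fun k => z * r k) = z * energyPairing S c r := by
  rw [energyPairing, energyPairing, Finset.mul_sum]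
  exact Finset.sum_congr rfl fun k _ => by ring

lemma tendsto_h1Sq_trunc (f : L2 d) : Tendsto (fun N => h1Sq (trunc N f)) atTop (𝓝 (h1Sq f)) := by
  simp only [h1Sq_trunc]
  exact (ENNReal.summable.hasSum (f := fun k => ENNReal.ofReal (wt k) * ‖coeff f k‖ₑ ^ 2)).comp
    tendsto_box

lemma energy_eq_norm4 {f : L2 d} (hf : h1Sq f < ⊤) :
    energy f = 1 / 2 * (ENNReal.ofReal (vol d) * h1Sq f) + 1 / 4 * norm4 f ^ 4 := by
  rw [energy_eq hf, norm4_pow]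

lemma energy_trunc (f : L2 d) (N : ℕ) : energy (trunc N f) =
    1 / 2 * (ENNReal.ofReal (vol d) * h1Sq (trunc N f)) + 1 / 4 * norm4 (trunc N f) ^ 4 := by
  refine energy_eq_norm4 ?_
  rw [h1Sq_trunc]
  exact ENNReal.sum_lt_top.2 fun k _ => ENNReal.mul_lt_top (by simp) (by finiteness)

lemma tendsto_energy_trunc (hd : d = 1 ∨ d = 2 ∨ d = 3) {f : L2 d} (hf : h1Sq f < ⊤) :
    Tendsto (fun N => energy (trunc N f)) atTop (𝓝 (energy f)) := by
  simp only [energy_trunc, energy_eq_norm4 hf]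
  refine (ENNReal.Tendsto.const_mul (ENNReal.Tendsto.const_mul (tendsto_h1Sq_trunc f)
    (Or.inr (by simp))) (Or.inr (by norm_num))).add (ENNReal.Tendsto.const_mul ?_
    (Or.inr (by norm_num)))
  exact ((ENNReal.continuous_pow 4).tendsto _).comp (tendsto_norm4_trunc hd hf)

namespace WaveData

variable {W : WaveData d b} {u : ℝ → L2 d}

lemma Represents.ofReal_truncEnergy (h : W.Represents T u) {t : ℝ} (ht : t ∈ Icc 0 T) (N : ℕ) :
    ENNReal.ofReal (W.truncEnergy (box d N) t) = energy (trunc N (u t)) := by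
  have h0 : ∀ k ∈ box d N, 0 ≤ wt k * ‖W.mode k t‖ ^ 2 := fun k _ =>
    mul_nonneg (wt_pos k).le (sq_nonneg _)
  have hc : Continuous fun x => ‖W.wave (box d N) (t, x)‖ ^ 4 :=
    (W.isSmooth_wave _ t).continuous.norm.pow 4
  have h4 : norm4 (trunc N (u t)) ^ 4 = ENNReal.ofReal (∫ x, ‖W.wave (box d N) (t, x)‖ ^ 4) := by
    rw [norm4_pow, ← lintegral_enorm_pow_eq]
    · refine lintegral_congr_ae ?_
      filter_upwards [coeFn_trunc N (u t)] with x hx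
      rw [hx, h.trig_eq ht]
    · exact hc.integrable_of_hasCompactSupport (HasCompactSupport.of_compactSpace _)
  rw [energy_trunc, h4, truncEnergy, h1Sq_trunc, ENNReal.ofReal_add
    (mul_nonneg (div_nonneg (vol_pos d).le (by norm_num)) (Finset.sum_nonneg h0))
    (mul_nonneg (by norm_num) (integral_nonneg fun x => by positivity)),
    ENNReal.ofReal_mul (div_nonneg (vol_pos d).le (by norm_num)),
    ENNReal.ofReal_mul (by norm_num : (0 : ℝ) ≤ 1 / 4), ENNReal.ofReal_sum_of_nonneg h0]
  simp only [ENNReal.ofReal_mul (wt_pos _).le, ofReal_norm_pow, h.coeff_eq t ht]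
  rw [div_eq_inv_mul (vol d), ENNReal.ofReal_mul (by norm_num), mul_assoc]
  have e2 : ENNReal.ofReal (2⁻¹) = 1 / 2 := by
    rw [ENNReal.ofReal_inv_of_pos (by norm_num)]; simp
  have e4 : ENNReal.ofReal (1 / 4) = 1 / 4 := by
    rw [ENNReal.ofReal_div_of_pos (by norm_num)]; simp
  rw [e2, e4]

/-- The weighted square norm of the high modes. -/
def tail (W : WaveData d b) (N : ℕ) : ℝ≥0∞ :=
  ∑' k : {k // k ∉ box d N}, ENNReal.ofReal (wt k.1) * W.modeSq k.1

lemma tendsto_tail (h : W.total < ⊤) : Tendsto W.tail atTop (𝓝 0) :=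
  (ENNReal.tendsto_tsum_compl_atTop_zero h.ne).comp tendsto_box

lemma xSq_sdiff_le (W : WaveData d b) (N M : ℕ) : W.xSq (box d M \ box d N) ≤ W.tail N := by
  have h := tsum_subtype {k | k ∉ box d N} fun k => ENNReal.ofReal (wt k) * W.modeSq k
  refine le_trans ?_ h.symm.le
  refine le_trans (Finset.sum_le_sum fun k hk => ?_) (ENNReal.sum_le_tsum (box d M \ box d N))
  rw [indicator_of_mem]
  exact (Finset.mem_sdiff.mp hk).2

lemma xSq_le_total (W : WaveData d b) (S : Finset (Fin d → ℤ)) : W.xSq S ≤ W.total :=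
  ENNReal.sum_le_tsum S

lemma measurable_energyError (W : WaveData d b) (hb : 1 / 2 < b) (S S' : Finset (Fin d → ℤ)) :
    Measurable (W.energyError S S') := by
  unfold energyError
  refine Finset.measurable_fun_sum _ fun k _ => ?_
  have h1 := (stronglyMeasurable_fcoeff (continuous_nl.comp (W.continuous_wave hb S)) k).measurable
  have h2 := (stronglyMeasurable_fcoeff (W.continuous_nlDiff hb S S') k).measurable
  have h3 := (W.continuous_mode hb k).measurable
  exact (((Complex.continuous_conj.measurable.comp h3).const_mul _).add
    (Complex.continuous_conj.measurable.comp h1)).mul h2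

/-- The error in the energy identity of a truncation of a solution. -/
def solutionError (W : WaveData d b) (u : ℝ → L2 d) (S : Finset (Fin d → ℤ)) (s : ℝ) : ℂ :=
  energyPairing S (fun k => W.mode k s)
    fun k => nlCoeff u k s - fcoeff (fun x => nl (W.wave S (s, x))) k

lemma Represents.tendsto_energyError (h : W.Represents T u) (hd : d = 1 ∨ d = 2 ∨ d = 3)
    (hb : 1 / 2 < b) (S : Finset (Fin d → ℤ)) {s : ℝ} (hs : s ∈ Icc 0 T) :
    Tendsto (fun M => W.energyError S (box d M) s) atTop (𝓝 (W.solutionError u S s)) := by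
  refine tendsto_finsetSum _ fun k _ => Tendsto.const_mul _ ?_
  have h1 := tendsto_fcoeff_nl hd (h.h1Sq_lt_top hb hs) k
  simp only [h.trig_eq hs] at h1
  have hi : ∀ S, Integrable fun x => nl (W.wave S (s, x)) := fun S =>
    integrable_of_continuous (W.isSmooth_wave S s).nl.continuous
  refine (h1.sub_const (fcoeff (fun x => nl (W.wave S (s, x))) k)).congr fun M => ?_
  rw [← fcoeff_sub (hi _) (hi _)]
  rfl

/-- Fatou's lemma in the outer truncation `M`: for `M ≥ N` the error between two truncations is
bounded uniformly in `M` by the tail beyond `N`. -/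
lemma Represents.lintegral_solutionError_le (h : W.Represents T u) (hd : d = 1 ∨ d = 2 ∨ d = 3)
    (hb : 1 / 2 < b) (N : ℕ) :
    ENNReal.ofReal (vol d) * ∫⁻ s in Ioo 0 T, ‖W.solutionError u (box d N) s‖ₑ ≤
      errorConst d T b W.total * W.tail N ^ (1 / 2 : ℝ) := by
  have hlim : ∀ᵐ s ∂(volume.restrict (Ioo 0 T)), ENNReal.ofReal (vol d) *
      ‖W.solutionError u (box d N) s‖ₑ = liminf (fun M => ENNReal.ofReal (vol d) *
        ‖W.energyError (box d N) (box d M) s‖ₑ) atTop := by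
    filter_upwards [ae_restrict_mem measurableSet_Ioo] with s hs
    exact (ENNReal.Tendsto.const_mul (h.tendsto_energyError hd hb _ (Ioo_subset_Icc_self hs)).enorm
      (Or.inr (by simp))).liminf_eq.symm
  rw [← lintegral_const_mul' _ _ ENNReal.ofReal_ne_top, lintegral_congr_ae hlim]
  refine (lintegral_liminf_le fun M =>
    ((W.measurable_energyError hb _ _).enorm.const_mul _)).trans ?_
  refine liminf_le_of_frequently_le' (Eventually.frequently ?_)
  filter_upwards [eventually_ge_atTop N] with M hM
  rw [lintegral_const_mul' _ _ ENNReal.ofReal_ne_top]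
  refine (W.lintegral_energyError_le hd hb T (box_mono hM) (W.xSq_le_total _)).trans ?_
  exact mul_le_mul_right (ENNReal.rpow_le_rpow (W.xSq_sdiff_le N M) (by norm_num)) _

/-- The energy inequality of a truncation of a solution. -/
lemma Represents.energy_trunc_le (h : W.Represents T u) (hd : d = 1 ∨ d = 2 ∨ d = 3)
    (hb : 1 / 2 < b) (hT : 0 ≤ T) {a : Torus d → ℂ} (ha : Continuous a)
    (hu : ContinuousOn u (Icc 0 T)) {g : ℝ → L2 d}
    (hg : AEStronglyMeasurable g (volume.restrict (Ioo 0 T)))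
    (hg2 : ∫⁻ t in Ioo 0 T, h1Sq (g t) < ⊤)
    (hprim : ∀ k, IsPrimitive T (fun t => coeff (u t) k) (rate a ha g u k)) {t : ℝ}
    (ht : t ∈ Icc 0 T) (N : ℕ) :
    energy (trunc N (u t)) ≤ energy (trunc N (u 0)) +
      ((∫⁻ s in Ioo 0 t, ‖(vol d : ℂ) * energyPairing (box d N) (coeff (u s))
        (coeff (forcing a ha g u s))‖ₑ) + errorConst d T b W.total * W.tail N ^ (1 / 2 : ℝ)) := by
  set S := box d N with hS
  have hpr : ∀ k ∈ S, IsPrimitive T (W.mode k) (rate a ha g u k) := fun k _ =>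
    (hprim k).congr hT fun t ht => h.coeff_eq t ht k
  have key := W.truncEnergy_eq hT hb S hpr ht
  have hbd : ∀ s ∈ Ioo 0 t, ‖vol d * (energyPairing S (fun k => W.mode k s)
      fun k => rate a ha g u k s).re‖ₑ ≤ ENNReal.ofReal (vol d) * ‖W.solutionError u S s‖ₑ +
      ‖(vol d : ℂ) * energyPairing S (coeff (u s)) (coeff (forcing a ha g u s))‖ₑ := by
    intro s hs
    have hsT : s ∈ Icc 0 T := ⟨hs.1.le, hs.2.le.trans ht.2⟩
    have hc : coeff (u s) = fun k => W.mode k s := funext fun k => h.coeff_eq s hsT k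
    -- The rate splits into the Hamiltonian velocity of the truncated equation, the mismatch between
    -- the nonlinearity of the solution and that of its truncation, and the linear forcing. Only the
    -- last two change the energy.
    have e : (energyPairing S (fun k => W.mode k s) fun k => rate a ha g u k s) =
        (energyPairing S (fun k => W.mode k s) fun k => -(Complex.I * (freqSq k * W.mode k s +
          fcoeff (fun x => nl (trig S (fun k => W.mode k s) x)) k))) +
        -Complex.I * W.solutionError u S s +
        energyPairing S (fun k => W.mode k s) (coeff (forcing a ha g u s)) := by
      rw [solutionError, ← energyPairing_const_mul, ← energyPairing_add, ← energyPairing_add]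
      congr 1
      funext k
      rw [rate, hc]
      simp only [wave]
      ring
    rw [e, Complex.add_re, Complex.add_re, re_energyPairing_hamiltonian, zero_add, ← hc, mul_add]
    refine (enorm_add_le _ _).trans (add_le_add ?_ ?_)
    · rw [enorm_mul, ← ofReal_norm, Real.norm_of_nonneg (vol_pos d).le]
      refine mul_le_mul_right ?_ _
      rw [← ofReal_norm, ← ofReal_norm]
      refine ENNReal.ofReal_le_ofReal ((Complex.abs_re_le_norm _).trans_eq ?_)
      rw [norm_mul, norm_neg, Complex.norm_I, one_mul]
    · rw [← Complex.re_ofReal_mul, ← ofReal_norm, ← ofReal_norm]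
      exact ENNReal.ofReal_le_ofReal (Complex.abs_re_le_norm _)
  have hm : AEMeasurable (fun s => ‖(vol d : ℂ) * energyPairing S (coeff (u s))
      (coeff (forcing a ha g u s))‖ₑ) (volume.restrict (Ioo 0 t)) := by
    have hsub : volume.restrict (Ioo 0 t) ≤ volume.restrict (Ioo 0 T) :=
      Measure.restrict_mono (Ioo_subset_Ioo_right ht.2) le_rfl
    have h1 : AEStronglyMeasurable (fun s => energyPairing S (fun k => W.mode k s)
        (coeff (forcing a ha g u s))) (volume.restrict (Ioo 0 t)) := by
      unfold energyPairing
      refine Finset.aestronglyMeasurable_fun_sum _ fun k _ => ?_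
      have m1 := (stronglyMeasurable_fcoeff (continuous_nl.comp (W.continuous_wave hb S)) k)
      have m2 := ((integrableOn_coeff_forcing ha hu hg hg2 k).aestronglyMeasurable).mono_measure hsub
      have m3 := (W.continuous_mode hb k)
      exact (((continuous_const.mul (Complex.continuous_conj.comp m3)).aestronglyMeasurable.add
        (Complex.continuous_conj.comp_stronglyMeasurable m1).aestronglyMeasurable)).mul m2
    refine ((h1.const_mul (vol d : ℂ)).enorm).congr ?_
    filter_upwards [ae_restrict_mem measurableSet_Ioo] with s hs
    have hsT : s ∈ Icc 0 T := ⟨hs.1.le, hs.2.le.trans ht.2⟩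
    have hc : coeff (u s) = fun k => W.mode k s := funext fun k => h.coeff_eq s hsT k
    rw [hc]
  rw [← h.ofReal_truncEnergy ht, ← h.ofReal_truncEnergy ⟨le_rfl, hT⟩, key]
  refine ENNReal.ofReal_add_le.trans (add_le_add le_rfl ?_)
  rw [intervalIntegral.integral_of_le ht.1, integral_Ioc_eq_integral_Ioo]
  calc _ ≤ ‖∫ s in Ioo 0 t, vol d * (energyPairing S (fun k => W.mode k s)
        fun k => rate a ha g u k s).re‖ₑ := by
        rw [← ofReal_norm]; exact ENNReal.ofReal_le_ofReal (Real.le_norm_self _)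
    _ ≤ ∫⁻ s in Ioo 0 t, ‖vol d * (energyPairing S (fun k => W.mode k s)
        fun k => rate a ha g u k s).re‖ₑ := enorm_integral_le_lintegral_enorm _
    _ ≤ ∫⁻ s in Ioo 0 t, (ENNReal.ofReal (vol d) * ‖W.solutionError u S s‖ₑ +
        ‖(vol d : ℂ) * energyPairing S (coeff (u s)) (coeff (forcing a ha g u s))‖ₑ) :=
        setLIntegral_mono' measurableSet_Ioo hbd
    _ = (ENNReal.ofReal (vol d) * ∫⁻ s in Ioo 0 t, ‖W.solutionError u S s‖ₑ) +
        ∫⁻ s in Ioo 0 t,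
          ‖(vol d : ℂ) * energyPairing S (coeff (u s)) (coeff (forcing a ha g u s))‖ₑ := by
        rw [lintegral_add_right' _ hm, lintegral_const_mul' _ _ ENNReal.ofReal_ne_top]
    _ ≤ _ := by
        rw [add_comm]
        refine add_le_add le_rfl (le_trans ?_ (h.lintegral_solutionError_le hd hb N))
        exact mul_le_mul_right (lintegral_mono_set (Ioo_subset_Ioo_right ht.2)) _

end WaveData

end TruncatedInequality

/-! ### The energy inequality of a solution -/

section EnergyInequality

variable {d : ℕ} {b T : ℝ}

lemma norm4_eq (F : Torus d → ℂ) : norm4 F = (∫⁻ x, ‖F x‖ₑ ^ 4) ^ (1 / 4 : ℝ) := by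
  rw [← norm4_pow, pow_four_rpow]

lemma lintegral_cube_mul_le {F G : Torus d → ℂ} (hF : Continuous F) (hG : Continuous G) :
    ∫⁻ x, ‖F x‖ₑ ^ 3 * ‖G x‖ₑ ≤ norm4 F ^ 3 * norm4 G := by
  have hpq : Real.HolderConjugate (4 / 3) 4 := by
    rw [Real.holderConjugate_iff]; norm_num
  have h := ENNReal.lintegral_mul_le_Lp_mul_Lq volume hpq
    (hF.measurable.enorm.pow_const 3).aemeasurable hG.measurable.enorm.aemeasurable
  refine h.trans_eq ?_
  have e : ∀ z : ℝ≥0∞, (z ^ 3) ^ (4 / 3 : ℝ) = z ^ 4 := fun z => by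
    rw [← ENNReal.rpow_natCast, ← ENNReal.rpow_mul, ← ENNReal.rpow_natCast]
    norm_num
  simp only [e, ENNReal.rpow_ofNat]
  rw [norm4_eq, norm4_eq, ← ENNReal.rpow_natCast (_ ^ (1 / 4 : ℝ)), ← ENNReal.rpow_mul]
  norm_num

lemma enorm_sum_wt_le (S : Finset (Fin d → ℤ)) (f F : L2 d) :
    ‖∑ k ∈ S, (wt k : ℂ) * (conj (coeff f k) * coeff F k)‖ₑ ≤
      h1Sq f ^ (1 / 2 : ℝ) * h1Sq F ^ (1 / 2 : ℝ) := by
  set r : (Fin d → ℤ) → ℝ≥0∞ := fun k => ENNReal.ofReal (wt k) ^ (1 / 2 : ℝ)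
  have hr : ∀ k, ‖(wt k : ℂ)‖ₑ = r k * r k := fun k => by
    rw [sqrt_mul_self_ennreal, ← ofReal_norm, Complex.norm_real, Real.norm_of_nonneg (wt_pos k).le]
  have h := ENNReal.inner_le_Lp_mul_Lq S (fun k => r k * ‖coeff f k‖ₑ) (fun k => r k * ‖coeff F k‖ₑ)
    Real.HolderConjugate.two_two
  simp only [ENNReal.rpow_ofNat, mul_pow, sq (r _), r, sqrt_mul_self_ennreal] at h
  calc _ ≤ ∑ k ∈ S, r k * ‖coeff f k‖ₑ * (r k * ‖coeff F k‖ₑ) := by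
        refine (enorm_sum_le _ _).trans (Finset.sum_le_sum fun k _ => ?_)
        rw [enorm_mul, enorm_mul, enorm_conj, hr]
        exact le_of_eq (by ring)
    _ ≤ _ := by
        refine h.trans ?_
        gcongr <;> exact ENNReal.sum_le_tsum S

lemma enorm_energyPairing_le (N : ℕ) (f F : L2 d) :
    ‖(vol d : ℂ) * energyPairing (box d N) (coeff f) (coeff F)‖ₑ ≤
      ENNReal.ofReal (vol d) * (h1Sq f ^ (1 / 2 : ℝ) * h1Sq F ^ (1 / 2 : ℝ)) +
        norm4 (trunc N f) ^ 3 * norm4 (trunc N F) := by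
  rw [vol_mul_energyPairing]
  refine (enorm_add_le _ _).trans (add_le_add ?_ ?_)
  · rw [enorm_mul, ← ofReal_norm (vol d : ℂ), Complex.norm_real, Real.norm_of_nonneg (vol_pos d).le]
    exact mul_le_mul_right (enorm_sum_wt_le _ f F) _
  · rw [norm4_congr (coeFn_trunc N f), norm4_congr (coeFn_trunc N F)]
    refine (enorm_integral_le_lintegral_enorm _).trans
      (le_trans (le_of_eq (lintegral_congr fun x => ?_))
        (lintegral_cube_mul_le (continuous_trig _ _) (continuous_trig _ _)))
    rw [enorm_mul, enorm_conj, enorm_nl]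

lemma trunc_forcing (N : ℕ) (v w : L2 d) :
    trunc N (-v - Complex.I • w) = -trunc N v + -(Complex.I • trunc N w) := by
  refine ext_coeff fun k => ?_
  rw [coeff_trunc, coeff_sub, coeff_neg, coeff_smul, coeff_add, coeff_neg, coeff_neg, coeff_smul,
    coeff_trunc, coeff_trunc]
  split_ifs <;> ring

lemma norm4_smul_I (f : L2 d) : norm4 (Complex.I • f : L2 d) = norm4 f := by
  rw [norm4_congr (Lp.coeFn_smul Complex.I f), norm4, eLpNorm_const_smul]
  simp [norm4, ← ofReal_norm]

/-- The damping term `v` must be kept in `L⁴`: against a cube in `L⁴` it then gives a multiple of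
the energy `G`, whereas a bound through `H¹` would give `G^{5/4}`, too much for a global Gronwall
argument. The embedding is applied only to its truncation remainder, which vanishes in the limit,
and to the forcing `w`. -/
lemma norm4_trunc_forcing_le (hd : d = 1 ∨ d = 2 ∨ d = 3) (N : ℕ) (v w : L2 d) :
    norm4 (trunc N (-v - Complex.I • w)) ≤ norm4 v +
      embedConst' d * h1Sq (v - trunc N v) ^ (1 / 2 : ℝ) +
      embedConst' d * h1Sq w ^ (1 / 2 : ℝ) := by
  rw [trunc_forcing]
  refine (norm4_add_le _ _).trans (add_le_add ?_ ?_)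
  · rw [norm4_neg]
    exact (norm4_trunc_le v N).trans (add_le_add le_rfl (norm4_le hd _))
  · rw [norm4_neg, norm4_smul_I]
    exact (norm4_le hd _).trans (mul_le_mul_right
      (ENNReal.rpow_le_rpow (h1Sq_trunc_le N w) (by norm_num)) _)

lemma h1Sq_forcing_le (v w : L2 d) : h1Sq (-v - Complex.I • w) ≤ 2 * (h1Sq v + h1Sq w) := by
  have h1 : h1Sq (-v) = h1Sq v := by simp only [h1Sq, coeff_neg, enorm_neg]
  have h2 : h1Sq (-(Complex.I • w)) = h1Sq w := by
    simp only [h1Sq, coeff_neg, enorm_neg, coeff_smul, enorm_mul]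
    simp [← ofReal_norm Complex.I]
  rw [sub_eq_add_neg]
  exact (h1Sq_add_le _ _).trans_eq (by rw [h1, h2])

lemma rpow_half_le_one_add (z : ℝ≥0∞) : z ^ (1 / 2 : ℝ) ≤ 1 + z := by
  rcases le_total z 1 with h | h
  · exact (ENNReal.rpow_le_one h (by norm_num)).trans le_self_add
  · calc z ^ (1 / 2 : ℝ) ≤ z ^ (1 : ℝ) := ENNReal.rpow_le_rpow_of_exponent_le h (by norm_num)
      _ ≤ _ := by rw [ENNReal.rpow_one]; exact le_add_self

lemma aemeasurable_h1Sq_of_coeff {F : ℝ → L2 d} {μ : Measure ℝ}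
    (h : ∀ k, AEStronglyMeasurable (fun t => coeff (F t) k) μ) :
    AEMeasurable (fun t => h1Sq (F t)) μ :=
  AEMeasurable.tsum fun k => ((h k).enorm.pow_const 2).const_mul _

/-- The bound for the production rate of the energy: `m₁`, `m₄` are bounds for the multiplication
by the damping coefficient on `H¹` and on `L⁴`, and `η` is a truncation error. -/
def production (d : ℕ) (m₁ m₄ h n ν γ η : ℝ≥0∞) : ℝ≥0∞ :=
  ENNReal.ofReal (vol d) * (h ^ (1 / 2 : ℝ) * (2 * (m₁ * h + γ)) ^ (1 / 2 : ℝ)) +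
    ν ^ 3 * (m₄ * n + embedConst' d * η ^ (1 / 2 : ℝ) + embedConst' d * γ ^ (1 / 2 : ℝ))

/-- A majorant affine in `γ`, obtained from `√z ≤ 1 + z`. It is integrable in time when `γ` is, and
serves in the dominated convergence as the truncation is removed. -/
lemma production_le {m₁ m₄ h n ν γ η h' n' ν' η' : ℝ≥0∞} (hh : h ≤ h') (hn : n ≤ n') (hν : ν ≤ ν')
    (hη : η ≤ η') : production d m₁ m₄ h n ν γ η ≤
      (ENNReal.ofReal (vol d) * (h' ^ (1 / 2 : ℝ) * (1 + 2 * (m₁ * h'))) +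
        ν' ^ 3 * (m₄ * n' + embedConst' d * η' ^ (1 / 2 : ℝ) + embedConst' d)) +
      (ENNReal.ofReal (vol d) * (h' ^ (1 / 2 : ℝ) * 2) + ν' ^ 3 * embedConst' d) * γ := by
  calc _ ≤ ENNReal.ofReal (vol d) * (h' ^ (1 / 2 : ℝ) * (1 + 2 * (m₁ * h' + γ))) +
        ν' ^ 3 * (m₄ * n' + embedConst' d * η' ^ (1 / 2 : ℝ) + embedConst' d * (1 + γ)) := by
        unfold production
        gcongr
        · exact (ENNReal.rpow_le_rpow (by gcongr) (by norm_num)).trans (rpow_half_le_one_add _)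
        · exact rpow_half_le_one_add γ
    _ = _ := by ring

namespace WaveData

variable {W : WaveData d b} {u : ℝ → L2 d}

lemma Represents.aemeasurable_norm4_trunc (h : W.Represents T u) (hb : 1 / 2 < b) (N : ℕ) :
    AEMeasurable (fun s => norm4 (trunc N (u s))) (volume.restrict (Ioo 0 T)) := by
  have m : Measurable fun s => (∫⁻ x, ‖W.wave (box d N) (s, x)‖ₑ ^ 4) ^ (1 / 4 : ℝ) :=
    (((W.continuous_wave hb (box d N)).measurable.enorm.pow_const 4).lintegral_prod_right'
      (ν := (volume : Measure (Torus d)))).pow_const _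
  refine m.aemeasurable.congr ?_
  filter_upwards [ae_restrict_mem measurableSet_Ioo] with s hs
  rw [norm4_congr (coeFn_trunc N (u s)), norm4_eq]
  simp only [h.trig_eq (Ioo_subset_Icc_self hs)]

lemma Represents.aemeasurable_norm4 (h : W.Represents T u) (hd : d = 1 ∨ d = 2 ∨ d = 3)
    (hb : 1 / 2 < b) :
    AEMeasurable (fun s => norm4 (u s)) (volume.restrict (Ioo 0 T)) := by
  refine aemeasurable_of_tendsto_metrizable_ae' (h.aemeasurable_norm4_trunc hb) ?_
  filter_upwards [ae_restrict_mem measurableSet_Ioo] with s hs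
  exact tendsto_norm4_trunc hd (h.h1Sq_lt_top hb (Ioo_subset_Icc_self hs))

/-- The energy inequality of a solution. -/
lemma Represents.energy_le (h : W.Represents T u) (hd : d = 1 ∨ d = 2 ∨ d = 3)
    (hb : 1 / 2 < b) (hT : 0 ≤ T) {a : Torus d → ℂ} (ha : Continuous a) {m₁ m₄ : ℝ≥0∞}
    (hm₁t : m₁ < ⊤) (hm₄t : m₄ < ⊤) (hm₁ : ∀ f, h1Sq (mulL2 a ha f) ≤ m₁ * h1Sq f)
    (hm₄ : ∀ f, norm4 (mulL2 a ha f) ≤ m₄ * norm4 f)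
    (hu : ContinuousOn u (Icc 0 T)) {g : ℝ → L2 d}
    (hg : AEStronglyMeasurable g (volume.restrict (Ioo 0 T)))
    (hg2 : ∫⁻ t in Ioo 0 T, h1Sq (g t) < ⊤)
    (hprim : ∀ k, IsPrimitive T (fun t => coeff (u t) k) (rate a ha g u k)) {t : ℝ}
    (ht : t ∈ Icc 0 T) :
    energy (u t) ≤ energy (u 0) + ∫⁻ s in Ioo 0 t,
      production d m₁ m₄ (h1Sq (u s)) (norm4 (u s)) (norm4 (u s)) (h1Sq (g s)) 0 := by
  have hsub : volume.restrict (Ioo 0 t) ≤ volume.restrict (Ioo 0 T) :=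
    Measure.restrict_mono (Ioo_subset_Ioo_right ht.2) le_rfl
  have hIcc : ∀ s ∈ Ioo 0 t, s ∈ Icc 0 T := fun s hs => ⟨hs.1.le, hs.2.le.trans ht.2⟩
  set δ : ℕ → ℝ → ℝ≥0∞ := fun N s => h1Sq (mulL2 a ha (u s) - trunc N (mulL2 a ha (u s))) with hδ
  set Ψ : ℕ → ℝ → ℝ≥0∞ := fun N s => production d m₁ m₄ (h1Sq (u s)) (norm4 (u s))
    (norm4 (trunc N (u s))) (h1Sq (g s)) (δ N s) with hΨ
  have hle : ∀ N, energy (trunc N (u t)) ≤ energy (trunc N (u 0)) + ((∫⁻ s in Ioo 0 t, Ψ N s) +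
      errorConst d T b W.total * W.tail N ^ (1 / 2 : ℝ)) := fun N => by
    refine (h.energy_trunc_le hd hb hT ha hu hg hg2 hprim ht N).trans ?_
    refine add_le_add le_rfl (add_le_add (lintegral_mono fun s => ?_) le_rfl)
    refine (enorm_energyPairing_le N _ _).trans ?_
    simp only [hΨ, production, forcing]
    gcongr
    · exact (h1Sq_forcing_le _ _).trans (by gcongr; exact hm₁ _)
    · exact (norm4_trunc_forcing_le hd N _ _).trans (by gcongr; exact hm₄ _)
  -- This uniform bound on `H¹` norms depends on `b` and on the solution. It enters only the
  -- dominating function and so leaves no trace in the limit inequality.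
  set H := invMass b * W.total with hH
  have hHt : H < ⊤ := h.bound_lt_top hb
  have hmh : AEMeasurable (fun s => h1Sq (u s)) (volume.restrict (Ioo 0 t)) :=
    (aemeasurable_h1Sq_of_coeff fun k => ((continuousOn_coeff hu k).aestronglyMeasurable
      measurableSet_Icc)).mono_measure (Measure.restrict_mono hIcc le_rfl)
  have hmγ := (aemeasurable_h1Sq hg).mono_measure hsub
  have hmn := (h.aemeasurable_norm4 hd hb).mono_measure hsub
  have hmν := fun N => (h.aemeasurable_norm4_trunc hb N).mono_measure hsub
  have hmδ : ∀ N, AEMeasurable (δ N) (volume.restrict (Ioo 0 t)) := fun N => by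
    refine (aemeasurable_h1Sq_of_coeff fun k => ?_).mono_measure (Measure.restrict_mono hIcc le_rfl)
    simp only [coeff_sub_trunc]
    split_ifs
    · exact aestronglyMeasurable_const
    · exact (continuousOn_coeff_mulL2 ha hu k).aestronglyMeasurable measurableSet_Icc
  have hmΨ : ∀ N, AEMeasurable (Ψ N) (volume.restrict (Ioo 0 t)) := fun N =>
    ((hmh.pow_const _).mul ((((hmh.const_mul _).add hmγ).const_mul _).pow_const _)).const_mul _ |>.add
      (((hmν N).pow_const 3).mul (((hmn.const_mul _).add (((hmδ N).pow_const _).const_mul _)).add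
        ((hmγ.pow_const _).const_mul _)))
  have hlim : Tendsto (fun N => ∫⁻ s in Ioo 0 t, Ψ N s) atTop (𝓝 (∫⁻ s in Ioo 0 t,
      production d m₁ m₄ (h1Sq (u s)) (norm4 (u s)) (norm4 (u s)) (h1Sq (g s)) 0)) := by
    set η := embedConst' d * H ^ (1 / 2 : ℝ) with hη
    have hr : ∀ z : ℝ≥0∞, z < ⊤ → z ^ (1 / 2 : ℝ) < ⊤ := fun z hz =>
      ENNReal.rpow_lt_top_of_nonneg (by norm_num) hz.ne
    have hKt := embedConst'_lt_top d
    have hηt : η < ⊤ := ENNReal.mul_lt_top hKt (hr _ hHt)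
    have hHm : m₁ * H < ⊤ := ENNReal.mul_lt_top hm₁t hHt
    have hn : ∀ s ∈ Ioo 0 t, norm4 (u s) ≤ η := fun s hs => (norm4_le hd _).trans
      (mul_le_mul_right (ENNReal.rpow_le_rpow (h.h1Sq_le (hIcc s hs)) (by norm_num)) _)
    refine tendsto_lintegral_of_dominated_convergence' (fun s =>
      (ENNReal.ofReal (vol d) * (H ^ (1 / 2 : ℝ) * (1 + 2 * (m₁ * H))) +
        η ^ 3 * (m₄ * η + embedConst' d * (m₁ * H) ^ (1 / 2 : ℝ) + embedConst' d)) +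
      (ENNReal.ofReal (vol d) * (H ^ (1 / 2 : ℝ) * 2) + η ^ 3 * embedConst' d) * h1Sq (g s))
      hmΨ (fun N => ?_) ?_ ?_
    · filter_upwards [ae_restrict_mem measurableSet_Ioo] with s hs
      refine production_le (h.h1Sq_le (hIcc s hs)) (hn s hs) ?_ ?_
      · exact (norm4_le hd _).trans (mul_le_mul_right (ENNReal.rpow_le_rpow
          ((h1Sq_trunc_le N _).trans (h.h1Sq_le (hIcc s hs))) (by norm_num)) _)
      · exact (h1Sq_sub_trunc_le N _).trans ((hm₁ _).trans
          (mul_le_mul_right (h.h1Sq_le (hIcc s hs)) _))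
    · refine ne_of_lt ?_
      rw [lintegral_add_left measurable_const, setLIntegral_const, lintegral_const_mul'']
      · have h1 := (hr _ hHt)
        have h2 := (hr _ hHm)
        have h3 := ENNReal.pow_lt_top (n := 3) hηt
        have h4 : 1 + 2 * (m₁ * H) < ⊤ := ENNReal.add_lt_top.2
          ⟨by norm_num, ENNReal.mul_lt_top (by norm_num) hHm⟩
        refine ENNReal.add_lt_top.2 ⟨ENNReal.mul_lt_top (ENNReal.add_lt_top.2
          ⟨ENNReal.mul_lt_top ENNReal.ofReal_lt_top (ENNReal.mul_lt_top h1 h4),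
            ENNReal.mul_lt_top h3 (ENNReal.add_lt_top.2 ⟨ENNReal.add_lt_top.2
              ⟨ENNReal.mul_lt_top hm₄t hηt, ENNReal.mul_lt_top hKt h2⟩, hKt⟩)⟩) (by simp),
          ENNReal.mul_lt_top (ENNReal.add_lt_top.2 ⟨ENNReal.mul_lt_top ENNReal.ofReal_lt_top
            (ENNReal.mul_lt_top h1 (by norm_num)), ENNReal.mul_lt_top h3 hKt⟩)
            ((lintegral_mono' hsub le_rfl).trans_lt hg2)⟩
      · exact hmγ
    · filter_upwards [ae_restrict_mem measurableSet_Ioo, ae_lt_top' hmγ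
        ((lintegral_mono' hsub le_rfl).trans_lt hg2).ne] with s hs hγ
      have hus := h.h1Sq_lt_top hb (hIcc s hs)
      have hvs : h1Sq (mulL2 a ha (u s)) < ⊤ := (hm₁ _).trans_lt (ENNReal.mul_lt_top hm₁t hus)
      have hnt := norm4_lt_top hd hus
      have l1 : Tendsto (fun N => norm4 (trunc N (u s)) ^ 3) atTop (𝓝 (norm4 (u s) ^ 3)) :=
        ((ENNReal.continuous_pow 3).tendsto _).comp (tendsto_norm4_trunc hd hus)
      have l2 : Tendsto (fun N => δ N s ^ (1 / 2 : ℝ)) atTop (𝓝 (0 ^ (1 / 2 : ℝ))) :=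
        ((ENNReal.continuous_rpow_const (y := (1 / 2 : ℝ))).tendsto _).comp
          (tendsto_h1Sq_sub_trunc hvs)
      have l3 := ENNReal.Tendsto.const_mul (a := embedConst' d) l2 (Or.inr hKt.ne)
      have l4 := ((tendsto_const_nhds (x := m₄ * norm4 (u s))).add l3).add
        (tendsto_const_nhds (x := embedConst' d * h1Sq (g s) ^ (1 / 2 : ℝ)))
      refine tendsto_const_nhds.add (ENNReal.Tendsto.mul l1 (Or.inr ?_) l4
        (Or.inr (ENNReal.pow_lt_top hnt).ne))
      refine (ENNReal.add_lt_top.2 ⟨ENNReal.add_lt_top.2 ⟨ENNReal.mul_lt_top hm₄t hnt, ?_⟩,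
        ENNReal.mul_lt_top hKt (hr _ hγ)⟩).ne
      exact ENNReal.mul_lt_top hKt (hr _ (by norm_num))
  have htail : Tendsto (fun N => errorConst d T b W.total * W.tail N ^ (1 / 2 : ℝ)) atTop (𝓝 0) := by
    have h1 := ((ENNReal.continuous_rpow_const (y := (1 / 2 : ℝ))).tendsto _).comp
      (tendsto_tail h.total_lt_top)
    rw [ENNReal.zero_rpow_of_pos (by norm_num)] at h1
    have h2 := ENNReal.Tendsto.const_mul (a := errorConst d T b W.total) h1
      (Or.inr (errorConst_lt_top hb T h.total_lt_top).ne)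
    rwa [mul_zero] at h2
  have hfin := le_of_tendsto_of_tendsto' (tendsto_energy_trunc hd (h.h1Sq_lt_top hb ht))
    ((tendsto_energy_trunc hd (h.h1Sq_lt_top hb ⟨le_rfl, hT⟩)).add (hlim.add htail)) hle
  rwa [add_zero] at hfin

end WaveData

end EnergyInequality

/-! ### A nonlinear Gronwall inequality -/

section Gronwall

/-- A form of Young's inequality in which `m ^ 4` has coefficient one, so that it can be absorbed;
it follows by comparing `m ^ 2` with `4 * x`. -/
lemma four_mul_mul_sq_le (x m : ℝ≥0∞) : 4 * (x * m ^ 2) ≤ m ^ 4 + 16 * x ^ 2 := by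
  rcases le_total (m ^ 2) (4 * x) with h | h
  · calc 4 * (x * m ^ 2) ≤ 4 * (x * (4 * x)) := by gcongr
      _ = 16 * x ^ 2 := by ring
      _ ≤ _ := le_add_self
  · calc 4 * (x * m ^ 2) = 4 * x * m ^ 2 := by ring
      _ ≤ m ^ 2 * m ^ 2 := by gcongr
      _ = m ^ 4 := by ring
      _ ≤ _ := le_self_add

lemma four_mul_mul_cube_le (x m : ℝ≥0∞) : 4 * (x * m ^ 3) ≤ m ^ 4 + 256 * x ^ 4 := by
  rcases le_total m (4 * x) with h | h
  · calc 4 * (x * m ^ 3) ≤ 4 * (x * (4 * x) ^ 3) := by gcongr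
      _ = 256 * x ^ 4 := by ring
      _ ≤ _ := le_add_self
  · calc 4 * (x * m ^ 3) = 4 * x * m ^ 3 := by ring
      _ ≤ m * m ^ 3 := by gcongr
      _ = m ^ 4 := by ring
      _ ≤ _ := le_self_add

lemma lintegral_exp_le {l t : ℝ} (hl : 0 < l) (ht : 0 ≤ t) :
    ∫⁻ s in Ioo 0 t, ENNReal.ofReal (Real.exp (l * s)) ≤ ENNReal.ofReal (l⁻¹ * Real.exp (l * t)) := by
  have hc : Continuous fun s => Real.exp (l * s) := by fun_prop
  rw [← ofReal_integral_eq_lintegral_ofReal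
    ((hc.integrableOn_Icc (a := 0) (b := t)).mono_set Ioo_subset_Icc_self)
    (ae_of_all _ fun s => (Real.exp_pos _).le), ← integral_Ioc_eq_integral_Ioo,
    ← intervalIntegral.integral_of_le ht, intervalIntegral.integral_comp_mul_left _ hl.ne',
    integral_exp, smul_eq_mul]
  refine ENNReal.ofReal_le_ofReal (mul_le_mul_of_nonneg_left ?_ (inv_nonneg.mpr hl.le))
  linarith [Real.exp_pos (l * 0)]

lemma lintegral_sqrt_le {T t : ℝ} (htT : t ≤ T) {γ : ℝ → ℝ≥0∞}
    (hγ : AEMeasurable γ (volume.restrict (Ioo 0 T))) :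
    ∫⁻ s in Ioo 0 t, γ s ^ (1 / 2 : ℝ) ≤
      (∫⁻ s in Ioo 0 T, γ s) ^ (1 / 2 : ℝ) * ENNReal.ofReal T ^ (1 / 2 : ℝ) := by
  have h := lintegral_mul_le_sqrt (hγ.pow_const (1 / 2 : ℝ))
    (aemeasurable_const (b := (1 : ℝ≥0∞)))
  have hsq : ∀ z : ℝ≥0∞, (z ^ (1 / 2 : ℝ)) ^ 2 = z := fun z => by rw [sq, sqrt_mul_self_ennreal]
  simp only [hsq, mul_one, one_pow, setLIntegral_const, one_mul, Real.volume_Ioo, sub_zero] at h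
  exact (lintegral_mono_set (Ioo_subset_Ioo_right htT)).trans h

/-- A Gronwall inequality with the sublinear terms `G^{1/2}` and `G^{3/4}`. -/
lemma gronwall_sublinear {c₁ c₂ : ℝ≥0∞} (hc₁ : c₁ < ⊤) (hc₂ : c₂ < ⊤) (T : ℝ) :
    ∃ C : ℝ≥0∞, C < ⊤ ∧ ∀ (G γ : ℝ → ℝ≥0∞) (B : ℝ≥0∞), B < ⊤ → (∀ t ∈ Icc 0 T, G t ≤ B) →
      AEMeasurable γ (volume.restrict (Ioo 0 T)) →
      (∀ t ∈ Icc 0 T, G t ≤ G 0 + ∫⁻ s in Ioo 0 t,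
        (c₁ * G s + c₂ * (G s ^ (1 / 2 : ℝ) + G s ^ (3 / 4 : ℝ)) * γ s ^ (1 / 2 : ℝ))) →
      ∀ t ∈ Icc 0 T, G t ≤ C * (G 0 + ((∫⁻ s in Ioo 0 T, γ s) ^ (1 / 2 : ℝ)) ^ 2 +
        ((∫⁻ s in Ioo 0 T, γ s) ^ (1 / 2 : ℝ)) ^ 4) := by
  -- In the weighted supremum of `e^{-lt} G(t)` the linear term contributes at most `c₁ / l ≤ 1/4`
  -- of the supremum. The `+ 1` keeps `l` positive when `c₁` vanishes.
  set l : ℝ := 4 * (c₁.toReal + 1) with hl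
  have hl0 : 0 < l := by positivity
  set e : ℝ → ℝ≥0∞ := fun t => ENNReal.ofReal (Real.exp (l * t)) with he
  set w : ℝ → ℝ≥0∞ := fun t => ENNReal.ofReal (Real.exp (-(l * t))) with hw
  have hew : ∀ t, e t * w t = 1 := fun t => by
    rw [he, hw, ← ENNReal.ofReal_mul (Real.exp_pos _).le, ← Real.exp_add, add_neg_cancel,
      Real.exp_zero, ENNReal.ofReal_one]
  have hw1 : ∀ t, 0 ≤ t → w t ≤ 1 := fun t ht => by
    rw [hw, ← ENNReal.ofReal_one]
    exact ENNReal.ofReal_le_ofReal (Real.exp_le_one_iff.mpr (by nlinarith))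
  have he1 : ∀ t, 0 ≤ t → 1 ≤ e t := fun t ht => by
    rw [he, ← ENNReal.ofReal_one]
    exact ENNReal.ofReal_le_ofReal (Real.one_le_exp (by positivity))
  have hmono : ∀ t, t ≤ T → e t ≤ e T := fun t ht =>
    ENNReal.ofReal_le_ofReal (Real.exp_le_exp.mpr (by gcongr))
  set D : ℝ≥0∞ := c₂ * e T * ENNReal.ofReal T ^ (1 / 2 : ℝ) with hD
  have hDt : D < ⊤ := ENNReal.mul_lt_top (ENNReal.mul_lt_top hc₂ ENNReal.ofReal_lt_top)
    (ENNReal.rpow_lt_top_of_nonneg (by norm_num) ENNReal.ofReal_ne_top)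
  refine ⟨e T * (4 + 16 * D ^ 2 + 256 * D ^ 4), ENNReal.mul_lt_top ENNReal.ofReal_lt_top
    (by finiteness), fun G γ B hB hGB hγ hG t ht => ?_⟩
  set Γ := (∫⁻ s in Ioo 0 T, γ s) ^ (1 / 2 : ℝ) with hΓ
  -- The bound `B` is used only to make `M` finite, so that multiples of it can be cancelled; it
  -- does not enter the constant.
  set M : ℝ≥0∞ := ⨆ s ∈ Icc 0 T, w s * G s with hM
  have hMB : M ≤ B := iSup₂_le fun s hs =>
    (mul_le_mul' (hw1 s hs.1) (hGB s hs)).trans_eq (one_mul _)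
  have hMt : M < ⊤ := hMB.trans_lt hB
  have hGM : ∀ s ∈ Icc 0 T, G s ≤ e s * M := fun s hs => by
    calc G s = e s * (w s * G s) := by rw [← mul_assoc, hew, one_mul]
      _ ≤ e s * M := mul_le_mul_right (le_iSup₂ (f := fun s (_ : s ∈ Icc 0 T) => w s * G s) s hs) _
  -- In terms of the fourth root the powers `1/2`, `3/4` and `1` of `M` become `m²`, `m³` and `m⁴`.
  set m := M ^ (1 / 4 : ℝ) with hm
  have hmp : ∀ n : ℕ, m ^ n = M ^ ((n : ℝ) / 4) := fun n => by
    rw [hm, ← ENNReal.rpow_natCast, ← ENNReal.rpow_mul]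
    congr 1; ring
  have hm2 : M ^ (1 / 2 : ℝ) = m ^ 2 := by rw [hmp]; norm_num
  have hm3 : M ^ (3 / 4 : ℝ) = m ^ 3 := by rw [hmp]; norm_num
  have hm4 : m ^ 4 = M := by rw [hmp]; norm_num
  have hpow : ∀ s ∈ Icc 0 T, ∀ p : ℝ, 0 ≤ p → p ≤ 1 → G s ^ p ≤ e T * M ^ p := fun s hs p h0 h1 => by
    refine (ENNReal.rpow_le_rpow (hGM s hs) h0).trans ?_
    rw [ENNReal.mul_rpow_of_nonneg _ _ h0]
    gcongr
    calc e s ^ p ≤ e s ^ (1 : ℝ) := ENNReal.rpow_le_rpow_of_exponent_le (he1 s hs.1) h1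
      _ = e s := ENNReal.rpow_one _
      _ ≤ e T := hmono s hs.2
  have hstep : ∀ r ∈ Icc 0 T, 4 * (w r * G r) ≤
      4 * G 0 + (M + 4 * (D * Γ * m ^ 2) + 4 * (D * Γ * m ^ 3)) := by
    intro r hr
    have hlin : c₁ * ∫⁻ s in Ioo 0 r, e s ≤ e r * 4⁻¹ := by
      calc c₁ * ∫⁻ s in Ioo 0 r, e s ≤ c₁ * ENNReal.ofReal (l⁻¹ * Real.exp (l * r)) :=
            mul_le_mul_right (lintegral_exp_le hl0 hr.1) _
        _ = ENNReal.ofReal (c₁.toReal * (l⁻¹ * Real.exp (l * r))) := by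
            rw [ENNReal.ofReal_mul ENNReal.toReal_nonneg, ENNReal.ofReal_toReal hc₁.ne]
        _ ≤ ENNReal.ofReal (Real.exp (l * r) * 4⁻¹) := by
            refine ENNReal.ofReal_le_ofReal ?_
            have h1 : c₁.toReal * l⁻¹ ≤ 4⁻¹ := by
              rw [← div_eq_mul_inv, div_le_iff₀ hl0, hl]
              linarith
            calc _ = c₁.toReal * l⁻¹ * Real.exp (l * r) := by ring
              _ ≤ 4⁻¹ * Real.exp (l * r) := by gcongr
              _ = _ := by ring
        _ = e r * 4⁻¹ := by
            rw [ENNReal.ofReal_mul (Real.exp_pos _).le, ENNReal.ofReal_inv_of_pos (by norm_num)]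
            simp [he]
    have hint : ∫⁻ s in Ioo 0 r, (c₁ * G s +
        c₂ * (G s ^ (1 / 2 : ℝ) + G s ^ (3 / 4 : ℝ)) * γ s ^ (1 / 2 : ℝ)) ≤
        e r * 4⁻¹ * M + D * Γ * (m ^ 2 + m ^ 3) := by
      calc _ ≤ ∫⁻ s in Ioo 0 r, (c₁ * M * e s +
            c₂ * (e T * (m ^ 2 + m ^ 3)) * γ s ^ (1 / 2 : ℝ)) := by
            refine setLIntegral_mono' measurableSet_Ioo fun s hs => ?_
            have hsT : s ∈ Icc 0 T := ⟨hs.1.le, hs.2.le.trans hr.2⟩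
            rw [mul_add (e T), ← hm2, ← hm3, mul_assoc c₁, mul_comm M]
            gcongr
            · exact hGM s hsT
            · exact hpow s hsT _ (by norm_num) (by norm_num)
            · exact hpow s hsT _ (by norm_num) (by norm_num)
        _ = c₁ * M * (∫⁻ s in Ioo 0 r, e s) +
            c₂ * (e T * (m ^ 2 + m ^ 3)) * ∫⁻ s in Ioo 0 r, γ s ^ (1 / 2 : ℝ) := by
            have hme : Measurable e := by
              have : Continuous fun s => Real.exp (l * s) := by fun_prop
              exact this.measurable.ennreal_ofReal
            rw [lintegral_add_left (hme.const_mul _), lintegral_const_mul _ hme,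
              lintegral_const_mul'' _ ((hγ.mono_measure (Measure.restrict_mono
                (Ioo_subset_Ioo_right hr.2) le_rfl)).pow_const _)]
        _ ≤ c₁ * M * (∫⁻ s in Ioo 0 r, e s) +
            c₂ * (e T * (m ^ 2 + m ^ 3)) * (Γ * ENNReal.ofReal T ^ (1 / 2 : ℝ)) := by
            gcongr
            exact lintegral_sqrt_le hr.2 hγ
        _ = c₁ * (∫⁻ s in Ioo 0 r, e s) * M + D * Γ * (m ^ 2 + m ^ 3) := by
            rw [hD]; ring
        _ ≤ _ := by gcongr
    have h4 : (4 : ℝ≥0∞) * 4⁻¹ = 1 := ENNReal.mul_inv_cancel (by norm_num) (by norm_num)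
    calc 4 * (w r * G r) ≤ 4 * (w r * (G 0 + (e r * 4⁻¹ * M + D * Γ * (m ^ 2 + m ^ 3)))) := by
          gcongr
          exact (hG r hr).trans (add_le_add le_rfl hint)
      _ = 4 * (w r * G 0) + ((e r * w r) * (4 * 4⁻¹) * M + w r * (4 * (D * Γ * m ^ 2) +
          4 * (D * Γ * m ^ 3))) := by ring
      _ ≤ 4 * (1 * G 0) + (1 * 1 * M + 1 * (4 * (D * Γ * m ^ 2) + 4 * (D * Γ * m ^ 3))) := by
          rw [hew, h4]
          gcongr <;> exact hw1 r hr.1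
      _ = _ := by ring
  have h4M : 4 * M ≤ 4 * G 0 + (M + 4 * (D * Γ * m ^ 2) + 4 * (D * Γ * m ^ 3)) := by
    rw [hM, ENNReal.mul_iSup]
    refine iSup_le fun s => ?_
    rw [ENNReal.mul_iSup]
    exact iSup_le fun hs => hstep s hs
  -- The linear term and the two applications of Young's inequality each cost one `M`. Of the four
  -- on the left, three are cancelled.
  have hMle : M ≤ 4 * G 0 + 16 * (D * Γ) ^ 2 + 256 * (D * Γ) ^ 4 := by
    have h3 : (3 : ℝ≥0∞) * M ≠ ⊤ := (ENNReal.mul_lt_top (by norm_num) hMt).ne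
    rw [← ENNReal.add_le_add_iff_left h3]
    calc 3 * M + M = 4 * M := by ring
      _ ≤ 4 * G 0 + (M + 4 * (D * Γ * m ^ 2) + 4 * (D * Γ * m ^ 3)) := h4M
      _ ≤ 4 * G 0 + (M + (m ^ 4 + 16 * (D * Γ) ^ 2) + (m ^ 4 + 256 * (D * Γ) ^ 4)) := by
          gcongr
          · exact four_mul_mul_sq_le _ _
          · exact four_mul_mul_cube_le _ _
      _ = _ := by rw [hm4]; ring
  calc G t ≤ e t * M := hGM t ht
    _ ≤ e T * (4 * G 0 + 16 * (D * Γ) ^ 2 + 256 * (D * Γ) ^ 4) := mul_le_mul' (hmono t ht.2) hMle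
    _ = e T * (4 * G 0 + 16 * D ^ 2 * Γ ^ 2 + 256 * D ^ 4 * Γ ^ 4) := by ring
    _ ≤ e T * ((4 + 16 * D ^ 2 + 256 * D ^ 4) * (G 0 + Γ ^ 2 + Γ ^ 4)) := by
        refine mul_le_mul_right ?_ _
        rw [mul_add, mul_add]
        gcongr
        · exact le_self_add.trans le_self_add
        · exact le_add_self.trans le_self_add
        · exact le_add_self
    _ = _ := by ring

end Gronwall

/-! ### The energy bound -/

section EnergyBound

variable {d : ℕ}

lemma h1Sq_le_energy {f : L2 d} (hf : h1Sq f < ⊤) :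
    h1Sq f ≤ 2 * (ENNReal.ofReal (vol d))⁻¹ * energy f := by
  have hv0 : ENNReal.ofReal (vol d) ≠ 0 := by simp [vol_pos d]
  have h2 : (2 : ℝ≥0∞) * (1 / 2) = 1 := ENNReal.mul_div_cancel (by norm_num) (by norm_num)
  calc h1Sq f = (2 * (1 / 2)) * ((ENNReal.ofReal (vol d))⁻¹ * ENNReal.ofReal (vol d)) * h1Sq f := by
        rw [h2, ENNReal.inv_mul_cancel hv0 ENNReal.ofReal_ne_top, one_mul, one_mul]
    _ = 2 * (ENNReal.ofReal (vol d))⁻¹ * (1 / 2 * (ENNReal.ofReal (vol d) * h1Sq f)) := by ring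
    _ ≤ _ := by
        gcongr
        rw [energy_eq_norm4 hf]
        exact le_self_add

lemma norm4_pow_le_energy {f : L2 d} (hf : h1Sq f < ⊤) : norm4 f ^ 4 ≤ 4 * energy f := by
  have h4 : (4 : ℝ≥0∞) * (1 / 4) = 1 := ENNReal.mul_div_cancel (by norm_num) (by norm_num)
  calc norm4 f ^ 4 = 4 * (1 / 4 * norm4 f ^ 4) := by rw [← mul_assoc, h4, one_mul]
    _ ≤ _ := by
        gcongr
        rw [energy_eq_norm4 hf]
        exact le_add_self

/-- The production rate of the energy is bounded in terms of the energy. -/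
lemma exists_production_le (d : ℕ) {m₁ m₄ : ℝ≥0∞} (hm₁ : m₁ < ⊤) (hm₄ : m₄ < ⊤) :
    ∃ c₁ c₂ : ℝ≥0∞, c₁ < ⊤ ∧ c₂ < ⊤ ∧ ∀ (f : L2 d) (γ : ℝ≥0∞), h1Sq f < ⊤ →
      production d m₁ m₄ (h1Sq f) (norm4 f) (norm4 f) γ 0 ≤ c₁ * energy f +
        c₂ * (energy f ^ (1 / 2 : ℝ) + energy f ^ (3 / 4 : ℝ)) * γ ^ (1 / 2 : ℝ) := by
  set V := ENNReal.ofReal (vol d) with hV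
  set α : ℝ≥0∞ := 2 * V⁻¹ with hα
  set K := embedConst' d with hK
  have hr : ∀ z : ℝ≥0∞, z < ⊤ → ∀ p : ℝ, 0 ≤ p → z ^ p < ⊤ := fun z hz p hp =>
    ENNReal.rpow_lt_top_of_nonneg hp hz.ne
  have hVt : V < ⊤ := ENNReal.ofReal_lt_top
  have hαt : α < ⊤ := ENNReal.mul_lt_top (by norm_num)
    (ENNReal.inv_ne_top.mpr (by simp [hV, vol_pos d])).lt_top
  refine ⟨V * ((2 * m₁) ^ (1 / 2 : ℝ) * α) + m₄ * 4,
    V * (2 * α) ^ (1 / 2 : ℝ) + 4 ^ (3 / 4 : ℝ) * K, ?_, ?_, fun f γ hf => ?_⟩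
  · exact ENNReal.add_lt_top.2 ⟨ENNReal.mul_lt_top hVt (ENNReal.mul_lt_top
      (hr _ (ENNReal.mul_lt_top (by norm_num) hm₁) _ (by norm_num)) hαt),
      ENNReal.mul_lt_top hm₄ (by norm_num)⟩
  · exact ENNReal.add_lt_top.2 ⟨ENNReal.mul_lt_top hVt
      (hr _ (ENNReal.mul_lt_top (by norm_num) hαt) _ (by norm_num)),
      ENNReal.mul_lt_top (hr _ (by norm_num) _ (by norm_num)) (embedConst'_lt_top d)⟩
  set G := energy f
  set h := h1Sq f
  set n := norm4 f
  have hh : h ≤ α * G := h1Sq_le_energy hf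
  have hn4 : n ^ 4 ≤ 4 * G := norm4_pow_le_energy hf
  have hn3 : n ^ 3 ≤ 4 ^ (3 / 4 : ℝ) * G ^ (3 / 4 : ℝ) := by
    rw [← ENNReal.mul_rpow_of_nonneg _ _ (by norm_num)]
    refine le_trans (le_of_eq ?_) (ENNReal.rpow_le_rpow hn4 (by norm_num : (0 : ℝ) ≤ 3 / 4))
    rw [← ENNReal.rpow_natCast n 4, ← ENNReal.rpow_mul, ← ENNReal.rpow_natCast n 3]
    norm_num
  have h1 : h ^ (1 / 2 : ℝ) * (2 * (m₁ * h + γ)) ^ (1 / 2 : ℝ) ≤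
      (2 * m₁) ^ (1 / 2 : ℝ) * α * G + (2 * α) ^ (1 / 2 : ℝ) * G ^ (1 / 2 : ℝ) * γ ^ (1 / 2 : ℝ) := by
    have e1 : (2 * (m₁ * h + γ)) ^ (1 / 2 : ℝ) ≤
        (2 * m₁) ^ (1 / 2 : ℝ) * h ^ (1 / 2 : ℝ) + (2 * γ) ^ (1 / 2 : ℝ) := by
      rw [mul_add, ← mul_assoc, ← ENNReal.mul_rpow_of_nonneg _ _ (by norm_num)]
      exact ENNReal.rpow_add_le_add_rpow _ _ (by norm_num) (by norm_num)
    calc _ ≤ h ^ (1 / 2 : ℝ) *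
          ((2 * m₁) ^ (1 / 2 : ℝ) * h ^ (1 / 2 : ℝ) + (2 * γ) ^ (1 / 2 : ℝ)) := by gcongr
      _ = (2 * m₁) ^ (1 / 2 : ℝ) * (h ^ (1 / 2 : ℝ) * h ^ (1 / 2 : ℝ)) +
          h ^ (1 / 2 : ℝ) * (2 * γ) ^ (1 / 2 : ℝ) := by ring
      _ ≤ (2 * m₁) ^ (1 / 2 : ℝ) * (α * G) + (α * G) ^ (1 / 2 : ℝ) * (2 * γ) ^ (1 / 2 : ℝ) := by
          rw [sqrt_mul_self_ennreal]
          gcongr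
      _ = _ := by
          rw [← ENNReal.mul_rpow_of_nonneg _ _ (by norm_num),
            ← ENNReal.mul_rpow_of_nonneg _ _ (by norm_num),
            ← ENNReal.mul_rpow_of_nonneg _ _ (by norm_num)]
          congr 1
          · ring
          · congr 1; ring
  have h2 : n ^ 3 * (m₄ * n + K * 0 ^ (1 / 2 : ℝ) + K * γ ^ (1 / 2 : ℝ)) ≤
      m₄ * 4 * G + 4 ^ (3 / 4 : ℝ) * K * G ^ (3 / 4 : ℝ) * γ ^ (1 / 2 : ℝ) := by
    rw [ENNReal.zero_rpow_of_pos (by norm_num), mul_zero, add_zero]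
    calc _ = m₄ * n ^ 4 + n ^ 3 * (K * γ ^ (1 / 2 : ℝ)) := by ring
      _ ≤ m₄ * (4 * G) + 4 ^ (3 / 4 : ℝ) * G ^ (3 / 4 : ℝ) * (K * γ ^ (1 / 2 : ℝ)) := by gcongr
      _ = _ := by ring
  set y := γ ^ (1 / 2 : ℝ)
  set g₂ := G ^ (1 / 2 : ℝ)
  set g₃ := G ^ (3 / 4 : ℝ)
  set q := (2 * α) ^ (1 / 2 : ℝ)
  set p := (4 : ℝ≥0∞) ^ (3 / 4 : ℝ)
  calc production d m₁ m₄ h n n γ 0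
      ≤ V * ((2 * m₁) ^ (1 / 2 : ℝ) * α * G + q * g₂ * y) + (m₄ * 4 * G + p * K * g₃ * y) :=
        add_le_add (mul_le_mul_right h1 V) h2
    -- The two missing cross products are added so that the terms with `y` factor as `(V q + p K)
    -- (g₂ + g₃) y`.
    _ ≤ V * ((2 * m₁) ^ (1 / 2 : ℝ) * α * G + q * g₂ * y) + (m₄ * 4 * G + p * K * g₃ * y) +
        (V * q * g₃ * y + p * K * g₂ * y) := le_self_add
    _ = _ := by ring

end EnergyBound

end DampedNLS

end

/-! ### Proof of the theorem -/

theorem proposition2p4 (d : ℕ) (hd : d = 1 ∨ d = 2 ∨ d = 3) (T : ℝ) (hT : 0 < T)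
    (a : DampedNLS.Torus d → ℝ) (ha : DampedNLS.IsSmooth a) :
    ∃ C : ℝ, 0 < C ∧
      ∀ (s b : ℝ), 1 ≤ s → b ∈ Ioo (1 / 2 : ℝ) 1 →
      ∀ (u₀ : DampedNLS.L2 d) (g u : ℝ → DampedNLS.L2 d),
        DampedNLS.MemSobolev s u₀ → DampedNLS.MemL2Sobolev T s g →
        DampedNLS.IsBourgainSolution T s b a g u₀ u →
        ∀ t ∈ Icc 0 T,
          DampedNLS.energy (u t) < ⊤ ∧
          DampedNLS.energy (u t) ≤ ENNReal.ofReal C *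
            (DampedNLS.energy (u 0) + DampedNLS.l2SobolevNorm T 1 g ^ 2 +
              DampedNLS.l2SobolevNorm T 1 g ^ 4) := by
  have hac : DampedNLS.IsSmooth fun x => (a x : ℂ) := Complex.ofRealCLM.contDiff.comp ha
  obtain ⟨m₁, hm₁t, hm₁⟩ := DampedNLS.exists_h1Sq_mulL2_le hac
  obtain ⟨m₄, hm₄t, hm₄⟩ := DampedNLS.exists_norm4_mulL2_le hac.continuous
  obtain ⟨c₁, c₂, hc₁, hc₂, hprod⟩ := DampedNLS.exists_production_le d hm₁t hm₄t
  obtain ⟨C, hC, hgron⟩ := DampedNLS.gronwall_sublinear hc₁ hc₂ T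
  -- The constant is fixed before `s`, `b` and the solution appear; the `+ 1` ensures that it is
  -- positive.
  refine ⟨C.toReal + 1, by positivity, fun s b hs hb u₀ g u _ hg hsol => ?_⟩
  have hg2 : ∫⁻ t in Ioo 0 T, DampedNLS.h1Sq (g t) < ⊤ := by
    have h1 := hg.2
    rw [DampedNLS.l2SobolevNorm, ENNReal.rpow_lt_top_iff_of_pos (by norm_num)] at h1
    exact (lintegral_mono fun t => DampedNLS.h1Sq_le_sobolevNormSq hs _).trans_lt h1
  obtain ⟨W, hW, hWu⟩ := DampedNLS.exists_waveData hT hs hb.1 hsol.memBourgain hsol.continuousOn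
  have h : W.Represents T u := ⟨hWu, hW⟩
  have hprim := fun k => DampedNLS.isPrimitive_coeff hd hT hb.1 h hac.continuous hg.1 hg2 hsol k
  have hfin : ∀ t ∈ Icc 0 T, DampedNLS.h1Sq (u t) < ⊤ := fun t ht => h.h1Sq_lt_top hb.1 ht
  -- The bound `B` built from `H` depends on `b` and on the solution. It gives the finiteness of the
  -- energy and the a priori boundedness required by the Gronwall argument, and nothing else.
  set H := DampedNLS.invMass b * W.total
  set B : ℝ≥0∞ := 1 / 2 * (ENNReal.ofReal (DampedNLS.vol d) * H) +
    1 / 4 * (DampedNLS.embedConst d * H ^ 2)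
  have hHt : H < ⊤ := h.bound_lt_top hb.1
  have hBt : B < ⊤ := ENNReal.add_lt_top.2
    ⟨ENNReal.mul_lt_top (by norm_num) (ENNReal.mul_lt_top ENNReal.ofReal_lt_top hHt),
      ENNReal.mul_lt_top (by norm_num) (ENNReal.mul_lt_top (DampedNLS.embedConst_lt_top d)
        (ENNReal.pow_lt_top hHt))⟩
  have hB : ∀ t ∈ Icc 0 T, DampedNLS.energy (u t) ≤ B := fun t ht => by
    rw [DampedNLS.energy_eq (hfin t ht)]
    have h1 := h.h1Sq_le ht
    have h2 : ∫⁻ x, ‖u t x‖ₑ ^ 4 ≤ DampedNLS.embedConst d * H ^ 2 :=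
      (DampedNLS.lintegral_pow_four_le hd (u t)).trans (by gcongr)
    exact add_le_add (mul_le_mul_right (mul_le_mul_right h1 _) _) (mul_le_mul_right h2 _)
  intro t ht
  refine ⟨(hB t ht).trans_lt hBt, ?_⟩
  have key := hgron (fun t => DampedNLS.energy (u t)) (fun t => DampedNLS.h1Sq (g t)) B hBt hB
    (DampedNLS.aemeasurable_h1Sq hg.1) (fun r hr => ?_) t ht
  · refine key.trans ?_
    simp only [DampedNLS.l2SobolevNorm, DampedNLS.sobolevNormSq_one]
    refine mul_le_mul_left ?_ _
    calc C = ENNReal.ofReal C.toReal := (ENNReal.ofReal_toReal hC.ne).symm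
      _ ≤ _ := ENNReal.ofReal_le_ofReal (by linarith)
  · refine (h.energy_le hd hb.1 hT.le hac.continuous hm₁t hm₄t hm₁ hm₄ hsol.continuousOn hg.1 hg2
      hprim hr).trans (add_le_add le_rfl ?_)
    exact setLIntegral_mono' measurableSet_Ioo fun r' hr' =>
      hprod _ _ (hfin r' ⟨hr'.1.le, hr'.2.le.trans hr.2⟩)
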